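/- **Setting.** Let $\lambda,\mu,\rho,\kappa,\gamma,\eta,\omega$ be real with $\mu>0$, $\lambda+\mu>0$, $\rho,\kappa,\omega>0$ and $\gamma\eta>0$. Put $q=i\omega/\kappa$, $\epsilon=\gamma\eta\kappa/(\lambda+2\mu)$, $k_p=\omega\sqrt{\rho/(\lambda+2\mu)}$, $k_s=\omega\sqrt{\rho/\mu}$, and let $k_1,k_2$ be complex numbers with positive real and imaginary parts, $k_1^2\ne k_2^2$, $k_1^2+k_2^2=q(1+\epsilon)+k_p^2$ and $k_1^2k_2^2=qk_p^2$. Let $\gamma_k(x,y)=\frac i4H^{(1)}_0(k|x-y|)$ for $x\neq y$ in $\mathbb R^2$, and let $\mathbb E=\begin{pmatrix}\mathbb E_{11}&E_{12}\\E_{21}^\top&E_{22}\end{pmatrix}$ with $$\mathbb E_{11}=\tfrac1\mu\gamma_{k_s}\mathbb I_2+\tfrac1{\rho\omega^2}\nabla_x\nabla_x^\top\Big[\gamma_{k_s}-\tfrac{k_p^2-k_2^2}{k_1^2-k_2^2}\gamma_{k_1}+\tfrac{k_p^2-k_1^2}{k_1^2-k_2^2}\gamma_{k_2}\Big],$$ $$E_{12}=\tfrac{i\omega\eta}{(k_1^2-k_2^2)(\lambda+2\mu)}\nabla_x[\gamma_{k_1}-\gamma_{k_2}],\qquad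 E_{21}=-\tfrac{\gamma}{(k_1^2-k_2^2)(\lambda+2\mu)}\nabla_x[\gamma_{k_1}-\gamma_{k_2}],$$ $$E_{22}=-\tfrac1{k_1^2-k_2^2}\big[(k_p^2-k_1^2)\gamma_{k_1}-(k_p^2-k_2^2)\gamma_{k_2}\big].$$ Let $\Gamma$ be a smooth simple open arc with a parametrization $\mathbf x:[-1,1]\to\mathbb R^2$ that is $C^\infty$ up to the endpoints, injective, and satisfies $\mathbf x'\neq0$. Let $D_s=|\mathbf x'|^{-1}\frac{d}{dt}$ be the tangential derivative and $\nu=(x_2',-x_1')^\top/|\mathbf x'|$ the unit normal. Let $w$ be a weight of the form $w(\mathbf x(t))=\sqrt{1-t^2}\,b(t)$ with $b$ smooth and positive on $[-1,1]$ (for example $b=1$), and let $D_s^w[v]=w^2D_s[v]+\frac v2D_s[w^2]$. Let $\mathbb A=\begin{pmatrix}0&-1\\1&0\end{pmatrix}$, $\mathbb J_{\nu_x,\nu_y}=\nu_y\nu_x^\top-\nu_x\nu_y^\top$ and $$T(\partial,\nu)u=2\mu\,\partial_\nu u+\lambda\nu\,\mathrm{div}\,u+\mu\,\nu\times\mathrm{curl}\,u,\qquad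 \nu\times\mathrm{curl}\,u=(\nu_2,-\nu_1)^\top(\partial_1u_2-\partial_2u_1).$$ Let $$\mathbb B_4=\begin{pmatrix}T(\partial,\nu)&-\gamma\nu\\0&-1\end{pmatrix},\qquad \mathbb B_4^*=\begin{pmatrix}T(\partial,\nu)&-i\omega\eta\nu\\0&-1\end{pmatrix}.$$ The weighted fourth-kind operator is $$V_4^w[\boldsymbol\psi](x)=\int_\Gamma\mathbb B_4(\partial_x,\nu_x)\big(\mathbb B_4^*(\partial_y,\nu_y)\mathbb E(x,y)\big)^\top\mathrm{diag}(w,w,w^{-1})(y)\,\boldsymbol\psi(y)\,ds_y,\qquad x\in\Gamma,$$ and $V_{4,11}^w,V_{4,12}^w,V_{4,21}^w$ are its blocks for the splitting $\boldsymbol\psi=(\boldsymbol\phi,\psi)$ into two components and one. The integral defining $V^w_{4,11}$ is a Hadamard finite part, and those defining $V^w_{4,12}$ and $V^w_{4,21}$ are Cauchy principal values. In both, the part of $\Gamma$ in a ball of radius $r$ about $x$ is removed and $r\to0^+$; for the finite part, a divergent term $a/r$ is subtracted first. Finally let $$C_j=\frac{i\omega\eta\gamma(k_p^2+k_j^2)-k_j^2(k_j^2-q)(\lambda+2\mu)}{k_1^2-k_2^2}\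 (j=1,2),\qquad C_3=\frac{2\mu}{k_1^2-k_2^2}\Big(\frac{i\omega\eta\gamma}{\lambda+2\mu}-k_2^2+q\Big),$$ $$\Phi=-2\mu\gamma_{k_s}+(2\mu-C_3)\gamma_{k_1}+C_3\gamma_{k_2},\qquad G=\gamma_{k_1}-\gamma_{k_2}.$$ **Theorem.** For densities $\boldsymbol\phi,\psi$ that are twice continuously differentiable on $[-1,1]$ as functions of $t$, and at every interior point of $\Gamma$, the finite part and the principal values exist and $$V_{4,11}^w[\boldsymbol\phi]=V_{4,11}^1[w\boldsymbol\phi]+D_sV_{4,11}^2[w^{-1}D_s^w\boldsymbol\phi]+V_{4,11}^3[w^{-1}D_s^w\boldsymbol\phi]+D_sV_{4,11}^4[w\boldsymbol\phi],$$ $$V_{4,12}^w[\psi]=V_{4,12}^1[w^{-1}\psi]+D_sV_{4,12}^2[w^{-1}\psi],$$ $$V_{4,21}^w[\boldsymbol\phi]=V_{4,21}^1[w\boldsymbol\phi]+V_{4,21}^2[w^{-1}D_s^w\boldsymbol\phi],$$ where $$V_{4,11}^1[\phi]=-\rho\omega^2\!\int_\Gamma\gamma_{k_s}\big(\nu_x\nu_y^\top-\nu_x^\top\nu_y\mathbb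 I_2-\mathbb J_{\nu_x,\nu_y}\big)\phi\,ds_y-\int_\Gamma[C_1\gamma_{k_1}-C_2\gamma_{k_2}]\nu_x\nu_y^\top\phi\,ds_y,$$ $$V_{4,11}^2[\phi]=\int_\Gamma\big[4\mu\gamma_{k_s}\mathbb I_2+4\mu^2\mathbb A\mathbb E_{11}\mathbb A\big]\phi\,ds_y,$$ $$V_{4,11}^3[\phi]=\int_\Gamma\nu_x\nabla_x^\top\Phi\,\mathbb A\,\phi\,ds_y,\qquad V_{4,11}^4[\phi]=\int_\Gamma\mathbb A\nabla_y\Phi\,\nu_y^\top\phi\,ds_y,$$ $$V_{4,12}^1[\psi]=-\tfrac{\gamma k_p^2}{k_1^2-k_2^2}\int_\Gamma\nu_x\,G\,\psi\,ds_y,\qquad V_{4,12}^2[\psi]=\tfrac{2\mu\gamma}{(\lambda+2\mu)(k_1^2-k_2^2)}\int_\Gamma\mathbb A\nabla_xG\,\psi\,ds_y,$$ $$V_{4,21}^1[\phi]=-\tfrac{i\omega\eta k_p^2}{k_1^2-k_2^2}\int_\Gamma G\,\nu_y^\top\phi\,ds_y,\qquad V_{4,21}^2[\phi]=-\tfrac{2i\omega\eta\mu}{(\lambda+2\mu)(k_1^2-k_2^2)}\int_\Gamma\nabla_x^\top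 G\,\mathbb A\,\phi\,ds_y.$$ The kernels of these eight operators are at most weakly singular: each is continuous for $x\ne y$ in the arc without its endpoints, and bounded there by $C|x-y|^{-\alpha}$ for some $C$ and some $0\le\alpha<1$. In the three formulas all integrals on the right converge absolutely, and the functions to which $D_s$ is applied outside an integral are differentiable. -/

import Mathlib

open Set Filter Topology MeasureTheory Matrix
open scoped ContDiff

noncomputable section

namespace ThermoArc

/-! ### Hankel function and Helmholtz fundamental solution -/

/-- The Bessel function of the first kind of order zero (power series). -/
def besselJ0 (z : ℂ) : ℂ :=
  ∑' m : ℕ, (-1) ^ m * (z / 2) ^ (2 * m) / ((m.factorial : ℂ) ^ 2)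

/-- The Bessel function of the second kind of order zero (series with logarithmic term,
principal branch). -/
def besselY0 (z : ℂ) : ℂ :=
  (2 / (Real.pi : ℂ)) *
    ((Complex.log (z / 2) + (Real.eulerMascheroniConstant : ℂ)) * besselJ0 z
      - ∑' m : ℕ, (-1) ^ m * ((harmonic m : ℚ) : ℂ) * (z / 2) ^ (2 * m)
          / ((m.factorial : ℂ) ^ 2))

/-- The Hankel function of the first kind of order zero. -/
def hankelH0 (z : ℂ) : ℂ := besselJ0 z + Complex.I * besselY0 z

/-- Points of the Euclidean plane. -/
abbrev Pt := EuclideanSpace ℝ (Fin 2)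

/-- The fundamental solution `γ_k(x, y)` of the Helmholtz equation with wavenumber `k`. -/
def helmholtz (k : ℂ) (x y : Pt) : ℂ := Complex.I / 4 * hankelH0 (k * (‖x - y‖ : ℂ))

/-! ### First order differential operators in the plane -/

/-- Partial derivative in the `j`-th coordinate direction. -/
def pd (j : Fin 2) (f : Pt → ℂ) (x : Pt) : ℂ := fderiv ℝ f x (EuclideanSpace.single j 1)

/-- The gradient of a complex-valued function. -/
def grad (f : Pt → ℂ) (x : Pt) : Fin 2 → ℂ := fun j => pd j f x

/-- A real vector regarded as a complex one. -/
def toC (v : Pt) : Fin 2 → ℂ := fun i => ((v i : ℝ) : ℂ)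

/-- The divergence of a vector field. -/
def div2 (u : Pt → Fin 2 → ℂ) (x : Pt) : ℂ := ∑ l, pd l (fun z => u z l) x

/-- The scalar curl `∂₁ u₂ - ∂₂ u₁` of a plane vector field. -/
def curl2 (u : Pt → Fin 2 → ℂ) (x : Pt) : ℂ := pd 0 (fun z => u z 1) x - pd 1 (fun z => u z 0) x

/-- The derivative `(ν · ∇) u` of a vector field in the direction `ν`. -/
def normalDeriv (nu : Pt) (u : Pt → Fin 2 → ℂ) (x : Pt) : Fin 2 → ℂ :=
  fun i => ∑ j, toC nu j * pd j (fun z => u z i) x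

/-- The traction operator
`T(∂, ν) u = 2 μ ∂_ν u + λ ν div u + μ ν × curl u`, where in the plane
`ν × curl u = (ν₂, -ν₁) (∂₁ u₂ - ∂₂ u₁)`. -/
def traction (lam mu : ℝ) (nu : Pt) (u : Pt → Fin 2 → ℂ) (x : Pt) : Fin 2 → ℂ :=
  (2 * mu : ℂ) • normalDeriv nu u x + ((lam : ℂ) * div2 u x) • toC nu
    + ((mu : ℂ) * curl2 u x) • ![toC nu 1, -toC nu 0]

/-! ### The thermoelastic medium -/

/-- Lamé constants, density, thermal diffusivity, the two coupling constants and the frequency. -/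
structure Medium where
  lam : ℝ
  mu : ℝ
  rho : ℝ
  kappa : ℝ
  gam : ℝ
  eta : ℝ
  omega : ℝ
  mu_pos : 0 < mu
  lam_add_mu_pos : 0 < lam + mu
  rho_pos : 0 < rho
  kappa_pos : 0 < kappa
  coupling_pos : 0 < gam * eta
  omega_pos : 0 < omega

namespace Medium

variable (M : Medium)

/-- The thermoelastic coupling constant `ε = γ η κ / (λ + 2 μ)`. -/
def eps : ℝ := M.gam * M.eta * M.kappa / (M.lam + 2 * M.mu)

/-- `q = i ω / κ`. -/
def q : ℂ := Complex.I * M.omega / M.kappa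

/-- The longitudinal wavenumber `k_p`. -/
def kp : ℝ := M.omega * Real.sqrt (M.rho / (M.lam + 2 * M.mu))

/-- The transverse wavenumber `k_s`. -/
def ks : ℝ := M.omega * Real.sqrt (M.rho / M.mu)

/-- The coupling coefficient `i ω η`. -/
def iwe : ℂ := Complex.I * M.omega * M.eta

/-- `k₁, k₂` are the (distinct) elastothermal and thermoelastic wavenumbers: the roots, in the open
first quadrant, of the characteristic system. -/
structure IsWavenumberPair (k₁ k₂ : ℂ) : Prop where
  sum_sq : k₁ ^ 2 + k₂ ^ 2 = M.q * (1 + M.eps) + (M.kp : ℂ) ^ 2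
  prod_sq : k₁ ^ 2 * k₂ ^ 2 = M.q * (M.kp : ℂ) ^ 2
  re_pos₁ : 0 < k₁.re
  im_pos₁ : 0 < k₁.im
  re_pos₂ : 0 < k₂.re
  im_pos₂ : 0 < k₂.im
  ne : k₁ ^ 2 ≠ k₂ ^ 2

variable (k₁ k₂ : ℂ)

/-! ### Fundamental solution of the Biot system -/

/-- The scalar function whose Hessian enters `E₁₁`. -/
def hessPotential (x y : Pt) : ℂ :=
  helmholtz M.ks x y
    - ((M.kp : ℂ) ^ 2 - k₂ ^ 2) / (k₁ ^ 2 - k₂ ^ 2) * helmholtz k₁ x y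
    + ((M.kp : ℂ) ^ 2 - k₁ ^ 2) / (k₁ ^ 2 - k₂ ^ 2) * helmholtz k₂ x y

/-- `γ_{k₁} - γ_{k₂}`. -/
def helmholtzDiff (x y : Pt) : ℂ := helmholtz k₁ x y - helmholtz k₂ x y

def E11 (x y : Pt) : Matrix (Fin 2) (Fin 2) ℂ :=
  ((1 / (M.mu : ℂ)) * helmholtz M.ks x y) • (1 : Matrix (Fin 2) (Fin 2) ℂ)
    + (1 / ((M.rho : ℂ) * (M.omega : ℂ) ^ 2)) •
      Matrix.of fun i j => pd i (fun z => pd j (fun z' => M.hessPotential k₁ k₂ z' y) z) x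

def E12 (x y : Pt) : Fin 2 → ℂ :=
  (M.iwe / ((k₁ ^ 2 - k₂ ^ 2) * (M.lam + 2 * M.mu))) • grad (fun z => helmholtzDiff k₁ k₂ z y) x

def E21 (x y : Pt) : Fin 2 → ℂ :=
  (-((M.gam : ℂ) / ((k₁ ^ 2 - k₂ ^ 2) * (M.lam + 2 * M.mu)))) •
    grad (fun z => helmholtzDiff k₁ k₂ z y) x

def E22 (x y : Pt) : ℂ :=
  -(1 / (k₁ ^ 2 - k₂ ^ 2)) *
    (((M.kp : ℂ) ^ 2 - k₁ ^ 2) * helmholtz k₁ x y - ((M.kp : ℂ) ^ 2 - k₂ ^ 2) * helmholtz k₂ x y)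

/-- Two displacement components followed by the temperature. -/
abbrev Idx := Fin 2 ⊕ Unit

/-- The full `3 × 3` fundamental matrix `E(x, y)`. -/
def E (x y : Pt) : Matrix Idx Idx ℂ :=
  Matrix.fromBlocks (M.E11 k₁ k₂ x y) (Matrix.of fun i _ => M.E12 k₁ k₂ x y i)
    (Matrix.of fun _ j => M.E21 k₁ k₂ x y j) (Matrix.of fun _ _ => M.E22 k₁ k₂ x y)

/-! ### Fourth-kind boundary operators and the kernel of `V₄` -/

/-- The boundary operator `[[T(∂, ν), -c ν], [0, -1]]` acting on a field `(u, p)`. -/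
def mixedOp (c : ℂ) (nu : Pt) (U : Pt → Idx → ℂ) (x : Pt) : Idx → ℂ :=
  Sum.elim
    (traction M.lam M.mu nu (fun z i => U z (Sum.inl i)) x - (c * U x (Sum.inr ())) • toC nu)
    (fun _ => -U x (Sum.inr ()))

/-- The operator `mixedOp` applied to every column of a matrix field. -/
def mixedOpMat (c : ℂ) (nu : Pt) (F : Pt → Matrix Idx Idx ℂ) (x : Pt) : Matrix Idx Idx ℂ :=
  Matrix.of fun i j => M.mixedOp c nu (fun z a => F z a j) x i

/-- `B₄(∂, ν)`, with `c = γ`. -/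
def B4 (nu : Pt) (F : Pt → Matrix Idx Idx ℂ) (x : Pt) : Matrix Idx Idx ℂ :=
  M.mixedOpMat M.gam nu F x

/-- The adjoint boundary operator `B₄*(∂, ν)`, with `c = i ω η`. -/
def B4star (nu : Pt) (F : Pt → Matrix Idx Idx ℂ) (x : Pt) : Matrix Idx Idx ℂ :=
  M.mixedOpMat M.iwe nu F x

/-- The kernel `B₄(∂_x, ν_x) (B₄*(∂_y, ν_y) E(x, y))ᵀ` of the fourth-kind operator. -/
def V4kernel (x y nx ny : Pt) : Matrix Idx Idx ℂ :=
  M.B4 nx (fun z => (M.B4star ny (fun z' => M.E k₁ k₂ z z') y)ᵀ) x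

/-! ### Constants and kernels of the regularized operators -/

def C1 : ℂ :=
  (M.iwe * M.gam * ((M.kp : ℂ) ^ 2 + k₁ ^ 2) - k₁ ^ 2 * (k₁ ^ 2 - M.q) * (M.lam + 2 * M.mu))
    / (k₁ ^ 2 - k₂ ^ 2)

def C2 : ℂ :=
  (M.iwe * M.gam * ((M.kp : ℂ) ^ 2 + k₂ ^ 2) - k₂ ^ 2 * (k₂ ^ 2 - M.q) * (M.lam + 2 * M.mu))
    / (k₁ ^ 2 - k₂ ^ 2)

def C3 : ℂ :=
  2 * M.mu / (k₁ ^ 2 - k₂ ^ 2) * (M.iwe * M.gam / (M.lam + 2 * M.mu) - k₂ ^ 2 + M.q)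

/-- The matrix `𝔸 = [[0, -1], [1, 0]]`. -/
def rot : Matrix (Fin 2) (Fin 2) ℂ := !![0, -1; 1, 0]

/-- `𝕁 = ν_y ν_xᵀ - ν_x ν_yᵀ`. -/
def Jmat (nx ny : Pt) : Matrix (Fin 2) (Fin 2) ℂ :=
  vecMulVec (toC ny) (toC nx) - vecMulVec (toC nx) (toC ny)

/-- `-2 μ γ_{k_s} + (2 μ - C₃) γ_{k₁} + C₃ γ_{k₂}`. -/
def mixedPotential (x y : Pt) : ℂ :=
  -2 * M.mu * helmholtz M.ks x y + (2 * M.mu - M.C3 k₁ k₂) * helmholtz k₁ x y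
    + M.C3 k₁ k₂ * helmholtz k₂ x y

def K11_1 (x y nx ny : Pt) : Matrix (Fin 2) (Fin 2) ℂ :=
  (-((M.rho : ℂ) * (M.omega : ℂ) ^ 2) * helmholtz M.ks x y) •
      (vecMulVec (toC nx) (toC ny) - (toC nx ⬝ᵥ toC ny) • (1 : Matrix (Fin 2) (Fin 2) ℂ)
        - Jmat nx ny)
    - (M.C1 k₁ k₂ * helmholtz k₁ x y - M.C2 k₁ k₂ * helmholtz k₂ x y) •
        vecMulVec (toC nx) (toC ny)

def K11_2 (x y _nx _ny : Pt) : Matrix (Fin 2) (Fin 2) ℂ :=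
  (4 * M.mu * helmholtz M.ks x y) • (1 : Matrix (Fin 2) (Fin 2) ℂ)
    + (4 * (M.mu : ℂ) ^ 2) • (rot * M.E11 k₁ k₂ x y * rot)

def K11_3 (x y nx _ny : Pt) : Matrix (Fin 2) (Fin 2) ℂ :=
  vecMulVec (toC nx) (grad (fun z => M.mixedPotential k₁ k₂ z y) x) * rot

def K11_4 (x y _nx ny : Pt) : Matrix (Fin 2) (Fin 2) ℂ :=
  vecMulVec (rot *ᵥ grad (fun z => M.mixedPotential k₁ k₂ x z) y) (toC ny)

def K12_1 (x y nx _ny : Pt) : Matrix (Fin 2) Unit ℂ :=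
  Matrix.of fun i _ =>
    -((M.gam : ℂ) * (M.kp : ℂ) ^ 2 / (k₁ ^ 2 - k₂ ^ 2)) * toC nx i * helmholtzDiff k₁ k₂ x y

def K12_2 (x y _nx _ny : Pt) : Matrix (Fin 2) Unit ℂ :=
  Matrix.of fun i _ =>
    (2 * M.mu * M.gam / ((M.lam + 2 * M.mu) * (k₁ ^ 2 - k₂ ^ 2))) *
      (rot *ᵥ grad (fun z => helmholtzDiff k₁ k₂ z y) x) i

def K21_1 (x y _nx ny : Pt) : Matrix Unit (Fin 2) ℂ :=
  Matrix.of fun _ j =>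
    -(M.iwe * (M.kp : ℂ) ^ 2 / (k₁ ^ 2 - k₂ ^ 2)) * helmholtzDiff k₁ k₂ x y * toC ny j

def K21_2 (x y _nx _ny : Pt) : Matrix Unit (Fin 2) ℂ :=
  Matrix.of fun _ j =>
    -(2 * M.iwe * M.mu / ((M.lam + 2 * M.mu) * (k₁ ^ 2 - k₂ ^ 2))) *
      (grad (fun z => helmholtzDiff k₁ k₂ z y) x ᵥ* rot) j

end Medium

/-! ### Open arcs, tangential derivatives, weights -/

/-- A smooth, regular, simple open arc, given by its parametrization over `[-1, 1]`.
Functions on the arc are written as functions of the parameter. -/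
structure SmoothArc where
  x : ℝ → Pt
  smooth : ContDiffOn ℝ ∞ x (Icc (-1) 1)
  simple : InjOn x (Icc (-1) 1)
  regular : ∀ t ∈ Icc (-1 : ℝ) 1, derivWithin x (Icc (-1) 1) t ≠ 0

namespace SmoothArc

variable (Γ : SmoothArc)

/-- The arc length element `|x'(t)|`. -/
def speed (t : ℝ) : ℝ := ‖deriv Γ.x t‖

/-- The unit normal `ν = (x₂', -x₁') / |x'|`, so that `D_s = ν₁ ∂₂ - ν₂ ∂₁`. -/
def normal (t : ℝ) : Pt := !₂[deriv Γ.x t 1 / Γ.speed t, -(deriv Γ.x t 0) / Γ.speed t]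

/-- The tangential derivative `D_s`. -/
def Ds {F : Type*} [NormedAddCommGroup F] [NormedSpace ℝ F] (f : ℝ → F) (t : ℝ) : F :=
  (Γ.speed t)⁻¹ • deriv f t

/-- The weighted tangential derivative `D_s^w[v] = w² D_s[v] + (v / 2) D_s[w²]`. -/
def Dsw {F : Type*} [NormedAddCommGroup F] [NormedSpace ℝ F] (w : ℝ → ℝ) (v : ℝ → F) (t : ℝ) : F :=
  (w t) ^ 2 • Γ.Ds v t + (Γ.Ds (fun s => (w s) ^ 2) t / 2) • v t

/-- A kernel depending on two points and the normals there, pulled back to the parameters. -/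
def pull {m n : Type*} (K : Pt → Pt → Pt → Pt → Matrix m n ℂ) (t τ : ℝ) : Matrix m n ℂ :=
  K (Γ.x t) (Γ.x τ) (Γ.normal t) (Γ.normal τ)

/-- The integrand of `∫_Γ K(x, y) φ(y) ds_y`, `x = x(t)`, `y = x(τ)`, as a function of `τ`. -/
def integrand {m n : Type*} [Fintype n] (K : ℝ → ℝ → Matrix m n ℂ) (φ : ℝ → n → ℂ) (t τ : ℝ) :
    m → ℂ :=
  Γ.speed τ • (K t τ *ᵥ φ τ)

/-- The (Lebesgue) integral operator `φ ↦ ∫_Γ K(x, y) φ(y) ds_y`. -/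
def op {m n : Type*} [Fintype m] [Fintype n] (K : ℝ → ℝ → Matrix m n ℂ) (φ : ℝ → n → ℂ) (t : ℝ) :
    m → ℂ :=
  ∫ τ in Ioo (-1 : ℝ) 1, Γ.integrand K φ t τ

/-- Absolute convergence of `∫_Γ K(x, y) φ(y) ds_y` at `x = x(t)`. -/
def Converges {m n : Type*} [Fintype m] [Fintype n] (K : ℝ → ℝ → Matrix m n ℂ) (φ : ℝ → n → ℂ)
    (t : ℝ) : Prop :=
  IntegrableOn (Γ.integrand K φ t) (Ioo (-1) 1)

/-- A kernel on the arc is at most weakly singular: it is continuous off the diagonal and bounded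
by a multiple of `|x - y|^(-α)` for some `α < 1`. -/
def IsWeaklySingular {m n : Type*} (K : ℝ → ℝ → Matrix m n ℂ) : Prop :=
  ContinuousOn (fun p : ℝ × ℝ => K p.1 p.2)
      {p | p.1 ∈ Ioo (-1 : ℝ) 1 ∧ p.2 ∈ Ioo (-1 : ℝ) 1 ∧ p.1 ≠ p.2} ∧
    ∃ C α : ℝ, 0 ≤ α ∧ α < 1 ∧ ∀ t ∈ Ioo (-1 : ℝ) 1, ∀ τ ∈ Ioo (-1 : ℝ) 1, t ≠ τ →
      ∀ i j, ‖K t τ i j‖ ≤ C * ‖Γ.x t - Γ.x τ‖ ^ (-α)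

/-- Parameters of the points of the arc at distance more than `r` from `x(t)`. -/
def outside (t r : ℝ) : Set ℝ := {τ ∈ Ioo (-1 : ℝ) 1 | r < ‖Γ.x t - Γ.x τ‖}

/-- `L` is the Cauchy principal value of `∫_Γ K(x, y) φ(y) ds_y` at `x = x(t)`. -/
def HasPV {m n : Type*} [Fintype m] [Fintype n] (K : ℝ → ℝ → Matrix m n ℂ) (φ : ℝ → n → ℂ)
    (t : ℝ) (L : m → ℂ) : Prop :=
  (∀ r > 0, IntegrableOn (Γ.integrand K φ t) (Γ.outside t r)) ∧
    Tendsto (fun r : ℝ => ∫ τ in Γ.outside t r, Γ.integrand K φ t τ) (𝓝[>] 0) (𝓝 L)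

/-- `L` is the Hadamard finite part of `∫_Γ K(x, y) φ(y) ds_y` at `x = x(t)`: what remains in the
limit after removal of the divergent term `a / r`. -/
def HasFP {m n : Type*} [Fintype m] [Fintype n] (K : ℝ → ℝ → Matrix m n ℂ) (φ : ℝ → n → ℂ)
    (t : ℝ) (L : m → ℂ) : Prop :=
  (∀ r > 0, IntegrableOn (Γ.integrand K φ t) (Γ.outside t r)) ∧
    ∃ a : m → ℂ, Tendsto
      (fun r : ℝ => (∫ τ in Γ.outside t r, Γ.integrand K φ t τ) - r⁻¹ • a) (𝓝[>] 0) (𝓝 L)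

/-- The kernel of the weighted operator `V₄^w[ψ] = V₄[𝕎₄ ψ]`, `𝕎₄ = diag(w, w, w⁻¹)`. The kernels
of `V_{4,11}^w`, `V_{4,12}^w`, `V_{4,21}^w` are its blocks. -/
def weightedKernel (M : Medium) (k₁ k₂ : ℂ) (w : ℝ → ℝ) (t τ : ℝ) :
    Matrix Medium.Idx Medium.Idx ℂ :=
  Γ.pull (M.V4kernel k₁ k₂) t τ *
    Matrix.diagonal (Sum.elim (fun _ => (w τ : ℂ)) (fun _ => (w τ : ℂ)⁻¹))

end SmoothArc

/-- A weight with the square-root behaviour at the two endpoints: `√(1 - t²)` times a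
smooth positive function on `[-1, 1]`. -/
def IsEdgeWeight (w : ℝ → ℝ) : Prop :=
  ∃ b : ℝ → ℝ, ContDiffOn ℝ ∞ b (Icc (-1) 1) ∧
    ∀ t ∈ Icc (-1 : ℝ) 1, 0 < b t ∧ w t = Real.sqrt (1 - t ^ 2) * b t

end ThermoArc

end

/-! Everything rests on the form of the fundamental solution near its pole: with `ρ = |x - y|²` one
has `γ_k = a_k(ρ) log ρ + b_k(ρ)`, where `a_k`, `b_k` are smooth and `a_k(0) = -1/(4π)` for every
`k` (`helmholtz_eq`, `logPart_eq`). A combination whose coefficients sum to zero therefore has a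
logarithmic coefficient vanishing at `ρ = 0`. Its first and second derivatives are then still at
most logarithmically singular along the arc: the only new factor, `z_i z_j / |z|²`, extends as a
`C¹` function of the two parameters (`isLogKernel_pd_pd`). This applies to the potential in `E₁₁`,
to `G` and to `Φ`, and makes all eight kernels logarithmic.

The pointwise identities are algebra. Off the diagonal every entry of the kernel is linear in
derivatives, of order at most four, of Helmholtz solutions. The equation reduces these derivatives
to five numbers per solution (`IsHelm.exists_jet`), and what remains is a polynomial identity.
`block_shear` treats `γ_{k_s}`, `block_potential` treats `γ_{k₁}` and `γ_{k₂}`, and `C₁`, `C₂`, `C₃`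
are the constants the latter demands. The outcome (`V4kernel₁₁_eq` and its two companions) is a
logarithmic kernel plus tangential derivatives, in `x`, in `y` or in both, of logarithmic kernels.

The analysis moves these derivatives. Outside a ball about `x` the derivative in `y` is integrated
by parts (`integral_cut_by_parts`). The weight vanishes at the tips, so they contribute nothing, and
the differentiated density is `D_s(w φ) = w⁻¹ D_s^w φ`. At the two cut points logarithmic boundary
terms cancel in the limit, because a ball cuts the arc asymptotically symmetrically
(`isCut_of_isBallCut`); a differentiated logarithm leaves `a / r + o(1)`, exactly the term that the
finite part discards (`IsCut.exists_tendsto_boundary_logKerDeriv`).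

The derivative in `x` leaves the integral because the derivative of a logarithmic integral is the
principal value of the differentiated kernel. For a `C¹` density with compact support the
substitution `τ = s + t` frees the logarithm of `t`, and an integration by parts returns to the
original kernel (`exists_hasDerivAt_integral_near`). The rest of the density vanishes near the point
and is handled by dominated convergence. -/

namespace ThermoArc

/-! ### Entire series with coefficients bounded by `1 / m!` -/

/-- Coefficient sequences dominated by those of the exponential series. -/
def ExpBounded (c : ℕ → ℂ) : Prop := ∀ m, ‖c m‖ ≤ 1 / (m.factorial : ℝ)

/-- The sum of the power series with coefficients `c`. -/
noncomputable def powerSum (c : ℕ → ℂ) (z : ℂ) : ℂ := ∑' m, c m * z ^ m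

/-- The coefficients of the derivative. -/
def derivCoeff (c : ℕ → ℂ) (m : ℕ) : ℂ := (m + 1) * c (m + 1)

/-- The bound `1 / m!` is stable under formal differentiation, since `(m + 1) / (m + 1)! = 1 / m!`;
one class of series thus carries all derivatives. -/
theorem ExpBounded.derivCoeff {c : ℕ → ℂ} (hc : ExpBounded c) : ExpBounded (derivCoeff c) := by
  intro m
  have h := hc (m + 1)
  have hm : ‖((m : ℂ) + 1)‖ = (m : ℝ) + 1 := by
    have : ((m : ℂ) + 1) = ((m + 1 : ℕ) : ℂ) := by push_cast; ring
    rw [this, Complex.norm_natCast]; push_cast; ring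
  rw [ThermoArc.derivCoeff, norm_mul, hm]
  refine (mul_le_mul_of_nonneg_left h (by positivity)).trans (le_of_eq ?_)
  rw [Nat.factorial_succ]
  have : (m.factorial : ℝ) ≠ 0 := by positivity
  push_cast
  field_simp

theorem ExpBounded.shift {c : ℕ → ℂ} (hc : ExpBounded c) : ExpBounded (fun m => c (m + 1)) := by
  intro m
  refine (hc (m + 1)).trans ?_
  apply one_div_le_one_div_of_le (by positivity)
  exact_mod_cast Nat.factorial_le (Nat.le_succ m)

theorem ExpBounded.norm_le {c : ℕ → ℂ} (hc : ExpBounded c) {z : ℂ} {R : ℝ} (hz : ‖z‖ ≤ R) (m : ℕ) :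
    ‖c m * z ^ m‖ ≤ R ^ m / m.factorial := by
  rw [norm_mul, norm_pow]
  calc _ ≤ 1 / (m.factorial : ℝ) * R ^ m := by
        gcongr
        exact hc m
    _ = _ := by ring

theorem ExpBounded.summable {c : ℕ → ℂ} (hc : ExpBounded c) (z : ℂ) :
    Summable fun m => c m * z ^ m :=
  .of_norm_bounded (Real.summable_pow_div_factorial ‖z‖) fun m => hc.norm_le le_rfl m

theorem ExpBounded.powerSum_eq {c : ℕ → ℂ} (hc : ExpBounded c) (z : ℂ) :
    powerSum c z = c 0 + z * powerSum (fun m => c (m + 1)) z := by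
  rw [powerSum, (hc.summable z).tsum_eq_zero_add, powerSum, ← tsum_mul_left]
  simp only [pow_zero, mul_one]
  congr 1
  refine tsum_congr fun m => ?_
  ring

theorem ExpBounded.hasDerivAt {c : ℕ → ℂ} (hc : ExpBounded c) (z : ℂ) :
    HasDerivAt (powerSum c) (powerSum (ThermoArc.derivCoeff c) z) z := by
  -- Any radius exceeding `‖z‖` would serve; the derived terms are dominated on the ball by `m
  -- R^(m-1) / m!`.
  set R := ‖z‖ + 1
  have h0 : Summable fun m : ℕ => R ^ m / (m.factorial : ℝ) := Real.summable_pow_div_factorial R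
  have hu : Summable fun m : ℕ => ((m : ℝ) * R ^ (m - 1)) / (m.factorial : ℝ) := by
    rw [← summable_nat_add_iff 1]
    refine h0.congr fun m => ?_
    rw [Nat.factorial_succ, Nat.add_sub_cancel]
    have : (m.factorial : ℝ) ≠ 0 := by positivity
    push_cast
    field_simp
  have hd : HasDerivAt (fun w => ∑' m, c m * w ^ m) (∑' m : ℕ, c m * (m * z ^ (m - 1))) z := by
    refine hasDerivAt_tsum_of_isPreconnected (t := Metric.ball 0 R) (y₀ := 0) hu
      Metric.isOpen_ball (convex_ball _ _).isPreconnected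
      (fun m y _ => (hasDerivAt_pow m y).const_mul (c m)) (fun m y hy => ?_)
      (Metric.mem_ball_self (by positivity)) (hc.summable 0) (by simp [R])
    have hy' : ‖y‖ ≤ R := by simpa using (Metric.mem_ball.1 hy).le
    rw [norm_mul, norm_mul, norm_pow, Complex.norm_natCast]
    calc _ ≤ 1 / (m.factorial : ℝ) * (m * R ^ (m - 1)) := by
          gcongr
          exact hc m
      _ = _ := by ring
  have hs : Summable fun m : ℕ => c m * (m * z ^ (m - 1)) := by
    rw [← summable_nat_add_iff 1]
    refine (hc.derivCoeff.summable z).congr fun m => ?_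
    simp only [ThermoArc.derivCoeff, Nat.add_sub_cancel]
    push_cast; ring
  refine HasDerivAt.congr_deriv hd ?_
  rw [hs.tsum_eq_zero_add, powerSum]
  simp only [Nat.cast_zero, zero_mul, mul_zero, zero_add, Nat.add_sub_cancel]
  refine tsum_congr fun m => ?_
  simp only [ThermoArc.derivCoeff]
  push_cast; ring

theorem ExpBounded.contDiff {c : ℕ → ℂ} (hc : ExpBounded c) : ContDiff ℂ ∞ (powerSum c) :=
  Differentiable.contDiff fun z => (hc.hasDerivAt z).differentiableAt

/-! ### The Bessel series in the variable `(z / 2) ^ 2` -/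

/-- Coefficients of `J₀` in the variable `(z / 2) ^ 2`. -/
noncomputable def jCoeff (m : ℕ) : ℂ := (-1) ^ m / ((m.factorial : ℂ) ^ 2)

/-- Coefficients of the harmonic-number series of `Y₀` in the variable `(z / 2) ^ 2`. -/
noncomputable def sCoeff (m : ℕ) : ℂ := (-1) ^ m * ((harmonic m : ℚ) : ℂ) / ((m.factorial : ℂ) ^ 2)

theorem expBounded_jCoeff : ExpBounded jCoeff := by
  intro m
  simp only [jCoeff, norm_div, norm_pow, norm_neg, norm_one, one_pow, Complex.norm_natCast]
  apply one_div_le_one_div_of_le (by positivity)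
  have : (1 : ℝ) ≤ m.factorial := by exact_mod_cast Nat.factorial_pos m
  nlinarith

theorem harmonic_bounds (m : ℕ) : 0 ≤ harmonic m ∧ harmonic m ≤ m := by
  induction m with
  | zero => simp
  | succ m ih =>
    rw [harmonic_succ]
    have h1 : ((m + 1 : ℕ) : ℚ)⁻¹ ≤ 1 := by
      apply inv_le_one_of_one_le₀; push_cast; linarith [(Nat.cast_nonneg m : (0 : ℚ) ≤ m)]
    have h0 : (0 : ℚ) ≤ ((m + 1 : ℕ) : ℚ)⁻¹ := by positivity
    refine ⟨by linarith [ih.1], ?_⟩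
    push_cast at *
    linarith [ih.2]

/-- `H_m ≤ m ≤ m!`, so one of the two factorials absorbs the harmonic number. -/
theorem expBounded_sCoeff : ExpBounded sCoeff := by
  intro m
  have hH : ‖((harmonic m : ℚ) : ℂ)‖ = ((harmonic m : ℚ) : ℝ) := by
    rw [show ((harmonic m : ℚ) : ℂ) = (((harmonic m : ℚ) : ℝ) : ℂ) by push_cast; rfl,
      Complex.norm_real, Real.norm_of_nonneg]
    exact_mod_cast (harmonic_bounds m).1
  have hle : ((harmonic m : ℚ) : ℝ) ≤ m.factorial := by
    calc ((harmonic m : ℚ) : ℝ) ≤ (m : ℝ) := by exact_mod_cast (harmonic_bounds m).2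
      _ ≤ m.factorial := by exact_mod_cast Nat.self_le_factorial m
  have hf : (0 : ℝ) < m.factorial := by positivity
  simp only [sCoeff, norm_div, norm_mul, norm_pow, norm_neg, norm_one, one_pow,
    Complex.norm_natCast, hH, one_mul]
  rw [div_le_div_iff₀ (by positivity) hf]
  nlinarith

theorem bessel_recurrence_j (m : ℕ) :
    ((m : ℂ) + 1) ^ 2 * jCoeff (m + 1) = -jCoeff m := by
  have hf : (m.factorial : ℂ) ≠ 0 := by exact_mod_cast Nat.factorial_ne_zero m
  have h1 : ((m : ℂ) + 1) ≠ 0 := by exact_mod_cast Nat.succ_ne_zero m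
  simp only [jCoeff, Nat.factorial_succ]
  push_cast
  field_simp
  ring

/-- The extra term comes from `H_{m+1} = H_m + 1 / (m + 1)`. It becomes the inhomogeneity `J'` in
`bessel_ode_s`, which cancels the cross term of the logarithm in `regPart_ode`. -/
theorem bessel_recurrence_s (m : ℕ) :
    ((m : ℂ) + 1) ^ 2 * sCoeff (m + 1) = -sCoeff m + ((m : ℂ) + 1) * jCoeff (m + 1) := by
  have hf : (m.factorial : ℂ) ≠ 0 := by exact_mod_cast Nat.factorial_ne_zero m
  have h1 : ((m : ℂ) + 1) ≠ 0 := by exact_mod_cast Nat.succ_ne_zero m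
  simp only [sCoeff, jCoeff, Nat.factorial_succ, harmonic_succ]
  push_cast
  field_simp
  ring

/-- The operator `w d²/dw² + d/dw` on power series. -/
theorem powerSum_bessel {c d : ℕ → ℂ} (hc : ExpBounded c)
    (h : ∀ m : ℕ, ((m : ℂ) + 1) ^ 2 * c (m + 1) = d m) (w : ℂ) :
    w * powerSum (derivCoeff (derivCoeff c)) w + powerSum (derivCoeff c) w = powerSum d w := by
  have h2 := (hc.derivCoeff.derivCoeff.summable w).mul_left w
  have h1 := hc.derivCoeff.summable w
  have hs : Summable fun m : ℕ => (m : ℂ) * (derivCoeff c m * w ^ m) := by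
    rw [← summable_nat_add_iff 1]
    refine h2.congr fun m => ?_
    simp only [derivCoeff]; push_cast; ring
  have e : w * powerSum (derivCoeff (derivCoeff c)) w
      = ∑' m : ℕ, (m : ℂ) * (derivCoeff c m * w ^ m) := by
    rw [hs.tsum_eq_zero_add, powerSum, ← tsum_mul_left]
    simp only [Nat.cast_zero, zero_mul, zero_add]
    refine tsum_congr fun m => ?_
    simp only [derivCoeff]; push_cast; ring
  rw [e, powerSum, powerSum, ← hs.tsum_add h1]
  refine tsum_congr fun m => ?_
  rw [← h m]
  simp only [derivCoeff]
  ring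

theorem bessel_ode_j (w : ℂ) :
    w * powerSum (derivCoeff (derivCoeff jCoeff)) w + powerSum (derivCoeff jCoeff) w
      = -powerSum jCoeff w := by
  rw [powerSum_bessel expBounded_jCoeff (fun m => bessel_recurrence_j m), powerSum, powerSum,
    ← tsum_neg]
  exact tsum_congr fun m => by ring

theorem bessel_ode_s (w : ℂ) :
    w * powerSum (derivCoeff (derivCoeff sCoeff)) w + powerSum (derivCoeff sCoeff) w
      = -powerSum sCoeff w + powerSum (derivCoeff jCoeff) w := by
  rw [powerSum_bessel expBounded_sCoeff (fun m => bessel_recurrence_s m), powerSum, powerSum,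
    powerSum, ← tsum_neg, ← ((expBounded_sCoeff.summable w).neg).tsum_add
      (expBounded_jCoeff.derivCoeff.summable w)]
  exact tsum_congr fun m => by simp only [derivCoeff]; ring

theorem besselJ0_eq (z : ℂ) : besselJ0 z = powerSum jCoeff ((z / 2) ^ 2) := by
  rw [besselJ0, powerSum]
  exact tsum_congr fun m => by rw [jCoeff, pow_mul]; ring

theorem besselY0_eq (z : ℂ) : besselY0 z = (2 / (Real.pi : ℂ)) *
    ((Complex.log (z / 2) + (Real.eulerMascheroniConstant : ℂ)) * powerSum jCoeff ((z / 2) ^ 2)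
      - powerSum sCoeff ((z / 2) ^ 2)) := by
  have h : ∑' m : ℕ, (-1) ^ m * ((harmonic m : ℚ) : ℂ) * (z / 2) ^ (2 * m)
      / ((m.factorial : ℂ) ^ 2) = powerSum sCoeff ((z / 2) ^ 2) :=
    tsum_congr fun m => by rw [sCoeff, pow_mul]; ring
  rw [besselY0, besselJ0_eq, h]

/-! ### The fundamental solution as a function of the squared distance -/

/-- The wavenumber factor in the argument of the power series. -/
noncomputable def waveFactor (k : ℂ) : ℂ := k ^ 2 / 4

/-- The coefficient of the logarithm in the fundamental solution. -/
noncomputable def logPart (k : ℂ) (ρ : ℝ) : ℂ :=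
  -(1 / (4 * (Real.pi : ℂ))) * powerSum jCoeff (waveFactor k * ρ)

/-- The difference quotient of `logPart` at zero. -/
noncomputable def logPartQuot (k : ℂ) (ρ : ℝ) : ℂ :=
  -(1 / (4 * (Real.pi : ℂ))) * waveFactor k * powerSum (fun m => jCoeff (m + 1)) (waveFactor k * ρ)

/-- The smooth part of the fundamental solution. -/
noncomputable def regPart (k : ℂ) (ρ : ℝ) : ℂ :=
  (Complex.I / 4 - 1 / (2 * (Real.pi : ℂ)) *
      (Complex.log (k / 2) + (Real.eulerMascheroniConstant : ℂ))) * powerSum jCoeff (waveFactor k * ρ)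
    + 1 / (2 * (Real.pi : ℂ)) * powerSum sCoeff (waveFactor k * ρ)

/-- The distance is a positive real, so `log (k |x - y| / 2)` splits on the principal branch, and
`log |x - y|` is half of `log |x - y|²`. That half turns the coefficient `-1/(2π)` into `-1/(4π)`.
-/
theorem helmholtz_eq {k : ℂ} (hk : k ≠ 0) {x y : Pt} (hxy : x ≠ y) :
    helmholtz k x y = logPart k (‖x - y‖ ^ 2) * (Real.log (‖x - y‖ ^ 2) : ℝ)
      + regPart k (‖x - y‖ ^ 2) := by
  have hr : 0 < ‖x - y‖ := norm_pos_iff.2 (sub_ne_zero.2 hxy)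
  have hlog : Complex.log (k * (‖x - y‖ : ℂ) / 2) = Real.log ‖x - y‖ + Complex.log (k / 2) := by
    rw [show k * (‖x - y‖ : ℂ) / 2 = (‖x - y‖ : ℂ) * (k / 2) by ring,
      Complex.log_ofReal_mul hr (div_ne_zero hk two_ne_zero)]
  have hw : (k * (‖x - y‖ : ℂ) / 2) ^ 2 = waveFactor k * ((‖x - y‖ ^ 2 : ℝ) : ℂ) := by
    rw [waveFactor]; push_cast; ring
  have hpi : (Real.pi : ℂ) ≠ 0 := by exact_mod_cast Real.pi_ne_zero
  rw [helmholtz, hankelH0, besselJ0_eq, besselY0_eq, hlog, hw, Real.log_pow, logPart, regPart]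
  push_cast
  field_simp
  linear_combination (4 * powerSum jCoeff (waveFactor k * (‖x - y‖ : ℂ) ^ 2) *
    (Real.log ‖x - y‖ + Complex.log (k / 2) + Real.eulerMascheroniConstant)
      - 4 * powerSum sCoeff (waveFactor k * (‖x - y‖ : ℂ) ^ 2)) * Complex.I_sq

theorem hasDerivAt_powerSum_wave {c : ℕ → ℂ} (hc : ExpBounded c) (κ : ℂ) (ρ : ℝ) :
    HasDerivAt (fun ρ : ℝ => powerSum c (κ * ρ)) (κ * powerSum (derivCoeff c) (κ * ρ)) ρ := by
  have h1 : HasDerivAt (fun z : ℂ => powerSum c (κ * z)) (powerSum (derivCoeff c) (κ * ρ) * κ) ρ :=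
    (hc.hasDerivAt (κ * ρ)).comp (ρ : ℂ) (by simpa using (hasDerivAt_id (ρ : ℂ)).const_mul κ)
  simpa [mul_comm] using h1.comp_ofReal

theorem contDiff_powerSum_wave {c : ℕ → ℂ} (hc : ExpBounded c) (κ : ℂ) :
    ContDiff ℝ ∞ (fun ρ : ℝ => powerSum c (κ * ρ)) :=
  (hc.contDiff.restrict_scalars ℝ).comp (contDiff_const.mul Complex.ofRealCLM.contDiff)

theorem contDiff_logPart (k : ℂ) : ContDiff ℝ ∞ (logPart k) :=
  contDiff_const.mul (contDiff_powerSum_wave expBounded_jCoeff _)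

theorem contDiff_logPartQuot (k : ℂ) : ContDiff ℝ ∞ (logPartQuot k) :=
  contDiff_const.mul (contDiff_powerSum_wave expBounded_jCoeff.shift _)

theorem contDiff_regPart (k : ℂ) : ContDiff ℝ ∞ (regPart k) :=
  (contDiff_const.mul (contDiff_powerSum_wave expBounded_jCoeff _)).add
    (contDiff_const.mul (contDiff_powerSum_wave expBounded_sCoeff _))

/-- The value at zero does not depend on `k`. This is what makes the leading logarithms cancel in
combinations whose coefficients sum to zero. -/
theorem logPart_eq (k : ℂ) (ρ : ℝ) :
    logPart k ρ = -(1 / (4 * (Real.pi : ℂ))) + ρ * logPartQuot k ρ := by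
  rw [logPart, logPartQuot, expBounded_jCoeff.powerSum_eq]
  simp only [jCoeff, pow_zero, Nat.factorial_zero, Nat.cast_one, one_pow, div_one]
  ring

theorem deriv_logPart (k : ℂ) : deriv (logPart k) = fun ρ : ℝ => -(1 / (4 * (Real.pi : ℂ))) *
    (waveFactor k * powerSum (derivCoeff jCoeff) (waveFactor k * ρ)) :=
  funext fun ρ => ((hasDerivAt_powerSum_wave expBounded_jCoeff (waveFactor k) ρ).const_mul _).deriv

theorem deriv_deriv_logPart (k : ℂ) (ρ : ℝ) : deriv (deriv (logPart k)) ρ =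
    -(1 / (4 * (Real.pi : ℂ))) * (waveFactor k * (waveFactor k *
      powerSum (derivCoeff (derivCoeff jCoeff)) (waveFactor k * ρ))) := by
  rw [deriv_logPart]
  exact (((hasDerivAt_powerSum_wave expBounded_jCoeff.derivCoeff (waveFactor k) ρ).const_mul
    _).const_mul _).deriv

theorem deriv_regPart (k : ℂ) : deriv (regPart k) = fun ρ : ℝ =>
    (Complex.I / 4 - 1 / (2 * (Real.pi : ℂ)) *
      (Complex.log (k / 2) + (Real.eulerMascheroniConstant : ℂ))) *
        (waveFactor k * powerSum (derivCoeff jCoeff) (waveFactor k * ρ))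
    + 1 / (2 * (Real.pi : ℂ)) * (waveFactor k * powerSum (derivCoeff sCoeff) (waveFactor k * ρ)) :=
  funext fun ρ => (((hasDerivAt_powerSum_wave expBounded_jCoeff (waveFactor k) ρ).const_mul _).add
    ((hasDerivAt_powerSum_wave expBounded_sCoeff (waveFactor k) ρ).const_mul _)).deriv

theorem deriv_deriv_regPart (k : ℂ) (ρ : ℝ) : deriv (deriv (regPart k)) ρ =
    (Complex.I / 4 - 1 / (2 * (Real.pi : ℂ)) *
      (Complex.log (k / 2) + (Real.eulerMascheroniConstant : ℂ))) *
        (waveFactor k * (waveFactor k *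
          powerSum (derivCoeff (derivCoeff jCoeff)) (waveFactor k * ρ)))
    + 1 / (2 * (Real.pi : ℂ)) * (waveFactor k * (waveFactor k *
          powerSum (derivCoeff (derivCoeff sCoeff)) (waveFactor k * ρ))) := by
  rw [deriv_regPart]
  exact ((((hasDerivAt_powerSum_wave expBounded_jCoeff.derivCoeff (waveFactor k) ρ).const_mul
    _).const_mul _).add (((hasDerivAt_powerSum_wave expBounded_sCoeff.derivCoeff
      (waveFactor k) ρ).const_mul _).const_mul _)).deriv

/-- The radial Helmholtz equation for the coefficient of the logarithm. -/
theorem logPart_ode (k : ℂ) (ρ : ℝ) :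
    ρ * deriv (deriv (logPart k)) ρ + deriv (logPart k) ρ = -waveFactor k * logPart k ρ := by
  rw [deriv_deriv_logPart, deriv_logPart, logPart]
  linear_combination -(1 / (4 * (Real.pi : ℂ))) * waveFactor k * bessel_ode_j (waveFactor k * ρ)

/-- The radial Helmholtz equation for the smooth part. -/
theorem regPart_ode (k : ℂ) (ρ : ℝ) :
    ρ * deriv (deriv (regPart k)) ρ + deriv (regPart k) ρ + 2 * deriv (logPart k) ρ
      = -waveFactor k * regPart k ρ := by
  rw [deriv_deriv_regPart, deriv_regPart, deriv_logPart, regPart]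
  linear_combination (Complex.I / 4 - 1 / (2 * (Real.pi : ℂ)) *
      (Complex.log (k / 2) + (Real.eulerMascheroniConstant : ℂ))) * waveFactor k *
        bessel_ode_j (waveFactor k * ρ)
    + 1 / (2 * (Real.pi : ℂ)) * waveFactor k * bessel_ode_s (waveFactor k * ρ)

/-! ### Calculus of partial derivatives -/

/-- Smoothness away from the origin. -/
def SmoothOff (F : Pt → ℂ) : Prop := ∀ z, z ≠ 0 → ContDiffAt ℝ ∞ F z

theorem SmoothOff.differentiableAt {F : Pt → ℂ} (hF : SmoothOff F) {z : Pt} (hz : z ≠ 0) :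
    DifferentiableAt ℝ F z := (hF z hz).differentiableAt (by simp)

theorem SmoothOff.add {F G : Pt → ℂ} (hF : SmoothOff F) (hG : SmoothOff G) :
    SmoothOff (fun z => F z + G z) := fun z hz => (hF z hz).add (hG z hz)

theorem SmoothOff.const_mul {F : Pt → ℂ} (hF : SmoothOff F) (c : ℂ) :
    SmoothOff (fun z => c * F z) := fun z hz => contDiffAt_const.mul (hF z hz)

theorem SmoothOff.sum {ι : Type*} {s : Finset ι} {F : ι → Pt → ℂ} (hF : ∀ i ∈ s, SmoothOff (F i)) :
    SmoothOff (fun z => ∑ i ∈ s, F i z) := fun z hz => ContDiffAt.sum fun i hi => hF i hi z hz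

theorem SmoothOff.pd {F : Pt → ℂ} (hF : SmoothOff F) (i : Fin 2) : SmoothOff (pd i F) := fun z hz =>
  ((hF z hz).fderiv_right (m := ∞) (by simp)).clm_apply contDiffAt_const

theorem SmoothOff.hasFDerivAt {F : Pt → ℂ} (hF : SmoothOff F) {z : Pt} (hz : z ≠ 0) :
    HasFDerivAt F (fderiv ℝ F z) z := (hF.differentiableAt hz).hasFDerivAt

theorem pd_congr {F G : Pt → ℂ} {z : Pt} (h : F =ᶠ[𝓝 z] G) (i : Fin 2) : pd i F z = pd i G z := by
  rw [pd, pd, h.fderiv_eq]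

theorem pd_add {F G : Pt → ℂ} {z : Pt} (hF : DifferentiableAt ℝ F z) (hG : DifferentiableAt ℝ G z)
    (i : Fin 2) : pd i (fun z => F z + G z) z = pd i F z + pd i G z := by
  simp only [pd]; rw [fderiv_fun_add hF hG]; rfl

theorem pd_const_mul {F : Pt → ℂ} {z : Pt} (hF : DifferentiableAt ℝ F z) (c : ℂ)
    (i : Fin 2) : pd i (fun z => c * F z) z = c * pd i F z := by
  simp only [pd]; rw [fderiv_const_mul hF]; rfl

theorem pd_comp_sub (F : Pt → ℂ) (x y : Pt) (i : Fin 2) :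
    pd i (fun z => F (z - y)) x = pd i F (x - y) := by
  rw [pd, pd, fderiv_comp_sub]

theorem pd_const_sub {F : Pt → ℂ} {x y : Pt} (hF : DifferentiableAt ℝ F (x - y)) (i : Fin 2) :
    pd i (fun z => F (x - z)) y = -pd i F (x - y) := by
  have h := hF.hasFDerivAt.comp y ((hasFDerivAt_id y).const_sub x)
  have e : (fun z => F (x - z)) = F ∘ HSub.hSub x := rfl
  simp only [pd, e]
  rw [h.fderiv]
  simp

theorem SmoothOff.pd_comm {F : Pt → ℂ} (hF : SmoothOff F) {z : Pt} (hz : z ≠ 0) (i j : Fin 2) :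
    ThermoArc.pd i (ThermoArc.pd j F) z = ThermoArc.pd j (ThermoArc.pd i F) z := by
  have hd : DifferentiableAt ℝ (fderiv ℝ F) z :=
    ((hF z hz).fderiv_right (m := ∞) (by simp)).differentiableAt (by simp)
  have key : ∀ i j : Fin 2, ThermoArc.pd i (ThermoArc.pd j F) z
      = fderiv ℝ (fderiv ℝ F) z (EuclideanSpace.single i 1) (EuclideanSpace.single j 1) := by
    intro i j
    have h := hd.hasFDerivAt.clm_apply (hasFDerivAt_const (EuclideanSpace.single j (1 : ℝ)) z)
    change fderiv ℝ (fun z => fderiv ℝ F z (EuclideanSpace.single j 1)) z _ = _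
    rw [h.fderiv]
    simp
  rw [key, key]
  exact (hF z hz).isSymmSndFDerivAt (by simpa using WithTop.coe_le_coe.2 (le_top : (2 : ℕ∞) ≤ ⊤)) _ _

/-- The punctured plane is open, so identities valid off the origin may be differentiated there,
repeatedly. -/
theorem pd_eq_of_eqOn {F G : Pt → ℂ} (h : ∀ z, z ≠ 0 → F z = G z) (i : Fin 2) :
    ∀ z, z ≠ 0 → pd i F z = pd i G z := fun _ hz =>
  pd_congr (Filter.eventually_of_mem (isOpen_ne.mem_nhds hz) fun w hw => h w hw) i

theorem fderiv_eq_pd (F : Pt → ℂ) (z v : Pt) : fderiv ℝ F z v = ∑ i, (v i : ℂ) * pd i F z := by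
  have hv : v = ∑ i, v i • EuclideanSpace.single i (1 : ℝ) := by
    ext j
    fin_cases j <;> simp [Fin.sum_univ_two]
  conv_lhs => rw [hv]
  rw [map_sum]
  refine Finset.sum_congr rfl fun i _ => ?_
  rw [map_smul, pd]
  simp

/-! ### Radial functions -/

theorem hasFDerivAt_radial {g : ℝ → ℂ} {g' : ℂ} {z : Pt} (h : HasDerivAt g g' (‖z‖ ^ 2)) :
    HasFDerivAt (fun z : Pt => g (‖z‖ ^ 2))
      (((2 : ℝ) • (innerSL ℝ z : Pt →L[ℝ] ℝ)).smulRight g') z := by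
  have h1 : HasFDerivAt (fun z : Pt => ‖z‖ ^ 2) ((2 : ℝ) • (innerSL ℝ z : Pt →L[ℝ] ℝ)) z := by
    simpa [two_smul] using (hasStrictFDerivAt_norm_sq z).hasFDerivAt
  refine (h.hasFDerivAt.comp z h1).congr_fderiv ?_
  ext v
  simp [mul_assoc]

theorem pd_radial {g : ℝ → ℂ} {g' : ℂ} {z : Pt} (h : HasDerivAt g g' (‖z‖ ^ 2)) (i : Fin 2) :
    pd i (fun z : Pt => g (‖z‖ ^ 2)) z = 2 * (z i : ℂ) * g' := by
  rw [pd, (hasFDerivAt_radial h).fderiv]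
  simp [EuclideanSpace.inner_single_right]

theorem hasFDerivAt_coord (i : Fin 2) (z : Pt) :
    HasFDerivAt (fun z : Pt => (z i : ℂ))
      (Complex.ofRealCLM ∘L (EuclideanSpace.proj i : Pt →L[ℝ] ℝ)) z :=
  (Complex.ofRealCLM ∘L (EuclideanSpace.proj i : Pt →L[ℝ] ℝ)).hasFDerivAt

theorem pd_coord_mul {G : Pt → ℂ} {z : Pt} (hG : DifferentiableAt ℝ G z) (i j : Fin 2) :
    pd j (fun z : Pt => 2 * (z i : ℂ) * G z) z
      = 2 * (if i = j then 1 else 0) * G z + 2 * (z i : ℂ) * pd j G z := by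
  have h := ((hasFDerivAt_coord i z).const_mul 2).mul hG.hasFDerivAt
  have e : (fun z : Pt => 2 * (z i : ℂ) * G z)
    = (fun z : Pt => (2 : ℂ) * (z i : ℂ)) * G := rfl
  simp only [pd]
  rw [e, h.fderiv]
  simp only [_root_.add_apply, _root_.smul_apply,
    ContinuousLinearMap.comp_apply, PiLp.proj_apply, smul_eq_mul]
  by_cases hij : i = j
  · simp [hij]; ring
  · simp [hij]

theorem norm_sq_pos {z : Pt} (hz : z ≠ 0) : 0 < ‖z‖ ^ 2 := by
  have := norm_pos_iff.2 hz
  positivity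

theorem contDiff_normSq : ContDiff ℝ ∞ (fun z : Pt => ‖z‖ ^ 2) := contDiff_norm_sq ℝ

/-- A radial function `a(|z|²) log |z|² + b(|z|²)` with smooth `a`, `b`, and `a(ρ) = c + ρ d(ρ)`. -/
structure LogForm (F : Pt → ℂ) (c : ℂ) (a d b : ℝ → ℂ) : Prop where
  contDiff_a : ContDiff ℝ ∞ a
  contDiff_d : ContDiff ℝ ∞ d
  contDiff_b : ContDiff ℝ ∞ b
  a_eq : ∀ ρ : ℝ, a ρ = c + ρ * d ρ
  eq : ∀ z, z ≠ 0 → F z = a (‖z‖ ^ 2) * (Real.log (‖z‖ ^ 2) : ℝ) + b (‖z‖ ^ 2)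

namespace LogForm

variable {F G : Pt → ℂ} {c c' : ℂ} {a d b a' d' b' : ℝ → ℂ}

theorem add (hF : LogForm F c a d b) (hG : LogForm G c' a' d' b') :
    LogForm (fun z => F z + G z) (c + c') (fun ρ => a ρ + a' ρ) (fun ρ => d ρ + d' ρ)
      (fun ρ => b ρ + b' ρ) where
  contDiff_a := hF.contDiff_a.add hG.contDiff_a
  contDiff_d := hF.contDiff_d.add hG.contDiff_d
  contDiff_b := hF.contDiff_b.add hG.contDiff_b
  a_eq ρ := by rw [hF.a_eq, hG.a_eq]; ring
  eq z hz := by rw [hF.eq z hz, hG.eq z hz]; ring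

theorem const_mul (hF : LogForm F c a d b) (r : ℂ) :
    LogForm (fun z => r * F z) (r * c) (fun ρ => r * a ρ) (fun ρ => r * d ρ)
      (fun ρ => r * b ρ) where
  contDiff_a := contDiff_const.mul hF.contDiff_a
  contDiff_d := contDiff_const.mul hF.contDiff_d
  contDiff_b := contDiff_const.mul hF.contDiff_b
  a_eq ρ := by rw [hF.a_eq]; ring
  eq z hz := by rw [hF.eq z hz]; ring

theorem smoothOff (hF : LogForm F c a d b) : SmoothOff F := by
  intro z hz
  have h1 : ContDiffAt ℝ ∞ (fun z : Pt => ‖z‖ ^ 2) z := contDiff_normSq.contDiffAt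
  have h2 : ContDiffAt ℝ ∞ (fun z : Pt => ((Real.log (‖z‖ ^ 2) : ℝ) : ℂ)) z :=
    Complex.ofRealCLM.contDiff.contDiffAt.comp z (h1.log (norm_sq_pos hz).ne')
  have h3 : ContDiffAt ℝ ∞
      (fun z => a (‖z‖ ^ 2) * (Real.log (‖z‖ ^ 2) : ℝ) + b (‖z‖ ^ 2)) z :=
    ((hF.contDiff_a.contDiffAt.comp z h1).mul h2).add (hF.contDiff_b.contDiffAt.comp z h1)
  exact h3.congr_of_eventuallyEq
    (Filter.eventually_of_mem (isOpen_ne.mem_nhds hz) fun w hw => hF.eq w hw)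

theorem hasDerivAt_log {ρ : ℝ} (hρ : 0 < ρ) :
    HasDerivAt (fun ρ : ℝ => ((Real.log ρ : ℝ) : ℂ)) ((ρ : ℂ)⁻¹) ρ := by
  simpa using (Real.hasDerivAt_log hρ.ne').ofReal_comp

theorem hasDerivAt_profile (ha : ContDiff ℝ ∞ a) (hb : ContDiff ℝ ∞ b) {ρ : ℝ} (hρ : 0 < ρ) :
    HasDerivAt (fun ρ : ℝ => a ρ * (Real.log ρ : ℝ) + b ρ)
      (deriv a ρ * (Real.log ρ : ℝ) + a ρ * (ρ : ℂ)⁻¹ + deriv b ρ) ρ :=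
  (((ha.differentiable (by simp) ρ).hasDerivAt.mul (hasDerivAt_log hρ)).add
    (hb.differentiable (by simp) ρ).hasDerivAt)

theorem pd_eq (hF : LogForm F c a d b) (i : Fin 2) {z : Pt} (hz : z ≠ 0) :
    pd i F z = 2 * (z i : ℂ) * (deriv a (‖z‖ ^ 2) * (Real.log (‖z‖ ^ 2) : ℝ)
      + a (‖z‖ ^ 2) * ((‖z‖ ^ 2 : ℝ) : ℂ)⁻¹ + deriv b (‖z‖ ^ 2)) := by
  rw [pd_eq_of_eqOn hF.eq i z hz]
  exact pd_radial (hasDerivAt_profile hF.contDiff_a hF.contDiff_b (norm_sq_pos hz)) i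

theorem contDiff_deriv {f : ℝ → ℂ} (hf : ContDiff ℝ ∞ f) : ContDiff ℝ ∞ (deriv f) :=
  (contDiff_infty_iff_deriv.1 hf).2

theorem pd_pd_eq (hF : LogForm F c a d b) (i j : Fin 2) {z : Pt} (hz : z ≠ 0) :
    pd j (pd i F) z = 2 * (if i = j then 1 else 0) *
      (deriv a (‖z‖ ^ 2) * (Real.log (‖z‖ ^ 2) : ℝ)
      + a (‖z‖ ^ 2) * ((‖z‖ ^ 2 : ℝ) : ℂ)⁻¹ + deriv b (‖z‖ ^ 2))
      + 4 * (z i : ℂ) * (z j : ℂ) * (deriv (deriv a) (‖z‖ ^ 2) * (Real.log (‖z‖ ^ 2) : ℝ)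
        + 2 * deriv a (‖z‖ ^ 2) * ((‖z‖ ^ 2 : ℝ) : ℂ)⁻¹
        - a (‖z‖ ^ 2) * (((‖z‖ ^ 2 : ℝ) : ℂ)⁻¹) ^ 2 + deriv (deriv b) (‖z‖ ^ 2)) := by
  rw [pd_eq_of_eqOn (fun w hw => hF.pd_eq i hw) j z hz]
  have hρ := norm_sq_pos hz
  have hinv : HasDerivAt (fun ρ : ℝ => (ρ : ℂ)⁻¹) (-(((‖z‖ ^ 2 : ℝ) : ℂ)⁻¹) ^ 2) (‖z‖ ^ 2) := by
    have h := (hasDerivAt_inv (x := ((‖z‖ ^ 2 : ℝ) : ℂ)) (by exact_mod_cast hρ.ne')).comp_ofReal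
    rw [inv_pow]
    exact h
  have h2 := (hasDerivAt_profile (contDiff_deriv hF.contDiff_a) (contDiff_deriv hF.contDiff_b)
    hρ).add (((hF.contDiff_a.differentiable (by simp) (‖z‖ ^ 2)).hasDerivAt).mul hinv)
  have h3 : HasDerivAt (fun ρ : ℝ => deriv a ρ * (Real.log ρ : ℝ) + a ρ * (ρ : ℂ)⁻¹ + deriv b ρ)
      (deriv (deriv a) (‖z‖ ^ 2) * (Real.log (‖z‖ ^ 2) : ℝ)
        + 2 * deriv a (‖z‖ ^ 2) * ((‖z‖ ^ 2 : ℝ) : ℂ)⁻¹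
        - a (‖z‖ ^ 2) * (((‖z‖ ^ 2 : ℝ) : ℂ)⁻¹) ^ 2 + deriv (deriv b) (‖z‖ ^ 2)) (‖z‖ ^ 2) := by
    refine (h2.congr_deriv ?_).congr_of_eventuallyEq (Eventually.of_forall fun ρ => ?_)
    · ring
    · simp only [Pi.add_apply, Pi.mul_apply]; ring
  rw [pd_coord_mul (hasFDerivAt_radial h3).differentiableAt i j, pd_radial h3 j]
  ring

/-- The first partial derivatives when the logarithm has no constant coefficient. -/
theorem pd_eq_of_zero (hF : LogForm F 0 a d b) (i : Fin 2) {z : Pt} (hz : z ≠ 0) :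
    pd i F z = 2 * (z i : ℂ) * (deriv a (‖z‖ ^ 2) * (Real.log (‖z‖ ^ 2) : ℝ)
      + d (‖z‖ ^ 2) + deriv b (‖z‖ ^ 2)) := by
  have h : ((‖z‖ ^ 2 : ℝ) : ℂ) ≠ 0 := by exact_mod_cast (norm_sq_pos hz).ne'
  rw [hF.pd_eq i hz, hF.a_eq]
  field_simp
  ring

/-- The second partial derivatives when the logarithm has no constant coefficient. -/
theorem pd_pd_eq_of_zero (hF : LogForm F 0 a d b) (i j : Fin 2) {z : Pt} (hz : z ≠ 0) :
    pd j (pd i F) z = 2 * (if i = j then 1 else 0) *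
      (deriv a (‖z‖ ^ 2) * (Real.log (‖z‖ ^ 2) : ℝ) + d (‖z‖ ^ 2) + deriv b (‖z‖ ^ 2))
      + 4 * (z i : ℂ) * (z j : ℂ) * (deriv (deriv a) (‖z‖ ^ 2) * (Real.log (‖z‖ ^ 2) : ℝ)
        + deriv (deriv b) (‖z‖ ^ 2))
      + 4 * ((z i : ℂ) * (z j : ℂ) * ((‖z‖ ^ 2 : ℝ) : ℂ)⁻¹) *
        (2 * deriv a (‖z‖ ^ 2) - d (‖z‖ ^ 2)) := by
  have h : ((‖z‖ ^ 2 : ℝ) : ℂ) ≠ 0 := by exact_mod_cast (norm_sq_pos hz).ne'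
  rw [hF.pd_pd_eq i j hz, hF.a_eq]
  field_simp
  ring

end LogForm

/-! ### The fundamental solution as a function of the difference -/

/-- The fundamental solution with pole at the origin. -/
noncomputable def fund (k : ℂ) (z : Pt) : ℂ := helmholtz k z 0

theorem helmholtz_eq_fund (k : ℂ) (x y : Pt) : helmholtz k x y = fund k (x - y) := by
  simp [fund, helmholtz]

theorem logForm_fund {k : ℂ} (hk : k ≠ 0) :
    LogForm (fund k) (-(1 / (4 * (Real.pi : ℂ)))) (logPart k) (logPartQuot k) (regPart k) where
  contDiff_a := contDiff_logPart k
  contDiff_d := contDiff_logPartQuot k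
  contDiff_b := contDiff_regPart k
  a_eq := logPart_eq k
  eq z hz := by
    rw [fund, helmholtz_eq hk hz, sub_zero]

theorem sum_coord_sq (z : Pt) : (z 0 : ℂ) ^ 2 + (z 1 : ℂ) ^ 2 = ((‖z‖ ^ 2 : ℝ) : ℂ) := by
  rw [EuclideanSpace.norm_sq_eq, Fin.sum_univ_two]
  simp

/-- The Helmholtz equation away from the pole. -/
theorem fund_helmholtz {k : ℂ} (hk : k ≠ 0) {z : Pt} (hz : z ≠ 0) :
    pd 1 (pd 1 (fund k)) z = -k ^ 2 * fund k z - pd 0 (pd 0 (fund k)) z := by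
  have hρ : ((‖z‖ ^ 2 : ℝ) : ℂ) ≠ 0 := by exact_mod_cast (norm_sq_pos hz).ne'
  have hF := logForm_fund hk
  have h1 := logPart_ode k (‖z‖ ^ 2)
  have h2 := regPart_ode k (‖z‖ ^ 2)
  have h3 := sum_coord_sq z
  rw [hF.pd_pd_eq 1 1 hz, hF.pd_pd_eq 0 0 hz, hF.eq z hz]
  simp only [if_true]
  rw [waveFactor] at h1 h2
  set ρ : ℂ := ((‖z‖ ^ 2 : ℝ) : ℂ)
  set L : ℂ := ((Real.log (‖z‖ ^ 2) : ℝ) : ℂ)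
  set a := logPart k (‖z‖ ^ 2)
  set a1 := deriv (logPart k) (‖z‖ ^ 2)
  set a2 := deriv (deriv (logPart k)) (‖z‖ ^ 2)
  set b1 := deriv (regPart k) (‖z‖ ^ 2)
  set b2 := deriv (deriv (regPart k)) (‖z‖ ^ 2)
  have h4 : ρ * ρ⁻¹ = 1 := mul_inv_cancel₀ hρ
  -- In the trace of the Hessian the terms in `a` without a logarithm are `4 a ρ⁻¹ - 4 ρ a ρ⁻² = 0`:
  -- in the plane `log |z|` is harmonic. The rest is four times the two radial equations.
  linear_combination 4 * L * h1 + 4 * h2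
    + 4 * (a2 * L + 2 * a1 * ρ⁻¹ - a * ρ⁻¹ ^ 2 + b2) * h3 + (8 * a1 - 4 * a * ρ⁻¹) * h4

theorem pd_sum {ι : Type*} (s : Finset ι) {F : ι → Pt → ℂ} {z : Pt}
    (hF : ∀ a ∈ s, DifferentiableAt ℝ (F a) z) (i : Fin 2) :
    pd i (fun z => ∑ a ∈ s, F a z) z = ∑ a ∈ s, pd i (F a) z := by
  simp only [pd]
  rw [fderiv_fun_sum hF, _root_.sum_apply]

/-- The coefficients of the traction operator. -/
def tracCoeff (lam mu : ℂ) (n : Fin 2 → ℂ) (i l m : Fin 2) : ℂ :=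
  2 * mu * n l * (if i = m then 1 else 0) + lam * n i * (if l = m then 1 else 0)
    + mu * (![n 1, -n 0] i) * (if l = 0 ∧ m = 1 then 1 else if l = 1 ∧ m = 0 then -1 else 0)

theorem traction_apply (lam mu : ℝ) (nu : Pt) (u : Pt → Fin 2 → ℂ) (x : Pt) (i : Fin 2) :
    traction lam mu nu u x i
      = ∑ l, ∑ m, tracCoeff lam mu (toC nu) i l m * pd l (fun z => u z m) x := by
  fin_cases i <;>
  simp [traction, tracCoeff, normalDeriv, div2, curl2, Fin.sum_univ_two] <;> ring

theorem smoothOff_of_congr {F G : Pt → ℂ} (hF : SmoothOff F) (h : ∀ z, z ≠ 0 → G z = F z) :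
    SmoothOff G := fun z hz => (hF z hz).congr_of_eventuallyEq
  (Filter.eventually_of_mem (isOpen_ne.mem_nhds hz) fun w hw => h w hw)

/-! ### The fundamental matrix and the operator kernel as functions of `x - y`. -/

namespace Medium

variable (M : Medium) (k₁ k₂ : ℂ)

/-- `hessPotential` as a function of the difference. -/
noncomputable def hessFun (z : Pt) : ℂ :=
  fund M.ks z + -(((M.kp : ℂ) ^ 2 - k₂ ^ 2) / (k₁ ^ 2 - k₂ ^ 2)) * fund k₁ z
    + ((M.kp : ℂ) ^ 2 - k₁ ^ 2) / (k₁ ^ 2 - k₂ ^ 2) * fund k₂ z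

/-- `helmholtzDiff` as a function of the difference. -/
noncomputable def diffFun (z : Pt) : ℂ := fund k₁ z + -1 * fund k₂ z

/-- `mixedPotential` as a function of the difference. -/
noncomputable def mixFun (z : Pt) : ℂ :=
  -2 * M.mu * fund M.ks z + (2 * M.mu - M.C3 k₁ k₂) * fund k₁ z + M.C3 k₁ k₂ * fund k₂ z

/-- The displacement block as a function of the difference. -/
noncomputable def e11 (i j : Fin 2) (z : Pt) : ℂ :=
  1 / (M.mu : ℂ) * (if i = j then 1 else 0) * fund M.ks z
    + 1 / ((M.rho : ℂ) * (M.omega : ℂ) ^ 2) * pd i (pd j (M.hessFun k₁ k₂)) z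

/-- The upper right coupling block as a function of the difference. -/
noncomputable def e12 (i : Fin 2) (z : Pt) : ℂ :=
  M.iwe / ((k₁ ^ 2 - k₂ ^ 2) * (M.lam + 2 * M.mu)) * pd i (diffFun k₁ k₂) z

/-- The lower left coupling block as a function of the difference. -/
noncomputable def e21 (i : Fin 2) (z : Pt) : ℂ :=
  -((M.gam : ℂ) / ((k₁ ^ 2 - k₂ ^ 2) * (M.lam + 2 * M.mu))) * pd i (diffFun k₁ k₂) z

/-- The thermal block as a function of the difference. -/
noncomputable def e22 (z : Pt) : ℂ :=
  -(((M.kp : ℂ) ^ 2 - k₁ ^ 2) / (k₁ ^ 2 - k₂ ^ 2)) * fund k₁ z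
    + ((M.kp : ℂ) ^ 2 - k₂ ^ 2) / (k₁ ^ 2 - k₂ ^ 2) * fund k₂ z

theorem hessPotential_eq (x y : Pt) : M.hessPotential k₁ k₂ x y = M.hessFun k₁ k₂ (x - y) := by
  simp only [hessPotential, hessFun, helmholtz_eq_fund]; ring

theorem helmholtzDiff_eq (x y : Pt) : helmholtzDiff k₁ k₂ x y = diffFun k₁ k₂ (x - y) := by
  simp only [helmholtzDiff, diffFun, helmholtz_eq_fund]; ring

theorem mixedPotential_eq (x y : Pt) : M.mixedPotential k₁ k₂ x y = M.mixFun k₁ k₂ (x - y) := by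
  simp only [mixedPotential, mixFun, helmholtz_eq_fund]

theorem E11_eq (x y : Pt) (i j : Fin 2) : M.E11 k₁ k₂ x y i j = M.e11 k₁ k₂ i j (x - y) := by
  have h : (fun z => pd j (fun z' => M.hessPotential k₁ k₂ z' y) z)
      = fun z => pd j (M.hessFun k₁ k₂) (z - y) := by
    funext z
    simp only [hessPotential_eq]
    exact pd_comp_sub _ _ _ _
  simp only [E11, e11, Matrix.add_apply, Matrix.smul_apply, Matrix.of_apply, smul_eq_mul,
    Matrix.one_apply, h, helmholtz_eq_fund]
  rw [pd_comp_sub]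
  ring

theorem E12_eq (x y : Pt) (i : Fin 2) : M.E12 k₁ k₂ x y i = M.e12 k₁ k₂ i (x - y) := by
  simp only [E12, e12, Pi.smul_apply, smul_eq_mul, grad, helmholtzDiff_eq]
  rw [pd_comp_sub]

theorem E21_eq (x y : Pt) (i : Fin 2) : M.E21 k₁ k₂ x y i = M.e21 k₁ k₂ i (x - y) := by
  simp only [E21, e21, Pi.smul_apply, smul_eq_mul, grad, helmholtzDiff_eq]
  rw [pd_comp_sub]

theorem E22_eq (x y : Pt) : M.E22 k₁ k₂ x y = M.e22 k₁ k₂ (x - y) := by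
  simp only [E22, e22, helmholtz_eq_fund]; ring

theorem lam_add_pos : 0 < M.lam + 2 * M.mu := by linarith [M.lam_add_mu_pos, M.mu_pos]

theorem ks_pos : 0 < M.ks :=
  mul_pos M.omega_pos (Real.sqrt_pos.2 (div_pos M.rho_pos M.mu_pos))

theorem ks_ne : (M.ks : ℂ) ≠ 0 := by exact_mod_cast M.ks_pos.ne'

theorem ks_sq : (M.ks : ℂ) ^ 2 = M.rho * M.omega ^ 2 / M.mu := by
  have h : M.ks ^ 2 = M.rho * M.omega ^ 2 / M.mu := by
    rw [ks, mul_pow, Real.sq_sqrt (div_pos M.rho_pos M.mu_pos).le]; ring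
  exact_mod_cast h

theorem kp_sq : (M.kp : ℂ) ^ 2 * (M.lam + 2 * M.mu) = M.rho * M.omega ^ 2 := by
  have h : M.kp ^ 2 * (M.lam + 2 * M.mu) = M.rho * M.omega ^ 2 := by
    rw [kp, mul_pow, Real.sq_sqrt (div_pos M.rho_pos M.lam_add_pos).le]
    have := M.lam_add_pos.ne'
    field_simp
  exact_mod_cast h

theorem smoothOff_ks : SmoothOff (fund M.ks) :=
  (logForm_fund M.ks_ne).smoothOff

variable {M k₁ k₂}

theorem IsWavenumberPair.ne₁ (hk : M.IsWavenumberPair k₁ k₂) : k₁ ≠ 0 := fun h => by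
  have := hk.re_pos₁; simp [h] at this

theorem IsWavenumberPair.ne₂ (hk : M.IsWavenumberPair k₁ k₂) : k₂ ≠ 0 := fun h => by
  have := hk.re_pos₂; simp [h] at this

variable (hk : M.IsWavenumberPair k₁ k₂)
include hk

theorem IsWavenumberPair.smoothOff₁ : SmoothOff (fund k₁) := (logForm_fund hk.ne₁).smoothOff

theorem IsWavenumberPair.smoothOff₂ : SmoothOff (fund k₂) := (logForm_fund hk.ne₂).smoothOff

theorem IsWavenumberPair.smoothOff_hess : SmoothOff (M.hessFun k₁ k₂) :=
  (M.smoothOff_ks.add (hk.smoothOff₁.const_mul _)).add (hk.smoothOff₂.const_mul _)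

theorem IsWavenumberPair.smoothOff_diff : SmoothOff (diffFun k₁ k₂) :=
  hk.smoothOff₁.add (hk.smoothOff₂.const_mul _)

theorem IsWavenumberPair.smoothOff_mix : SmoothOff (M.mixFun k₁ k₂) :=
  ((M.smoothOff_ks.const_mul _).add (hk.smoothOff₁.const_mul _)).add (hk.smoothOff₂.const_mul _)

theorem IsWavenumberPair.smoothOff_e11 (i j : Fin 2) : SmoothOff (M.e11 k₁ k₂ i j) :=
  (M.smoothOff_ks.const_mul _).add (((hk.smoothOff_hess.pd j).pd i).const_mul _)

theorem IsWavenumberPair.smoothOff_e12 (i : Fin 2) : SmoothOff (M.e12 k₁ k₂ i) :=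
  (hk.smoothOff_diff.pd i).const_mul _

theorem IsWavenumberPair.smoothOff_e21 (i : Fin 2) : SmoothOff (M.e21 k₁ k₂ i) :=
  (hk.smoothOff_diff.pd i).const_mul _

/-! ### The blocks of the kernel as differential expressions in the difference -/

/-- The upper left block of `B₄*(∂_y, ν_y) E`. -/
theorem IsWavenumberPair.B4star_inl_inl (ny : Pt) {x y : Pt} (hxy : x ≠ y) (i j : Fin 2) :
    M.B4star ny (fun z' => M.E k₁ k₂ x z') y (Sum.inl i) (Sum.inl j)
      = -∑ l, ∑ m, tracCoeff M.lam M.mu (toC ny) i l m * pd l (M.e11 k₁ k₂ m j) (x - y)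
        - M.iwe * M.e21 k₁ k₂ j (x - y) * toC ny i := by
  simp only [B4star, mixedOpMat, mixedOp, E, Matrix.of_apply, Sum.elim_inl, Pi.sub_apply,
    traction_apply, Matrix.fromBlocks_apply₁₁, Matrix.fromBlocks_apply₂₁, E11_eq, E21_eq,
    Pi.smul_apply, smul_eq_mul]
  congr 1
  rw [← Finset.sum_neg_distrib]
  refine Finset.sum_congr rfl fun l _ => ?_
  rw [← Finset.sum_neg_distrib]
  refine Finset.sum_congr rfl fun m _ => ?_
  rw [pd_const_sub ((hk.smoothOff_e11 m j).differentiableAt (sub_ne_zero.2 hxy))]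
  ring

/-- The upper right block of `B₄*(∂_y, ν_y) E`. -/
theorem IsWavenumberPair.B4star_inl_inr (ny : Pt) {x y : Pt} (hxy : x ≠ y) (i : Fin 2) :
    M.B4star ny (fun z' => M.E k₁ k₂ x z') y (Sum.inl i) (Sum.inr ())
      = -∑ l, ∑ m, tracCoeff M.lam M.mu (toC ny) i l m * pd l (M.e12 k₁ k₂ m) (x - y)
        - M.iwe * M.e22 k₁ k₂ (x - y) * toC ny i := by
  simp only [B4star, mixedOpMat, mixedOp, E, Matrix.of_apply, Sum.elim_inl, Pi.sub_apply,
    traction_apply, Matrix.fromBlocks_apply₁₂, Matrix.fromBlocks_apply₂₂, E12_eq, E22_eq,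
    Pi.smul_apply, smul_eq_mul]
  congr 1
  rw [← Finset.sum_neg_distrib]
  refine Finset.sum_congr rfl fun l _ => ?_
  rw [← Finset.sum_neg_distrib]
  refine Finset.sum_congr rfl fun m _ => ?_
  rw [pd_const_sub ((hk.smoothOff_e12 m).differentiableAt (sub_ne_zero.2 hxy))]
  ring

omit hk in
theorem B4star_inr (ny : Pt) (x y : Pt) (j : Fin 2) :
    M.B4star ny (fun z' => M.E k₁ k₂ x z') y (Sum.inr ()) (Sum.inl j) = -M.e21 k₁ k₂ j (x - y) ∧
    M.B4star ny (fun z' => M.E k₁ k₂ x z') y (Sum.inr ()) (Sum.inr ()) = -M.e22 k₁ k₂ (x - y) := by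
  simp [B4star, mixedOpMat, mixedOp, E, E21_eq, E22_eq]

/-- The bottom row of `B₄` only multiplies the temperature by `-1`, so nothing is differentiated in
`x`; transposition selects `E₁₂` and `E₂₂`. Each derivative in `y` is minus a derivative in `x - y`,
which compensates the factor `-1`. -/
theorem IsWavenumberPair.V4kernel₂₁ (nx ny : Pt) {x y : Pt} (hxy : x ≠ y) (j : Fin 2) :
    M.V4kernel k₁ k₂ x y nx ny (Sum.inr ()) (Sum.inl j)
      = ∑ l, ∑ m, tracCoeff M.lam M.mu (toC ny) j l m * pd l (M.e12 k₁ k₂ m) (x - y)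
        + M.iwe * M.e22 k₁ k₂ (x - y) * toC ny j := by
  have h : M.V4kernel k₁ k₂ x y nx ny (Sum.inr ()) (Sum.inl j)
      = -M.B4star ny (fun z' => M.E k₁ k₂ x z') y (Sum.inl j) (Sum.inr ()) := rfl
  rw [h, hk.B4star_inl_inr ny hxy]
  ring

omit hk in
-- Transposition selects the bottom row `-(E₂₁, E₂₂)` of `B₄* E`, so only the traction in `x`
-- differentiates.
theorem V4kernel₁₂ (nx ny : Pt) {x y : Pt} (hk : M.IsWavenumberPair k₁ k₂) (hxy : x ≠ y)
    (i : Fin 2) :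
    M.V4kernel k₁ k₂ x y nx ny (Sum.inl i) (Sum.inr ())
      = -∑ l, ∑ m, tracCoeff M.lam M.mu (toC nx) i l m * pd l (M.e21 k₁ k₂ m) (x - y)
        + M.gam * M.e22 k₁ k₂ (x - y) * toC nx i := by
  simp only [V4kernel, B4, mixedOpMat, Matrix.of_apply]
  rw [mixedOp]
  simp only [Sum.elim_inl, Pi.sub_apply, traction_apply, Pi.smul_apply, smul_eq_mul,
    Matrix.transpose_apply, fun z => (B4star_inr (M := M) (k₁ := k₁) (k₂ := k₂) ny z y 0).2]
  rw [sub_eq_add_neg]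
  congr 1
  · rw [← Finset.sum_neg_distrib]
    refine Finset.sum_congr rfl fun l _ => ?_
    rw [← Finset.sum_neg_distrib]
    refine Finset.sum_congr rfl fun m _ => ?_
    rw [show (fun z => M.B4star ny (fun z' => M.E k₁ k₂ z z') y (Sum.inr ()) (Sum.inl m))
      = fun z => -1 * M.e21 k₁ k₂ m (z - y) from funext fun z => by
        rw [(B4star_inr ny z y m).1]; ring]
    rw [pd_comp_sub (fun w => -1 * M.e21 k₁ k₂ m w),
      pd_const_mul ((hk.smoothOff_e21 m).differentiableAt (sub_ne_zero.2 hxy))]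
    ring
  · ring

/-- The traction in `x` acts on the upper left block of `(B₄* E)ᵀ`, built from `E₁₁` and `E₂₁`,
while `-γ ν_x` multiplies its temperature row, built from `E₁₂` and `E₂₂`. -/
theorem IsWavenumberPair.V4kernel₁₁ (nx ny : Pt) {x y : Pt} (hxy : x ≠ y) (i j : Fin 2) :
    M.V4kernel k₁ k₂ x y nx ny (Sum.inl i) (Sum.inl j)
      = -∑ l, ∑ m, tracCoeff M.lam M.mu (toC nx) i l m *
          (∑ l', ∑ m', tracCoeff M.lam M.mu (toC ny) j l' m' *
            pd l (pd l' (M.e11 k₁ k₂ m' m)) (x - y)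
          + M.iwe * toC ny j * pd l (M.e21 k₁ k₂ m) (x - y))
        + M.gam * toC nx i *
          (∑ l, ∑ m, tracCoeff M.lam M.mu (toC ny) j l m * pd l (M.e12 k₁ k₂ m) (x - y)
            + M.iwe * M.e22 k₁ k₂ (x - y) * toC ny j) := by
  have hz := sub_ne_zero.2 hxy
  simp only [V4kernel, B4, mixedOpMat, Matrix.of_apply]
  rw [mixedOp]
  simp only [Sum.elim_inl, Pi.sub_apply, traction_apply, Pi.smul_apply, smul_eq_mul,
    Matrix.transpose_apply]
  rw [hk.B4star_inl_inr ny hxy, sub_eq_add_neg]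
  congr 1
  · rw [← Finset.sum_neg_distrib]
    refine Finset.sum_congr rfl fun l _ => ?_
    rw [← Finset.sum_neg_distrib]
    refine Finset.sum_congr rfl fun m _ => ?_
    -- The identity is about to be differentiated in the first point, so it is needed for all `z`
    -- near `x` and not only at `x`.
    have hev : (fun z => M.B4star ny (fun z' => M.E k₁ k₂ z z') y (Sum.inl j) (Sum.inl m))
        =ᶠ[𝓝 x] fun z => (fun w => (-1) * (∑ l', ∑ m', tracCoeff M.lam M.mu (toC ny) j l' m' *
          pd l' (M.e11 k₁ k₂ m' m) w + M.iwe * toC ny j * M.e21 k₁ k₂ m w)) (z - y) := by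
      filter_upwards [isOpen_ne.mem_nhds hxy] with z hz
      rw [hk.B4star_inl_inl ny hz]
      ring
    have hsm : ∀ l', SmoothOff (fun w => ∑ m', tracCoeff M.lam M.mu (toC ny) j l' m' *
          pd l' (M.e11 k₁ k₂ m' m) w) := fun l' =>
      SmoothOff.sum fun m' _ => ((hk.smoothOff_e11 m' m).pd l').const_mul _
    have hsm2 : SmoothOff (fun w => ∑ l', ∑ m', tracCoeff M.lam M.mu (toC ny) j l' m' *
          pd l' (M.e11 k₁ k₂ m' m) w) := SmoothOff.sum fun l' _ => hsm l'
    have h21 := hk.smoothOff_e21 m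
    rw [pd_congr hev, pd_comp_sub (fun w => (-1) * (∑ l', ∑ m', tracCoeff M.lam M.mu (toC ny) j l' m' *
          pd l' (M.e11 k₁ k₂ m' m) w + M.iwe * toC ny j * M.e21 k₁ k₂ m w)),
      pd_const_mul ((hsm2.add (h21.const_mul _)).differentiableAt hz),
      pd_add (hsm2.differentiableAt hz) ((h21.const_mul _).differentiableAt hz),
      pd_const_mul (h21.differentiableAt hz),
      pd_sum _ (fun l' _ => (hsm l').differentiableAt hz)]
    simp_rw [pd_sum Finset.univ (fun m' _ => (((hk.smoothOff_e11 m' m).pd _).const_mul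
      (tracCoeff M.lam M.mu (toC ny) j _ m')).differentiableAt hz),
      pd_const_mul (((hk.smoothOff_e11 _ m).pd _).differentiableAt hz)]
    ring
  · ring

end Medium

/-! ### Jets of solutions of the Helmholtz equation -/

/-- A solution of `Δ F = -κ F` away from the origin. -/
def IsHelm (κ : ℂ) (F : Pt → ℂ) : Prop :=
  SmoothOff F ∧ ∀ z, z ≠ 0 → pd 1 (pd 1 F) z = -κ * F z - pd 0 (pd 0 F) z

/-- Second partial derivatives of a Helmholtz solution, reduced to `v = F`, `p = ∂₀∂₀F`,
`r = ∂₀∂₁F`. -/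
def jet₂ (κ v p r : ℂ) (a b : Fin 2) : ℂ :=
  if a = 0 then (if b = 0 then p else r) else (if b = 0 then r else -κ * v - p)

/-- Fourth partial derivatives of a Helmholtz solution, reduced to `v`, `p`, `r` and
`P = ∂₀⁴F`, `R = ∂₀³∂₁F`. -/
def jet₄ (κ v p r P R : ℂ) (a b c d : Fin 2) : ℂ :=
  if c = 0 then (if d = 0 then jet₂ κ p P R a b else jet₂ κ r R (-κ * p - P) a b)
  else (if d = 0 then jet₂ κ r R (-κ * p - P) a b
    else -κ * jet₂ κ v p r a b - jet₂ κ p P R a b)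

theorem pd_lin₂ {F G : Pt → ℂ} (hF : SmoothOff F) (hG : SmoothOff G) (c d : ℂ) (i : Fin 2)
    {z : Pt} (hz : z ≠ 0) :
    pd i (fun z => c * F z + d * G z) z = c * pd i F z + d * pd i G z := by
  rw [pd_add ((hF.const_mul c).differentiableAt hz) ((hG.const_mul d).differentiableAt hz),
    pd_const_mul (hF.differentiableAt hz), pd_const_mul (hG.differentiableAt hz)]

theorem pd_lin₃ {F G K : Pt → ℂ} (hF : SmoothOff F) (hG : SmoothOff G) (hK : SmoothOff K)
    (c d e : ℂ) (i : Fin 2) {z : Pt} (hz : z ≠ 0) :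
    pd i (fun z => c * F z + d * G z + e * K z) z = c * pd i F z + d * pd i G z + e * pd i K z := by
  rw [pd_add (((hF.const_mul c).add (hG.const_mul d)).differentiableAt hz)
    ((hK.const_mul e).differentiableAt hz), pd_lin₂ hF hG c d i hz,
    pd_const_mul (hK.differentiableAt hz)]

theorem pd_pd_lin₂ {F G : Pt → ℂ} (hF : SmoothOff F) (hG : SmoothOff G) (c d : ℂ) (i j : Fin 2)
    {z : Pt} (hz : z ≠ 0) : pd i (pd j (fun z => c * F z + d * G z)) z
      = c * pd i (pd j F) z + d * pd i (pd j G) z := by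
  rw [pd_eq_of_eqOn (fun w hw => pd_lin₂ hF hG c d j hw) i z hz, pd_lin₂ (hF.pd j) (hG.pd j) c d i hz]

theorem pd_pd_lin₃ {F G K : Pt → ℂ} (hF : SmoothOff F) (hG : SmoothOff G) (hK : SmoothOff K)
    (c d e : ℂ) (i j : Fin 2) {z : Pt} (hz : z ≠ 0) :
    pd i (pd j (fun z => c * F z + d * G z + e * K z)) z
      = c * pd i (pd j F) z + d * pd i (pd j G) z + e * pd i (pd j K) z := by
  rw [pd_eq_of_eqOn (fun w hw => pd_lin₃ hF hG hK c d e j hw) i z hz,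
    pd_lin₃ (hF.pd j) (hG.pd j) (hK.pd j) c d e i hz]

theorem IsHelm.pd_pd {κ : ℂ} {F : Pt → ℂ} (hF : IsHelm κ F) (a b : Fin 2) {z : Pt} (hz : z ≠ 0) :
    pd a (pd b F) z = jet₂ κ (F z) (pd 0 (pd 0 F) z) (pd 0 (pd 1 F) z) a b := by
  fin_cases a <;> fin_cases b <;> simp [jet₂]
  · exact hF.1.pd_comm hz 1 0
  · rw [hF.2 z hz]; ring

/-- Partial derivatives commute with the Laplacian. -/
theorem IsHelm.pd {κ : ℂ} {F : Pt → ℂ} (hF : IsHelm κ F) (i : Fin 2) :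
    IsHelm κ (ThermoArc.pd i F) := by
  refine ⟨hF.1.pd i, fun z hz => ?_⟩
  have e1 : ∀ j, ThermoArc.pd j (ThermoArc.pd j (ThermoArc.pd i F)) z
      = ThermoArc.pd i (ThermoArc.pd j (ThermoArc.pd j F)) z := fun j => by
    rw [pd_eq_of_eqOn (fun w hw => hF.1.pd_comm hw j i) j z hz, (hF.1.pd j).pd_comm hz j i]
  rw [e1, e1, pd_eq_of_eqOn (G := fun z => -κ * F z + -1 * ThermoArc.pd 0 (ThermoArc.pd 0 F) z)
    (fun w hw => by rw [hF.2 w hw]; ring) i z hz, pd_lin₂ hF.1 ((hF.1.pd 0).pd 0) _ _ i hz]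
  ring

/-- Each `∂_c ∂_d F` is again a Helmholtz solution, so its second derivatives form a `jet₂`.
Symmetry and the equation for `F` tie these jets together and leave only `∂₀⁴F` and `∂₀³∂₁F` as new
unknowns. -/
theorem IsHelm.pd_pd_pd_pd {κ : ℂ} {F : Pt → ℂ} (hF : IsHelm κ F) (a b c d : Fin 2) {z : Pt}
    (hz : z ≠ 0) : ThermoArc.pd a (ThermoArc.pd b (ThermoArc.pd c (ThermoArc.pd d F))) z
      = jet₄ κ (F z) (ThermoArc.pd 0 (ThermoArc.pd 0 F) z) (ThermoArc.pd 0 (ThermoArc.pd 1 F) z)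
        (ThermoArc.pd 0 (ThermoArc.pd 0 (ThermoArc.pd 0 (ThermoArc.pd 0 F))) z)
        (ThermoArc.pd 0 (ThermoArc.pd 0 (ThermoArc.pd 0 (ThermoArc.pd 1 F))) z) a b c d := by
  have h00 := (hF.pd 0).pd 0
  have h01 := (hF.pd 1).pd 0
  have e1 : ThermoArc.pd 0 (ThermoArc.pd 1 (ThermoArc.pd 0 (ThermoArc.pd 0 F))) z
      = ThermoArc.pd 0 (ThermoArc.pd 0 (ThermoArc.pd 0 (ThermoArc.pd 1 F))) z := by
    refine pd_eq_of_eqOn (fun w hw => ?_) 0 z hz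
    rw [(hF.1.pd 0).pd_comm hw 1 0]
    exact pd_eq_of_eqOn (fun u hu => hF.1.pd_comm hu 1 0) 0 w hw
  have e2 : ThermoArc.pd 0 (ThermoArc.pd 1 (ThermoArc.pd 0 (ThermoArc.pd 1 F))) z
      = -κ * ThermoArc.pd 0 (ThermoArc.pd 0 F) z
        - ThermoArc.pd 0 (ThermoArc.pd 0 (ThermoArc.pd 0 (ThermoArc.pd 0 F))) z := by
    have : ∀ w, w ≠ 0 → ThermoArc.pd 1 (ThermoArc.pd 0 (ThermoArc.pd 1 F)) w
        = (fun w => -κ * ThermoArc.pd 0 F w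
          + -1 * ThermoArc.pd 0 (ThermoArc.pd 0 (ThermoArc.pd 0 F)) w) w := fun w hw => by
      rw [(hF.1.pd 1).pd_comm hw 1 0, pd_eq_of_eqOn
        (G := fun z => -κ * F z + -1 * ThermoArc.pd 0 (ThermoArc.pd 0 F) z)
        (fun w hw => by rw [hF.2 w hw]; ring) 0 w hw, pd_lin₂ hF.1 ((hF.1.pd 0).pd 0) _ _ 0 hw]
    rw [pd_eq_of_eqOn this 0 z hz, pd_lin₂ (hF.1.pd 0) (h00.1.pd 0) _ _ 0 hz]
    ring
  have k01 := h01.pd_pd a b hz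
  have k00 := h00.pd_pd a b hz
  rw [e2] at k01
  rw [e1] at k00
  fin_cases c <;> fin_cases d <;> simp only [jet₄, Fin.zero_eta, Fin.mk_one, if_true, one_ne_zero,
    if_false]
  · exact k00
  · exact k01
  · rw [← k01]
    exact pd_eq_of_eqOn (fun w hw => pd_eq_of_eqOn (fun u hu => hF.1.pd_comm hu 1 0) b w hw) a z hz
  · rw [← k00, ← hF.pd_pd a b hz, pd_eq_of_eqOn (fun w hw => pd_eq_of_eqOn
      (G := fun z => -κ * F z + -1 * ThermoArc.pd 0 (ThermoArc.pd 0 F) z)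
        (fun w hw => by rw [hF.2 w hw]; ring) b w hw) a z hz, pd_pd_lin₂ hF.1 h00.1 _ _ a b hz]
    ring

/-- The comparison of kernels needs nothing about the four parameters beyond these reductions.
Hiding them leaves identities in free variables. -/
theorem IsHelm.exists_jet {κ : ℂ} {F : Pt → ℂ} (hF : IsHelm κ F) {z : Pt} (hz : z ≠ 0) :
    ∃ p r P R, (∀ a b, ThermoArc.pd a (ThermoArc.pd b F) z = jet₂ κ (F z) p r a b) ∧
      ∀ a b c d, ThermoArc.pd a (ThermoArc.pd b (ThermoArc.pd c (ThermoArc.pd d F))) z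
        = jet₄ κ (F z) p r P R a b c d :=
  ⟨_, _, _, _, fun a b => hF.pd_pd a b hz, fun a b c d => hF.pd_pd_pd_pd a b c d hz⟩

theorem isHelm_fund {k : ℂ} (hk : k ≠ 0) : IsHelm (k ^ 2) (fund k) :=
  ⟨(logForm_fund hk).smoothOff, fun _ hz => fund_helmholtz hk hz⟩

/-! ### The algebraic identities behind the regularization -/

/-- The tangent vector belonging to a normal. -/
def tang (n : Fin 2 → ℂ) : Fin 2 → ℂ := ![-n 1, n 0]

/-- The contribution of one scalar Helmholtz solution to the upper left block of the kernel:
`t₂`, `t` are its second derivatives and the second derivatives of the displacement block. -/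
def blockLHS (lam mu c g c12 c21 c22 v : ℂ) (n m : Fin 2 → ℂ) (t₂ : Fin 2 → Fin 2 → ℂ)
    (t : Fin 2 → Fin 2 → Fin 2 → Fin 2 → ℂ) (i j : Fin 2) : ℂ :=
  -∑ l, ∑ a, tracCoeff lam mu n i l a * (∑ l', ∑ a', tracCoeff lam mu m j l' a' * t l l' a' a
      + c * m j * (c21 * t₂ l a))
    + g * n i * (∑ l, ∑ a, tracCoeff lam mu m j l a * (c12 * t₂ l a) + c * (c22 * v) * m j)

/-- The contribution of one scalar Helmholtz solution to the regularized kernel. -/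
def blockRHS (ca cb ph v : ℂ) (n m : Fin 2 → ℂ) (t₂ : Fin 2 → Fin 2 → ℂ)
    (t : Fin 2 → Fin 2 → Fin 2 → Fin 2 → ℂ) (i j : Fin 2) : ℂ :=
  -ca * v * (n i * m j - (n 0 * m 0 + n 1 * m 1) * (if i = j then 1 else 0)
      - (m i * n j - n i * m j)) - cb * v * (n i * m j)
    + ∑ l, ∑ a, tang n l * (tang m a * t l a i j)
    + n i * ∑ a, tang m a * (ph * (![t₂ a 1, -t₂ a 0] j))
    + (∑ l, tang n l * (ph * (![t₂ l 1, -t₂ l 0] i))) * m j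

/-- The identity for the potential (gradient) part of the displacement block. -/
theorem block_potential (lam mu c g c12 c21 c22 κ B cb ph v p r P R : ℂ) (n m : Fin 2 → ℂ)
    (h1 : ph = -2 * mu * (lam + 2 * mu) * κ * B + 2 * mu * c * c21)
    (h2 : c * c21 = -g * c12)
    (h3 : cb = B * (lam + 2 * mu) ^ 2 * κ ^ 2 - 2 * c * c21 * (lam + 2 * mu) * κ - g * c * c22)
    (i j : Fin 2) :
    blockLHS lam mu c g c12 c21 c22 v n m (jet₂ κ v p r)
        (fun l l' a b => B * jet₄ κ v p r P R l l' a b) i j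
      = blockRHS 0 cb ph v n m (jet₂ κ v p r) (fun l l' i j => 4 * mu ^ 2 *
          ((if i = j then -1 else 1) * (B * jet₄ κ v p r P R l l' (1 - i) (1 - j)))) i j := by
  subst h1 h3
  -- Once `h1` and `h3` are substituted, the identity is polynomial only modulo `h2`. Subtracting
  -- this multiple of `c * c21 + g * c12`, which is zero, makes it hold for free variables.
  suffices h : blockLHS lam mu c g c12 c21 c22 v n m (jet₂ κ v p r)
        (fun l l' a b => B * jet₄ κ v p r P R l l' a b) i j
      - (c * c21 + g * c12) * (n i * ∑ l, ∑ a, tracCoeff lam mu m j l a * jet₂ κ v p r l a)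
      = blockRHS 0 (B * (lam + 2 * mu) ^ 2 * κ ^ 2 - 2 * c * c21 * (lam + 2 * mu) * κ - g * c * c22)
        (-2 * mu * (lam + 2 * mu) * κ * B + 2 * mu * c * c21) v n m (jet₂ κ v p r)
        (fun l l' i j => 4 * mu ^ 2 *
          ((if i = j then -1 else 1) * (B * jet₄ κ v p r P R l l' (1 - i) (1 - j)))) i j by
    rw [← h, show c * c21 + g * c12 = 0 by rw [h2]; ring]
    ring
  fin_cases i <;> fin_cases j <;>
    simp [blockLHS, blockRHS, tracCoeff, tang, jet₂, jet₄, Fin.sum_univ_two] <;> ring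

/-- The identity for the shear part of the displacement block. -/
theorem block_shear (lam mu c g W v p r P R : ℂ) (n m : Fin 2 → ℂ) (hmu : mu ≠ 0) (hW : W ≠ 0)
    (i j : Fin 2) :
    blockLHS lam mu c g 0 0 0 v n m (jet₂ (W / mu) v p r)
        (fun l l' a b => 1 / mu * (if a = b then 1 else 0) * jet₂ (W / mu) v p r l l'
          + 1 / W * jet₄ (W / mu) v p r P R l l' a b) i j
      = blockRHS W 0 (-2 * mu) v n m (jet₂ (W / mu) v p r)
        (fun l l' i j => 4 * mu * (if i = j then 1 else 0) * jet₂ (W / mu) v p r l l'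
          + 4 * mu ^ 2 * ((if i = j then -1 else 1) *
            (1 / mu * (if i = j then 1 else 0) * jet₂ (W / mu) v p r l l'
              + 1 / W * jet₄ (W / mu) v p r P R l l' (1 - i) (1 - j)))) i j := by
  fin_cases i <;> fin_cases j <;>
    simp [blockLHS, blockRHS, tracCoeff, tang, jet₂, jet₄, Fin.sum_univ_two] <;> field_simp <;> ring

/-- The components of `∇ᵀF 𝔸 = -(𝔸 ∇F)ᵀ`. -/
noncomputable def perpGrad (F : Pt → ℂ) (j : Fin 2) (z : Pt) : ℂ := ![pd 1 F z, -pd 0 F z] j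

theorem SmoothOff.perpGrad {F : Pt → ℂ} (hF : SmoothOff F) (j : Fin 2) :
    SmoothOff (perpGrad F j) := by
  fin_cases j
  · exact hF.pd 1
  · exact smoothOff_of_congr ((hF.pd 0).const_mul (-1)) fun z _ => by simp [ThermoArc.perpGrad]

theorem pd_perpGrad {F : Pt → ℂ} (hF : SmoothOff F) (a j : Fin 2) {z : Pt} (hz : z ≠ 0) :
    pd a (perpGrad F j) z = ![pd a (pd 1 F) z, -pd a (pd 0 F) z] j := by
  fin_cases j
  · rfl
  · change pd a (fun z => -pd 0 F z) z = _
    rw [show (fun z => -pd 0 F z) = fun z => -1 * pd 0 F z from funext fun z => by ring,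
      pd_const_mul ((hF.pd 0).differentiableAt hz)]
    simp

/-! ### Entries of the regularized kernels and the pointwise identities for the three blocks. -/

namespace Medium

variable {M : Medium} {k₁ k₂ : ℂ}

variable (M k₁ k₂) in
/-- The kernel `K11_2` as a function of the difference. -/
noncomputable def shearFun (i j : Fin 2) (z : Pt) : ℂ :=
  4 * M.mu * (if i = j then 1 else 0) * fund M.ks z
    + 4 * (M.mu : ℂ) ^ 2 * (if i = j then -1 else 1) * M.e11 k₁ k₂ (1 - i) (1 - j) z

theorem K11_1_apply (x y nx ny : Pt) (i j : Fin 2) : M.K11_1 k₁ k₂ x y nx ny i j =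
    -((M.rho : ℂ) * (M.omega : ℂ) ^ 2) * fund M.ks (x - y) * (toC nx i * toC ny j
      - (toC nx 0 * toC ny 0 + toC nx 1 * toC ny 1) * (if i = j then 1 else 0)
      - (toC ny i * toC nx j - toC nx i * toC ny j))
    - (M.C1 k₁ k₂ * fund k₁ (x - y) - M.C2 k₁ k₂ * fund k₂ (x - y)) * (toC nx i * toC ny j) := by
  simp [K11_1, Jmat, vecMulVec_apply, helmholtz_eq_fund, dotProduct, Fin.sum_univ_two,
    Matrix.one_apply]

theorem K11_2_apply (x y nx ny : Pt) (i j : Fin 2) :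
    M.K11_2 k₁ k₂ x y nx ny i j = M.shearFun k₁ k₂ i j (x - y) := by
  -- Conjugation by the quarter turn exchanges both indices and changes the sign of the diagonal
  -- entries.
  have h : ∀ E : Matrix (Fin 2) (Fin 2) ℂ,
      (rot * E * rot) i j = (if i = j then -1 else 1) * E (1 - i) (1 - j) := fun E => by
    fin_cases i <;> fin_cases j <;> simp [rot, Matrix.mul_apply, Matrix.vecMul, dotProduct, Fin.sum_univ_two]
  simp only [K11_2, shearFun, Matrix.add_apply, Matrix.smul_apply, h, E11_eq, smul_eq_mul,
    Matrix.one_apply, helmholtz_eq_fund]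
  ring

theorem K11_3_apply (x y nx ny : Pt) (i j : Fin 2) :
    M.K11_3 k₁ k₂ x y nx ny i j = toC nx i * perpGrad (M.mixFun k₁ k₂) j (x - y) := by
  have h : ∀ a, grad (fun z => M.mixedPotential k₁ k₂ z y) x a = pd a (M.mixFun k₁ k₂) (x - y) :=
    fun a => by simp only [grad, mixedPotential_eq]; rw [pd_comp_sub]
  fin_cases j <;> simp [K11_3, rot, Matrix.mul_apply, Fin.sum_univ_two, vecMulVec_apply, h,
    perpGrad]

/-- The gradient is in `y` here and in `x` in `K11_3`; the sign this costs is absorbed by `𝔸 ∇F =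
-(∇ᵀF 𝔸)ᵀ`, so the same `perpGrad` serves both. -/
theorem K11_4_apply (hk : M.IsWavenumberPair k₁ k₂) {x y : Pt} (hxy : x ≠ y) (nx ny : Pt)
    (i j : Fin 2) :
    M.K11_4 k₁ k₂ x y nx ny i j = perpGrad (M.mixFun k₁ k₂) i (x - y) * toC ny j := by
  have h : ∀ a, grad (fun z => M.mixedPotential k₁ k₂ x z) y a = -pd a (M.mixFun k₁ k₂) (x - y) :=
    fun a => by
      simp only [grad, mixedPotential_eq]
      rw [pd_const_sub (hk.smoothOff_mix.differentiableAt (sub_ne_zero.2 hxy))]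
  fin_cases i <;> simp [K11_4, rot, dotProduct, Fin.sum_univ_two, vecMulVec_apply, h,
    perpGrad]

theorem K12_1_apply (x y nx ny : Pt) (i : Fin 2) : M.K12_1 k₁ k₂ x y nx ny i () =
    -((M.gam : ℂ) * (M.kp : ℂ) ^ 2 / (k₁ ^ 2 - k₂ ^ 2)) * toC nx i * diffFun k₁ k₂ (x - y) := by
  simp only [K12_1, Matrix.of_apply, helmholtzDiff_eq]

theorem K12_2_apply (x y nx ny : Pt) (i : Fin 2) : M.K12_2 k₁ k₂ x y nx ny i () =
    -(2 * M.mu * M.gam / ((M.lam + 2 * M.mu) * (k₁ ^ 2 - k₂ ^ 2))) *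
      perpGrad (diffFun k₁ k₂) i (x - y) := by
  have h : ∀ a, grad (fun z => helmholtzDiff k₁ k₂ z y) x a = pd a (diffFun k₁ k₂) (x - y) :=
    fun a => by simp only [grad, helmholtzDiff_eq]; rw [pd_comp_sub]
  fin_cases i <;> simp [K12_2, rot, Matrix.mulVec, dotProduct, Fin.sum_univ_two, h, perpGrad]

theorem K21_1_apply (x y nx ny : Pt) (j : Fin 2) : M.K21_1 k₁ k₂ x y nx ny () j =
    -(M.iwe * (M.kp : ℂ) ^ 2 / (k₁ ^ 2 - k₂ ^ 2)) * diffFun k₁ k₂ (x - y) * toC ny j := by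
  simp only [K21_1, Matrix.of_apply, helmholtzDiff_eq]

theorem K21_2_apply (x y nx ny : Pt) (j : Fin 2) : M.K21_2 k₁ k₂ x y nx ny () j =
    -(2 * M.iwe * M.mu / ((M.lam + 2 * M.mu) * (k₁ ^ 2 - k₂ ^ 2))) *
      perpGrad (diffFun k₁ k₂) j (x - y) := by
  have h : ∀ a, grad (fun z => helmholtzDiff k₁ k₂ z y) x a = pd a (diffFun k₁ k₂) (x - y) :=
    fun a => by simp only [grad, helmholtzDiff_eq]; rw [pd_comp_sub]
  fin_cases j <;> simp [K21_2, rot, Matrix.vecMul, dotProduct, Fin.sum_univ_two, h, perpGrad]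

theorem lam_add_ne : ((M.lam : ℂ) + 2 * M.mu) ≠ 0 := by exact_mod_cast M.lam_add_pos.ne'

theorem mu_ne : (M.mu : ℂ) ≠ 0 := by exact_mod_cast M.mu_pos.ne'

theorem rho_omega_ne : (M.rho : ℂ) * (M.omega : ℂ) ^ 2 ≠ 0 := by
  have := M.rho_pos
  have := M.omega_pos
  have h : M.rho * M.omega ^ 2 ≠ 0 := by positivity
  exact_mod_cast h

theorem kp_sq_ne : (M.kp : ℂ) ^ 2 ≠ 0 := fun h => by
  have := M.kp_sq
  rw [h, zero_mul] at this
  exact rho_omega_ne this.symm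

theorem IsWavenumberPair.sub_ne (hk : M.IsWavenumberPair k₁ k₂) : k₁ ^ 2 - k₂ ^ 2 ≠ 0 :=
  sub_ne_zero.2 hk.ne

theorem IsWavenumberPair.diff_jet (hk : M.IsWavenumberPair k₁ k₂) {z : Pt} (hz : z ≠ 0)
    (a b : Fin 2) : pd a (pd b (diffFun k₁ k₂)) z
      = pd a (pd b (fund k₁)) z - pd a (pd b (fund k₂)) z := by
  have h := pd_pd_lin₂ hk.smoothOff₁ hk.smoothOff₂ 1 (-1) a b hz
  simp only [one_mul] at h
  rw [show diffFun k₁ k₂ = fun z => fund k₁ z + -1 * fund k₂ z from rfl, h]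
  ring

/-- Regularization of the upper right block. -/
theorem IsWavenumberPair.V4kernel₁₂_eq (hk : M.IsWavenumberPair k₁ k₂) (nx ny : Pt) {x y : Pt}
    (hxy : x ≠ y) (i : Fin 2) :
    M.V4kernel k₁ k₂ x y nx ny (Sum.inl i) (Sum.inr ()) = M.K12_1 k₁ k₂ x y nx ny i ()
      + ∑ l, tang (toC nx) l * (-(2 * M.mu * M.gam / ((M.lam + 2 * M.mu) * (k₁ ^ 2 - k₂ ^ 2))) *
          pd l (perpGrad (diffFun k₁ k₂) i) (x - y)) := by
  have hz := sub_ne_zero.2 hxy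
  have hD := hk.sub_ne
  have hL := M.lam_add_ne
  have e21 : ∀ l m, pd l (M.e21 k₁ k₂ m) (x - y)
      = -((M.gam : ℂ) / ((k₁ ^ 2 - k₂ ^ 2) * (M.lam + 2 * M.mu))) *
        pd l (pd m (diffFun k₁ k₂)) (x - y) := fun l m =>
    pd_const_mul ((hk.smoothOff_diff.pd m).differentiableAt hz) _ _
  obtain ⟨p₁, r₁, _, _, j1, -⟩ := (isHelm_fund hk.ne₁).exists_jet hz
  obtain ⟨p₂, r₂, _, _, j2, -⟩ := (isHelm_fund hk.ne₂).exists_jet hz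
  rw [V4kernel₁₂ nx ny hk hxy, K12_1_apply]
  simp only [e21, pd_perpGrad hk.smoothOff_diff _ _ hz, hk.diff_jet hz, j1, j2, e22, diffFun]
  -- The two denominators become free nonzero symbols, and `λ` is expressed through `λ + 2μ`; an
  -- identity of rational functions remains.
  generalize hDe : k₁ ^ 2 - k₂ ^ 2 = D at *
  generalize hLe : (M.lam : ℂ) + 2 * M.mu = L at *
  have hlam : (M.lam : ℂ) = L - 2 * M.mu := by rw [← hLe]; ring
  fin_cases i <;> simp [tracCoeff, tang, jet₂, Fin.sum_univ_two, hlam] <;> field_simp <;> ring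

/-- Regularization of the lower left block. -/
theorem IsWavenumberPair.V4kernel₂₁_eq (hk : M.IsWavenumberPair k₁ k₂) (nx ny : Pt) {x y : Pt}
    (hxy : x ≠ y) (j : Fin 2) :
    M.V4kernel k₁ k₂ x y nx ny (Sum.inr ()) (Sum.inl j) = M.K21_1 k₁ k₂ x y nx ny () j
      + ∑ l, tang (toC ny) l * (-(2 * M.iwe * M.mu / ((M.lam + 2 * M.mu) * (k₁ ^ 2 - k₂ ^ 2))) *
          pd l (perpGrad (diffFun k₁ k₂) j) (x - y)) := by
  have hz := sub_ne_zero.2 hxy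
  have hD := hk.sub_ne
  have hL := M.lam_add_ne
  have e12 : ∀ l m, pd l (M.e12 k₁ k₂ m) (x - y)
      = M.iwe / ((k₁ ^ 2 - k₂ ^ 2) * (M.lam + 2 * M.mu)) *
        pd l (pd m (diffFun k₁ k₂)) (x - y) := fun l m =>
    pd_const_mul ((hk.smoothOff_diff.pd m).differentiableAt hz) _ _
  obtain ⟨p₁, r₁, _, _, j1, -⟩ := (isHelm_fund hk.ne₁).exists_jet hz
  obtain ⟨p₂, r₂, _, _, j2, -⟩ := (isHelm_fund hk.ne₂).exists_jet hz
  rw [hk.V4kernel₂₁ nx ny hxy, K21_1_apply]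
  simp only [e12, pd_perpGrad hk.smoothOff_diff _ _ hz, hk.diff_jet hz, j1, j2, e22, diffFun]
  generalize hDe : k₁ ^ 2 - k₂ ^ 2 = D at *
  generalize hLe : (M.lam : ℂ) + 2 * M.mu = L at *
  have hlam : (M.lam : ℂ) = L - 2 * M.mu := by rw [← hLe]; ring
  fin_cases j <;> simp [tracCoeff, tang, jet₂, Fin.sum_univ_two, hlam] <;> field_simp <;> ring

/-- Separates the three wavenumbers in the form that `block_shear` and `block_potential` expect:
identity part plus Hessian for `k_s`, a multiple of the Hessian for `k₁` and for `k₂`. -/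
theorem IsWavenumberPair.e11_jet (hk : M.IsWavenumberPair k₁ k₂) {z : Pt} (hz : z ≠ 0)
    (a b c d : Fin 2) : pd a (pd b (M.e11 k₁ k₂ c d)) z
      = (1 / (M.mu : ℂ) * (if c = d then 1 else 0) * pd a (pd b (fund M.ks)) z
        + 1 / ((M.rho : ℂ) * (M.omega : ℂ) ^ 2) * pd a (pd b (pd c (pd d (fund M.ks)))) z)
      + -(((M.kp : ℂ) ^ 2 - k₂ ^ 2) / ((k₁ ^ 2 - k₂ ^ 2) * ((M.rho : ℂ) * (M.omega : ℂ) ^ 2))) *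
          pd a (pd b (pd c (pd d (fund k₁)))) z
      + ((M.kp : ℂ) ^ 2 - k₁ ^ 2) / ((k₁ ^ 2 - k₂ ^ 2) * ((M.rho : ℂ) * (M.omega : ℂ) ^ 2)) *
          pd a (pd b (pd c (pd d (fund k₂)))) z := by
  have hD := hk.sub_ne
  have hW := M.rho_omega_ne
  have hs := M.smoothOff_ks
  have h1 := hk.smoothOff₁
  have h2 := hk.smoothOff₂
  have e : M.hessFun k₁ k₂ = fun z => 1 * fund M.ks z
      + -(((M.kp : ℂ) ^ 2 - k₂ ^ 2) / (k₁ ^ 2 - k₂ ^ 2)) * fund k₁ z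
      + ((M.kp : ℂ) ^ 2 - k₁ ^ 2) / (k₁ ^ 2 - k₂ ^ 2) * fund k₂ z := by
    funext z; simp only [hessFun, one_mul]
  have hH : ∀ w, w ≠ 0 → pd c (pd d (M.hessFun k₁ k₂)) w = 1 * pd c (pd d (fund M.ks)) w
      + -(((M.kp : ℂ) ^ 2 - k₂ ^ 2) / (k₁ ^ 2 - k₂ ^ 2)) * pd c (pd d (fund k₁)) w
      + ((M.kp : ℂ) ^ 2 - k₁ ^ 2) / (k₁ ^ 2 - k₂ ^ 2) * pd c (pd d (fund k₂)) w := fun w hw => by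
    rw [e]; exact pd_pd_lin₃ hs h1 h2 1 _ _ c d hw
  rw [show M.e11 k₁ k₂ c d = fun z => 1 / (M.mu : ℂ) * (if c = d then 1 else 0) * fund M.ks z
    + 1 / ((M.rho : ℂ) * (M.omega : ℂ) ^ 2) * pd c (pd d (M.hessFun k₁ k₂)) z from rfl,
    pd_pd_lin₂ hs ((hk.smoothOff_hess.pd d).pd c) _ _ a b hz,
    pd_eq_of_eqOn (fun w hw => pd_eq_of_eqOn hH b w hw) a z hz,
    pd_pd_lin₃ ((hs.pd d).pd c) ((h1.pd d).pd c) ((h2.pd d).pd c) _ _ _ a b hz]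
  field_simp
  ring

theorem IsWavenumberPair.shearFun_jet (hk : M.IsWavenumberPair k₁ k₂) {z : Pt} (hz : z ≠ 0)
    (a b i j : Fin 2) : pd a (pd b (M.shearFun k₁ k₂ i j)) z
      = 4 * M.mu * (if i = j then 1 else 0) * pd a (pd b (fund M.ks)) z
        + 4 * (M.mu : ℂ) ^ 2 * (if i = j then -1 else 1) *
          pd a (pd b (M.e11 k₁ k₂ (1 - i) (1 - j))) z :=
  pd_pd_lin₂ M.smoothOff_ks (hk.smoothOff_e11 _ _) _ _ a b hz

theorem IsWavenumberPair.smoothOff_shear (hk : M.IsWavenumberPair k₁ k₂) (i j : Fin 2) :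
    SmoothOff (M.shearFun k₁ k₂ i j) :=
  (M.smoothOff_ks.const_mul _).add ((hk.smoothOff_e11 _ _).const_mul _)

/-- Regularization of the upper left block. -/
theorem IsWavenumberPair.V4kernel₁₁_eq (hk : M.IsWavenumberPair k₁ k₂) (nx ny : Pt) {x y : Pt}
    (hxy : x ≠ y) (i j : Fin 2) :
    M.V4kernel k₁ k₂ x y nx ny (Sum.inl i) (Sum.inl j) = M.K11_1 k₁ k₂ x y nx ny i j
      + ∑ l, ∑ a, tang (toC nx) l * (tang (toC ny) a * pd l (pd a (M.shearFun k₁ k₂ i j)) (x - y))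
      + toC nx i * ∑ a, tang (toC ny) a * pd a (perpGrad (M.mixFun k₁ k₂) j) (x - y)
      + (∑ l, tang (toC nx) l * pd l (perpGrad (M.mixFun k₁ k₂) i) (x - y)) * toC ny j := by
  have hz := sub_ne_zero.2 hxy
  have hD := hk.sub_ne
  have hL := M.lam_add_ne
  have hmu := M.mu_ne
  have hW := M.rho_omega_ne
  have hp := M.kp_sq_ne
  have hpL := M.kp_sq
  -- The product relation eliminates `q`, and `kp_sq` read from right to left eliminates `ρ ω²`.
  -- After that the requirements on the constants are identities of rational functions.
  have hq : M.q = k₁ ^ 2 * k₂ ^ 2 / (M.kp : ℂ) ^ 2 := (eq_div_iff hp).2 hk.prod_sq.symm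
  have hmix : 2 * M.mu - M.C3 k₁ k₂ = -2 * M.mu * (M.lam + 2 * M.mu) * k₁ ^ 2 *
        -(((M.kp : ℂ) ^ 2 - k₂ ^ 2) / ((k₁ ^ 2 - k₂ ^ 2) * ((M.rho : ℂ) * (M.omega : ℂ) ^ 2)))
      + 2 * M.mu * M.iwe * -((M.gam : ℂ) / ((k₁ ^ 2 - k₂ ^ 2) * (M.lam + 2 * M.mu))) := by
    rw [C3, ← hpL, hq]
    generalize (M.kp : ℂ) ^ 2 = p at *
    field_simp
    ring
  have Hs := isHelm_fund M.ks_ne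
  rw [M.ks_sq] at Hs
  have H1 := isHelm_fund hk.ne₁
  have H2 := isHelm_fund hk.ne₂
  have e12 : ∀ l m, pd l (M.e12 k₁ k₂ m) (x - y)
      = M.iwe / ((k₁ ^ 2 - k₂ ^ 2) * (M.lam + 2 * M.mu)) *
        pd l (pd m (diffFun k₁ k₂)) (x - y) := fun l m =>
    pd_const_mul ((hk.smoothOff_diff.pd m).differentiableAt hz) _ _
  have e21 : ∀ l m, pd l (M.e21 k₁ k₂ m) (x - y)
      = -((M.gam : ℂ) / ((k₁ ^ 2 - k₂ ^ 2) * (M.lam + 2 * M.mu))) *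
        pd l (pd m (diffFun k₁ k₂)) (x - y) := fun l m =>
    pd_const_mul ((hk.smoothOff_diff.pd m).differentiableAt hz) _ _
  have emix : ∀ l m, pd l (pd m (M.mixFun k₁ k₂)) (x - y)
      = -2 * M.mu * pd l (pd m (fund M.ks)) (x - y)
        + (2 * M.mu - M.C3 k₁ k₂) * pd l (pd m (fund k₁)) (x - y)
        + M.C3 k₁ k₂ * pd l (pd m (fund k₂)) (x - y) := fun l m =>
    pd_pd_lin₃ M.smoothOff_ks hk.smoothOff₁ hk.smoothOff₂ _ _ _ l m hz
  -- With `W = ρ ω²` the ratio `W / μ` is `k_s²`.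
  have S := fun v p r P R => block_shear M.lam M.mu M.iwe M.gam (M.rho * M.omega ^ 2) v p r P R
    (toC nx) (toC ny) hmu hW i j
  have A := fun v p r P R => block_potential M.lam M.mu M.iwe M.gam
    (M.iwe / ((k₁ ^ 2 - k₂ ^ 2) * (M.lam + 2 * M.mu)))
    (-((M.gam : ℂ) / ((k₁ ^ 2 - k₂ ^ 2) * (M.lam + 2 * M.mu))))
    (-(((M.kp : ℂ) ^ 2 - k₁ ^ 2) / (k₁ ^ 2 - k₂ ^ 2))) (k₁ ^ 2)
    (-(((M.kp : ℂ) ^ 2 - k₂ ^ 2) / ((k₁ ^ 2 - k₂ ^ 2) * ((M.rho : ℂ) * (M.omega : ℂ) ^ 2))))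
    (M.C1 k₁ k₂) (2 * M.mu - M.C3 k₁ k₂) v p r P R (toC nx) (toC ny) (by
      exact hmix) (by ring) (by
      rw [C1, ← hpL, hq]
      generalize (M.kp : ℂ) ^ 2 = p at *
      field_simp
      ring) i j
  have B := fun v p r P R => block_potential M.lam M.mu M.iwe M.gam
    (-(M.iwe / ((k₁ ^ 2 - k₂ ^ 2) * (M.lam + 2 * M.mu))))
    ((M.gam : ℂ) / ((k₁ ^ 2 - k₂ ^ 2) * (M.lam + 2 * M.mu)))
    (((M.kp : ℂ) ^ 2 - k₂ ^ 2) / (k₁ ^ 2 - k₂ ^ 2)) (k₂ ^ 2)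
    (((M.kp : ℂ) ^ 2 - k₁ ^ 2) / ((k₁ ^ 2 - k₂ ^ 2) * ((M.rho : ℂ) * (M.omega : ℂ) ^ 2)))
    (-M.C2 k₁ k₂) (M.C3 k₁ k₂) v p r P R (toC nx) (toC ny) (by
      rw [C3, ← hpL, hq]
      generalize (M.kp : ℂ) ^ 2 = p at *
      field_simp
      ring) (by ring) (by
      rw [C2, ← hpL, hq]
      generalize (M.kp : ℂ) ^ 2 = p at *
      field_simp
      ring) i j
  obtain ⟨p₀, r₀, P₀, R₀, js, js'⟩ := Hs.exists_jet hz
  obtain ⟨p₁, r₁, P₁, R₁, j1, j1'⟩ := H1.exists_jet hz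
  obtain ⟨p₂, r₂, P₂, R₂, j2, j2'⟩ := H2.exists_jet hz
  rw [hk.V4kernel₁₁ nx ny hxy, K11_1_apply]
  simp only [hk.shearFun_jet hz, pd_perpGrad hk.smoothOff_mix _ _ hz, e12, e21, hk.e11_jet hz, emix,
    hk.diff_jet hz, e22, js, js', j1, j1', j2, j2']
  have S' := S (fund M.ks (x - y)) p₀ r₀ P₀ R₀
  have A' := A (fund k₁ (x - y)) p₁ r₁ P₁ R₁
  have B' := B (fund k₂ (x - y)) p₂ r₂ P₂ R₂
  clear S A B
  -- From here on the jets are opaque. The claim is linear in them and is the sum of the identities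
  -- for the three wavenumbers.
  generalize jet₂ (M.rho * M.omega ^ 2 / M.mu) (fund M.ks (x - y)) p₀ r₀ = t₀ at *
  generalize jet₄ (M.rho * M.omega ^ 2 / M.mu) (fund M.ks (x - y)) p₀ r₀ P₀ R₀ = u₀ at *
  generalize jet₂ (k₁ ^ 2) (fund k₁ (x - y)) p₁ r₁ = t₁ at *
  generalize jet₄ (k₁ ^ 2) (fund k₁ (x - y)) p₁ r₁ P₁ R₁ = u₁ at *
  generalize jet₂ (k₂ ^ 2) (fund k₂ (x - y)) p₂ r₂ = t₂ at *
  generalize jet₄ (k₂ ^ 2) (fund k₂ (x - y)) p₂ r₂ P₂ R₂ = u₂ at *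
  simp only [blockLHS, blockRHS, Fin.sum_univ_two] at S' A' B' ⊢
  have perm : ∀ u v : ℂ, ∀ b : Fin 2, (![u, v] b) = u * (if b = 0 then 1 else 0)
      + v * (if b = 0 then 0 else 1) := fun u v b => by fin_cases b <;> simp
  simp only [perm, if_true, zero_ne_one, one_ne_zero, if_false, sub_right_inj] at S' A' B' ⊢
  generalize tracCoeff M.lam M.mu (toC nx) = tx at *
  generalize tracCoeff M.lam M.mu (toC ny) = ty at *
  linear_combination S' + A' + B'

end Medium

/-! ### Extension of functions on an interval and difference quotients -/

section Extension

variable {E : Type*} [NormedAddCommGroup E] [NormedSpace ℝ E] [CompleteSpace E]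

/-- A function of class `C^n` on `[-1, 1]` extends to a function of class `C^n` on the line. -/
theorem exists_contDiff_extension (n : ℕ) : ∀ f : ℝ → E, ContDiffOn ℝ n f (Icc (-1) 1) →
    ∃ g : ℝ → E, ContDiff ℝ n g ∧ EqOn g f (Icc (-1) 1) := by
  have hab : (-1 : ℝ) ≤ 1 := by norm_num
  have hu : UniqueDiffOn ℝ (Icc (-1 : ℝ) 1) := uniqueDiffOn_Icc (by norm_num)
  induction n with
  | zero =>
    intro f hf
    refine ⟨IccExtend hab ((Icc (-1 : ℝ) 1).domRestrict f), ?_, fun t ht => ?_⟩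
    · rw [Nat.cast_zero, contDiff_zero]
      exact (continuousOn_iff_continuous_domRestrict.1 hf.continuousOn).Icc_extend'
    · rw [IccExtend_of_mem _ _ ht]; rfl
  | succ n ih =>
    intro f hf
    have hf' := (contDiffOn_succ_iff_derivWithin hu).1 (by exact_mod_cast hf :
      ContDiffOn ℝ ((n : WithTop ℕ∞) + 1) f (Icc (-1) 1))
    -- The derivative is extended by the induction hypothesis, and its primitive from `-1` extends
    -- `f`.
    obtain ⟨h, hh, he⟩ := ih _ hf'.2.2
    have hd : ∀ t, HasDerivAt (fun t => f (-1) + ∫ s in (-1 : ℝ)..t, h s) (h t) t := fun t =>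
      (intervalIntegral.integral_hasDerivAt_right (hh.continuous.intervalIntegrable _ _)
        (hh.continuous.stronglyMeasurableAtFilter _ _) hh.continuous.continuousAt).const_add _
    refine ⟨fun t => f (-1) + ∫ s in (-1 : ℝ)..t, h s, ?_, fun t ht => ?_⟩
    · have : ContDiff ℝ ((n : WithTop ℕ∞) + 1) (fun t => f (-1) + ∫ s in (-1 : ℝ)..t, h s) := by
        rw [contDiff_succ_iff_deriv]
        refine ⟨fun t => (hd t).differentiableAt, fun hω => absurd hω (by simp), ?_⟩
        rw [show deriv (fun t => f (-1) + ∫ s in (-1 : ℝ)..t, h s) = h from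
          funext fun t => (hd t).deriv]
        exact hh
      exact_mod_cast this
    · have : ∫ s in (-1 : ℝ)..t, h s = f t - f (-1) := by
        refine intervalIntegral.integral_eq_sub_of_hasDerivAt_of_le ht.1
          (hf.continuousOn.mono (Icc_subset_Icc_right ht.2)) (fun s hs => ?_)
          (hh.continuous.intervalIntegrable _ _)
        have hs' : s ∈ Icc (-1 : ℝ) 1 := ⟨hs.1.le, hs.2.le.trans ht.2⟩
        rw [he hs']
        exact (hf'.1 s hs').hasDerivWithinAt.hasDerivAt
          (Icc_mem_nhds hs.1 (hs.2.trans_le ht.2))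
      simp [this]

omit [CompleteSpace E] in
/-- The integral of a `C¹` function over a compact interval depends in a `C¹` way on parameters. -/
theorem contDiff_one_parametric {P : Type*} [NormedAddCommGroup P] [NormedSpace ℝ P]
    [FiniteDimensional ℝ P] {F : P → ℝ → E} (hF : ContDiff ℝ 1 (fun q : P × ℝ => F q.1 q.2)) :
    ContDiff ℝ 1 (fun p => ∫ s in (0 : ℝ)..1, F p s) := by
  have : ProperSpace P := FiniteDimensional.proper ℝ P
  set F' : P → ℝ → P →L[ℝ] E := fun p s =>
    (fderiv ℝ (fun q : P × ℝ => F q.1 q.2) (p, s)).comp (ContinuousLinearMap.inl ℝ P ℝ) with hF'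
  have hc' : Continuous (Function.uncurry F') := by
    have h1 : Continuous (fderiv ℝ (fun q : P × ℝ => F q.1 q.2)) := hF.continuous_fderiv (by simp)
    exact h1.clm_comp continuous_const
  have hc : Continuous (Function.uncurry F) := hF.continuous
  have hd : ∀ p s, HasFDerivAt (fun p => F p s) (F' p s) p := fun p s => by
    have h1 := (hF.differentiable (by simp) (p, s)).hasFDerivAt
    have h2 : HasFDerivAt (fun p : P => (p, s)) (ContinuousLinearMap.inl ℝ P ℝ) p :=
      hasFDerivAt_prodMk_left p s
    exact HasFDerivAt.comp p h1 h2
  have key : ∀ p, HasFDerivAt (fun p => ∫ s in (0 : ℝ)..1, F p s) (∫ s in (0 : ℝ)..1, F' p s) p := by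
    intro p
    obtain ⟨C, hC⟩ := ((isCompact_closedBall p 1).prod (isCompact_Icc (a := (0 : ℝ)) (b := 1))
      ).exists_bound_of_continuousOn hc'.continuousOn
    refine intervalIntegral.hasFDerivAt_integral_of_dominated_of_fderiv_le
      (s := Metric.closedBall p 1) (bound := fun _ => C) (Metric.closedBall_mem_nhds p one_pos)
      (Eventually.of_forall fun x => ?_) ?_ ?_ (ae_of_all _ fun s hs x hx => ?_)
      intervalIntegrable_const (ae_of_all _ fun s _ x _ => hd x s)
    · exact (hc.comp (by fun_prop : Continuous fun s : ℝ => (x, s))).aestronglyMeasurable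
    · exact (hc.comp (by fun_prop : Continuous fun s : ℝ => (p, s))).intervalIntegrable _ _
    · exact (hc'.comp (by fun_prop : Continuous fun s : ℝ => (p, s))).aestronglyMeasurable
    · rw [uIoc_of_le zero_le_one] at hs
      exact hC (x, s) ⟨hx, hs.1.le, hs.2⟩
  rw [contDiff_one_iff_fderiv]
  refine ⟨fun p => (key p).differentiableAt, ?_⟩
  rw [show fderiv ℝ (fun p => ∫ s in (0 : ℝ)..1, F p s) = fun p => ∫ s in (0 : ℝ)..1, F' p s from
    funext fun p => (key p).fderiv]
  exact intervalIntegral.continuous_parametric_intervalIntegral_of_continuous' hc' 0 1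

/-- The difference quotient `(y t - y τ) / (t - τ)`, extended by `y'` to the diagonal. -/
noncomputable def diffQuot (y : ℝ → E) (p : ℝ × ℝ) : E :=
  ∫ s in (0 : ℝ)..1, deriv y (p.2 + s * (p.1 - p.2))

omit [CompleteSpace E] in
-- One derivative is lost. This is why the regular part of a logarithmic kernel on the arc is only
-- asked to be `C¹`, while the coefficient of the logarithm, which does not involve the quotient, is
-- `C²`.
theorem contDiff_diffQuot {y : ℝ → E} (hy : ContDiff ℝ 2 y) : ContDiff ℝ 1 (diffQuot y) := by
  have hy' : ContDiff ℝ 1 (deriv y) := by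
    have : ContDiff ℝ (1 + 1) y := by simpa [one_add_one_eq_two] using hy
    exact (contDiff_succ_iff_deriv.1 this).2.2
  refine contDiff_one_parametric (P := ℝ × ℝ) (F := fun p s => deriv y (p.2 + s * (p.1 - p.2))) ?_
  exact hy'.comp (by fun_prop)

theorem diffQuot_smul {y : ℝ → E} (hy : ContDiff ℝ 2 y) (t τ : ℝ) :
    (t - τ) • diffQuot y (t, τ) = y t - y τ := by
  have hd : Continuous (deriv y) := hy.continuous_deriv (by simp)
  have h : ∀ s ∈ uIcc (0 : ℝ) 1, HasDerivAt (fun s => y (τ + s * (t - τ)))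
      ((t - τ) • deriv y (τ + s * (t - τ))) s := fun s _ => by
    have h1 : HasDerivAt (fun s : ℝ => τ + s * (t - τ)) (t - τ) s := by
      simpa using ((hasDerivAt_id s).mul_const (t - τ)).const_add τ
    exact ((hy.differentiable (by simp) _).hasDerivAt).scomp s h1
  have hI := intervalIntegral.integral_eq_sub_of_hasDerivAt h
    ((continuous_const.smul (hd.comp (by fun_prop))).intervalIntegrable _ _)
  rw [diffQuot, ← intervalIntegral.integral_smul]
  simpa using hI

theorem diffQuot_diag (y : ℝ → E) (t : ℝ) : diffQuot y (t, t) = deriv y t := by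
  simp [diffQuot]

end Extension

/-! ### Extension of an arc -/

/-- `y` is a `C³` extension of the parametrization of the arc to the whole line. -/
structure SmoothArc.IsExtension (Γ : SmoothArc) (y : ℝ → Pt) : Prop where
  contDiff : ContDiff ℝ 3 y
  eqOn : EqOn y Γ.x (Icc (-1) 1)

namespace SmoothArc

variable (Γ : SmoothArc)

/-- Three derivatives are kept because the normal is built from `y'` and has to be `C²`. -/
theorem exists_isExtension : ∃ y, Γ.IsExtension y := by
  obtain ⟨y, h1, h2⟩ := exists_contDiff_extension 3 Γ.x
    (Γ.smooth.of_le (WithTop.coe_le_coe.2 (le_top : ((3 : ℕ) : ℕ∞) ≤ ⊤)))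
  exact ⟨y, by exact_mod_cast h1, h2⟩

variable {Γ} {y : ℝ → Pt}

namespace IsExtension

variable (hy : Γ.IsExtension y)
include hy

theorem contDiff_two : ContDiff ℝ 2 y := hy.contDiff.of_le (by norm_num)

theorem contDiff_deriv : ContDiff ℝ 2 (deriv y) := by
  have : ContDiff ℝ (2 + 1) y := by
    have := hy.contDiff
    norm_num at this ⊢
    exact this
  exact (contDiff_succ_iff_deriv.1 this).2.2

theorem hasDerivAt (t : ℝ) : HasDerivAt y (deriv y t) t :=
  (hy.contDiff.differentiable (by simp) t).hasDerivAt

theorem eq_x {t : ℝ} (ht : t ∈ Ioo (-1 : ℝ) 1) : Γ.x t = y t := (hy.eqOn (Ioo_subset_Icc_self ht)).symm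

theorem eventuallyEq {t : ℝ} (ht : t ∈ Ioo (-1 : ℝ) 1) : Γ.x =ᶠ[𝓝 t] y :=
  Filter.eventually_of_mem (isOpen_Ioo.mem_nhds ht) fun _ hs => hy.eq_x hs

theorem deriv_eq {t : ℝ} (ht : t ∈ Ioo (-1 : ℝ) 1) : deriv Γ.x t = deriv y t :=
  (hy.eventuallyEq ht).deriv_eq

theorem deriv_ne {t : ℝ} (ht : t ∈ Icc (-1 : ℝ) 1) : deriv y t ≠ 0 := by
  have h := Γ.regular t ht
  rwa [← derivWithin_congr hy.eqOn (hy.eqOn ht),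
    (hy.hasDerivAt t).hasDerivWithinAt.derivWithin (uniqueDiffOn_Icc (by norm_num) t ht)] at h

theorem injOn : InjOn y (Icc (-1) 1) := fun s hs t ht h =>
  Γ.simple hs ht (by rwa [hy.eqOn hs, hy.eqOn ht] at h)

/-- Regularity of the parametrization gives this on the diagonal, injectivity off it. By compactness
the chord is then comparable to the parameter distance. -/
theorem diffQuot_ne {t τ : ℝ} (ht : t ∈ Icc (-1 : ℝ) 1) (hτ : τ ∈ Icc (-1 : ℝ) 1) :
    diffQuot y (t, τ) ≠ 0 := by
  by_cases h : t = τ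
  · subst h
    rw [diffQuot_diag]
    exact hy.deriv_ne ht
  · intro h0
    have := diffQuot_smul hy.contDiff_two t τ
    rw [h0, smul_zero] at this
    exact h (hy.injOn ht hτ (sub_eq_zero.1 this.symm))

theorem norm_sub (t τ : ℝ) : ‖y t - y τ‖ = |t - τ| * ‖diffQuot y (t, τ)‖ := by
  rw [← diffQuot_smul hy.contDiff_two, norm_smul, Real.norm_eq_abs]

/-- The chord is bounded below and above by the parameter distance. -/
theorem exists_chord_bounds : ∃ c > 0, ∃ C > 0, ∀ t ∈ Icc (-1 : ℝ) 1, ∀ τ ∈ Icc (-1 : ℝ) 1,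
    c ≤ ‖diffQuot y (t, τ)‖ ∧ ‖diffQuot y (t, τ)‖ ≤ C := by
  have hc : Continuous (fun p => ‖diffQuot y p‖) := (contDiff_diffQuot hy.contDiff_two).continuous.norm
  have hK : IsCompact (Icc (-1 : ℝ) 1 ×ˢ Icc (-1 : ℝ) 1) := isCompact_Icc.prod isCompact_Icc
  have hne : (Icc (-1 : ℝ) 1 ×ˢ Icc (-1 : ℝ) 1).Nonempty := ⟨(0, 0), by norm_num, by norm_num⟩
  obtain ⟨p, hp, hmin⟩ := hK.exists_isMinOn hne hc.continuousOn
  obtain ⟨q, hq, hmax⟩ := hK.exists_isMaxOn hne hc.continuousOn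
  refine ⟨‖diffQuot y p‖, norm_pos_iff.2 (hy.diffQuot_ne hp.1 hp.2), ‖diffQuot y q‖,
    norm_pos_iff.2 (hy.diffQuot_ne hq.1 hq.2), fun t ht τ hτ => ⟨?_, ?_⟩⟩
  · exact hmin (show (t, τ) ∈ _ from ⟨ht, hτ⟩)
  · exact hmax (show (t, τ) ∈ _ from ⟨ht, hτ⟩)

theorem speed_eq {t : ℝ} (ht : t ∈ Ioo (-1 : ℝ) 1) : Γ.speed t = ‖deriv y t‖ := by
  rw [speed, hy.deriv_eq ht]

theorem speed_pos {t : ℝ} (ht : t ∈ Ioo (-1 : ℝ) 1) : 0 < Γ.speed t := by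
  rw [hy.speed_eq ht]
  exact norm_pos_iff.2 (hy.deriv_ne (Ioo_subset_Icc_self ht))

/-- The velocity is the speed times the tangent vector. -/
theorem deriv_eq_tang {t : ℝ} (ht : t ∈ Ioo (-1 : ℝ) 1) (l : Fin 2) :
    ((deriv y t l : ℝ) : ℂ) = (Γ.speed t : ℂ) * tang (toC (Γ.normal t)) l := by
  have h : (Γ.speed t : ℂ) ≠ 0 := by exact_mod_cast (hy.speed_pos ht).ne'
  fin_cases l <;> simp [tang, toC, normal, hy.deriv_eq ht] <;> field_simp

end IsExtension

end SmoothArc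

/-! ### The part of the arc outside a small ball -/

/-- The endpoints `n < t < p` of a shrinking, asymptotically symmetric interval about `t`. -/
structure IsCut (l : Filter ℝ) (n p : ℝ → ℝ) (t : ℝ) : Prop where
  tendsto_n : Tendsto n l (𝓝[<] t)
  tendsto_p : Tendsto p l (𝓝[>] t)
  log_sub : Tendsto (fun r => Real.log (p r - t) - Real.log (t - n r)) l (𝓝 0)

/-- The endpoints of the interval removed by a ball of radius `r` about `x t`. -/
structure SmoothArc.IsBallCut (Γ : SmoothArc) (y : ℝ → Pt) (n p : ℝ → ℝ) (t r : ℝ) : Prop where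
  outside_eq : Γ.outside t r = Ioo (-1) (n r) ∪ Ioo (p r) 1
  n_mem : n r ∈ Ioo (-1) t
  p_mem : p r ∈ Ioo t 1
  n_eq : (t - n r) * ‖diffQuot y (t, n r)‖ = r
  p_eq : (p r - t) * ‖diffQuot y (t, p r)‖ = r

namespace SmoothArc.IsExtension

variable {Γ : SmoothArc} {y : ℝ → Pt} (hy : Γ.IsExtension y)
include hy

/-- The derivative of `|y τ - y t|²` is `2 (τ - t) ⟨X, y' τ⟩` with `X` the difference quotient. At
`τ = t` the inner product equals `|y' t|²`, so it stays positive nearby and the sign is that of `τ -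
t`. -/
theorem exists_strictMono {t : ℝ} (ht : t ∈ Ioo (-1 : ℝ) 1) : ∃ δ > 0, -1 < t - δ ∧ t + δ < 1 ∧
    StrictMonoOn (fun τ => ‖y t - y τ‖) (Icc t (t + δ)) ∧
    StrictAntiOn (fun τ => ‖y t - y τ‖) (Icc (t - δ) t) := by
  have hX := (contDiff_diffQuot hy.contDiff_two).continuous
  have hc : Continuous (fun τ => inner ℝ (diffQuot y (τ, t)) (deriv y τ)) :=
    (hX.comp (by fun_prop : Continuous fun τ : ℝ => (τ, t))).inner hy.contDiff_deriv.continuous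
  have h0 : 0 < inner ℝ (diffQuot y (t, t)) (deriv y t) := by
    rw [diffQuot_diag, real_inner_self_eq_norm_sq]
    have := norm_pos_iff.2 (hy.deriv_ne (Ioo_subset_Icc_self ht))
    positivity
  obtain ⟨ε, hε, hpos⟩ := Metric.eventually_nhds_iff.1 (hc.continuousAt.eventually (lt_mem_nhds h0))
  have hd : ∀ τ, HasDerivAt (fun τ => ‖y τ - y t‖ ^ 2)
      (2 * ((τ - t) * inner ℝ (diffQuot y (τ, t)) (deriv y τ))) τ := fun τ => by
    have h := ((hy.hasDerivAt τ).sub_const (y t)).norm_sq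
    rw [← diffQuot_smul hy.contDiff_two τ t, real_inner_smul_left] at h
    exact h
  have hcont : Continuous (fun τ => ‖y τ - y t‖ ^ 2) :=
    continuous_iff_continuousAt.2 fun τ => (hd τ).continuousAt
  set δ := min (ε / 2) (min ((t + 1) / 2) ((1 - t) / 2)) with hδ
  have h1 : δ ≤ ε / 2 := min_le_left _ _
  have h2 : δ ≤ (t + 1) / 2 := (min_le_right _ _).trans (min_le_left _ _)
  have h3 : δ ≤ (1 - t) / 2 := (min_le_right _ _).trans (min_le_right _ _)
  have hδ0 : 0 < δ := lt_min (by linarith) (lt_min (by linarith [ht.1]) (by linarith [ht.2]))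
  refine ⟨δ, hδ0, by linarith [ht.1], by linarith [ht.2], ?_, ?_⟩
  · have hm : StrictMonoOn (fun τ => ‖y τ - y t‖ ^ 2) (Icc t (t + δ)) := by
      refine strictMonoOn_of_deriv_pos (convex_Icc _ _) hcont.continuousOn fun τ hτ => ?_
      rw [interior_Icc] at hτ
      rw [(hd τ).deriv]
      have := hpos (y := τ) (by rw [Real.dist_eq, abs_lt]; constructor <;> linarith [hτ.1, hτ.2])
      have h4 : 0 < τ - t := by linarith [hτ.1]
      positivity
    intro a ha b hb hab
    simp only [norm_sub_rev (y t)]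
    exact lt_of_pow_lt_pow_left₀ 2 (norm_nonneg _) (hm ha hb hab)
  · have hm : StrictAntiOn (fun τ => ‖y τ - y t‖ ^ 2) (Icc (t - δ) t) := by
      refine strictAntiOn_of_deriv_neg (convex_Icc _ _) hcont.continuousOn fun τ hτ => ?_
      rw [interior_Icc] at hτ
      rw [(hd τ).deriv]
      have := hpos (y := τ) (by rw [Real.dist_eq, abs_lt]; constructor <;> linarith [hτ.1, hτ.2])
      have h4 : τ - t < 0 := by linarith [hτ.2]
      nlinarith [mul_pos_of_neg_of_neg h4 (neg_neg_of_pos this)]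
    intro a ha b hb hab
    simp only [norm_sub_rev (y t)]
    exact lt_of_pow_lt_pow_left₀ 2 (norm_nonneg _) (hm ha hb hab)

/-- On each side of `t` the distance increases strictly near `t`, so a small circle is met exactly
once there. Farther parameters stay at distance at least `m`, because the arc does not return. -/
theorem exists_isBallCut {t : ℝ} (ht : t ∈ Ioo (-1 : ℝ) 1) :
    ∃ n p : ℝ → ℝ, ∀ᶠ r in 𝓝[>] (0 : ℝ), Γ.IsBallCut y n p t r := by
  obtain ⟨δ, hδ, hl, hu, hmono, hanti⟩ := hy.exists_strictMono ht
  have htI := Ioo_subset_Icc_self ht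
  have hcont : Continuous (fun τ => ‖y t - y τ‖) :=
    (continuous_const.sub hy.contDiff.continuous).norm
  obtain ⟨m, hm, hmb⟩ : ∃ m > 0, ∀ τ ∈ Ioo (-1 : ℝ) 1, δ ≤ |τ - t| → m ≤ ‖y t - y τ‖ := by
    obtain ⟨c, hc, C, -, hb⟩ := hy.exists_chord_bounds
    refine ⟨δ * c, mul_pos hδ hc, fun τ hτ hd => ?_⟩
    rw [hy.norm_sub, abs_sub_comm]
    exact mul_le_mul hd (hb t htI τ (Ioo_subset_Icc_self hτ)).1 hc.le (abs_nonneg _)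
  have h0 : ‖y t - y t‖ = 0 := by simp
  have hp1 : 0 < ‖y t - y (t + δ)‖ := by
    have := hmono (left_mem_Icc.2 (by linarith)) (right_mem_Icc.2 (by linarith))
      (show t < t + δ by linarith)
    simpa [h0] using this
  have hn1 : 0 < ‖y t - y (t - δ)‖ := by
    have := hanti (left_mem_Icc.2 (by linarith)) (right_mem_Icc.2 (by linarith))
      (show t - δ < t by linarith)
    simpa [h0] using this
  -- For `r < R` both sides reach the distance `r` within `δ` of `t`, and every parameter at least
  -- `δ` away lies outside the ball.
  set R := min m (min ‖y t - y (t + δ)‖ ‖y t - y (t - δ)‖)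
  have hR : 0 < R := lt_min hm (lt_min hp1 hn1)
  have key : ∀ r, ∃ a b, r ∈ Ioo 0 R → a ∈ Ioo (t - δ) t ∧ b ∈ Ioo t (t + δ) ∧
      ‖y t - y a‖ = r ∧ ‖y t - y b‖ = r := by
    intro r
    by_cases hr : r ∈ Ioo 0 R
    · have hr1 : r < ‖y t - y (t + δ)‖ := hr.2.trans_le ((min_le_right _ _).trans (min_le_left _ _))
      have hr2 : r < ‖y t - y (t - δ)‖ := hr.2.trans_le ((min_le_right _ _).trans (min_le_right _ _))
      obtain ⟨a, ha, ha'⟩ := intermediate_value_Ioo' (by linarith : t - δ ≤ t) hcont.continuousOn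
        (show r ∈ Ioo ‖y t - y t‖ ‖y t - y (t - δ)‖ from ⟨by rw [h0]; exact hr.1, hr2⟩)
      obtain ⟨b, hb, hb'⟩ := intermediate_value_Ioo (by linarith : t ≤ t + δ) hcont.continuousOn
        (show r ∈ Ioo ‖y t - y t‖ ‖y t - y (t + δ)‖ from ⟨by rw [h0]; exact hr.1, hr1⟩)
      exact ⟨a, b, fun _ => ⟨ha, hb, ha', hb'⟩⟩
    -- For radii outside `(0, R)` the endpoints are arbitrary.
    · exact ⟨0, 0, fun h => absurd h hr⟩
  choose n p hnp using key
  refine ⟨n, p, ?_⟩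
  filter_upwards [Ioo_mem_nhdsGT hR] with r hr
  obtain ⟨ha, hb, ha', hb'⟩ := hnp r hr
  refine ⟨?_, ⟨by linarith [ha.1], ha.2⟩, ⟨hb.1, by linarith [hb.2]⟩, ?_, ?_⟩
  · ext τ
    simp only [outside, mem_ofPred_eq, mem_union]
    constructor
    · rintro ⟨hτ, hrτ⟩
      rw [hy.eq_x ht, hy.eq_x hτ] at hrτ
      by_contra hcon
      rw [not_or] at hcon
      have h1 : n r ≤ τ := not_lt.1 fun h => hcon.1 ⟨hτ.1, h⟩
      have h2 : τ ≤ p r := not_lt.1 fun h => hcon.2 ⟨h, hτ.2⟩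
      rcases le_total t τ with h | h
      · have := hmono.monotoneOn ⟨h, by linarith [hb.2]⟩ ⟨hb.1.le, hb.2.le⟩ h2
        linarith
      · have := hanti.antitoneOn ⟨ha.1.le, ha.2.le⟩ ⟨by linarith [ha.1], h⟩ h1
        linarith
    · intro h
      have hτ : τ ∈ Ioo (-1 : ℝ) 1 := by
        rcases h with h | h
        · exact ⟨h.1, by linarith [h.2, ha.2, ht.2]⟩
        · exact ⟨by linarith [h.1, hb.1, ht.1], h.2⟩
      refine ⟨hτ, ?_⟩
      rw [hy.eq_x ht, hy.eq_x hτ]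
      by_cases hd : δ ≤ |τ - t|
      · exact (hr.2.trans_le (min_le_left _ _)).trans_le (hmb τ hτ hd)
      · rw [not_le, abs_lt] at hd
        rcases h with h | h
        · have := hanti ⟨by linarith, by linarith [h.2, ha.2]⟩ ⟨ha.1.le, ha.2.le⟩ h.2
          simp only at this
          linarith
        · have := hmono ⟨hb.1.le, hb.2.le⟩ ⟨by linarith [h.1, hb.1], by linarith⟩ h.1
          simp only at this
          linarith
  · rw [hy.norm_sub, abs_of_pos (by linarith [ha.2])] at ha'
    exact ha'
  · rw [hy.norm_sub, abs_of_neg (by linarith [hb.1]), neg_sub] at hb'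
    exact hb'

/-- Both endpoints have the same chord length `r`, so the logarithms of the two parameter distances
differ by `log |X(t, n)| - log |X(t, p)|`. Both terms tend to `log |y' t|`. -/
theorem isCut_of_isBallCut {t : ℝ} (ht : t ∈ Ioo (-1 : ℝ) 1) {n p : ℝ → ℝ}
    (h : ∀ᶠ r in 𝓝[>] (0 : ℝ), Γ.IsBallCut y n p t r) : IsCut (𝓝[>] 0) n p t := by
  obtain ⟨c, hc, C, -, hb⟩ := hy.exists_chord_bounds
  have htI := Ioo_subset_Icc_self ht
  have h0 : Tendsto (fun r : ℝ => r / c) (𝓝[>] 0) (𝓝 0) := by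
    have : Tendsto (fun r : ℝ => r / c) (𝓝 0) (𝓝 (0 / c)) := tendsto_id.div_const c
    rw [zero_div] at this
    exact this.mono_left nhdsWithin_le_nhds
  have hn0 : Tendsto (fun r => t - n r) (𝓝[>] 0) (𝓝 0) := by
    refine squeeze_zero' ?_ ?_ h0
    · filter_upwards [h] with r hr using by linarith [hr.n_mem.2]
    · filter_upwards [h] with r hr
      have h1 := (hb t htI (n r) ⟨hr.n_mem.1.le, by linarith [hr.n_mem.2, ht.2]⟩).1
      rw [le_div_iff₀ hc]
      nlinarith [hr.n_eq, hr.n_mem.2]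
  have hp0 : Tendsto (fun r => p r - t) (𝓝[>] 0) (𝓝 0) := by
    refine squeeze_zero' ?_ ?_ h0
    · filter_upwards [h] with r hr using by linarith [hr.p_mem.1]
    · filter_upwards [h] with r hr
      have h1 := (hb t htI (p r) ⟨by linarith [hr.p_mem.1, ht.1], hr.p_mem.2.le⟩).1
      rw [le_div_iff₀ hc]
      nlinarith [hr.p_eq, hr.p_mem.1]
  have hn1 : Tendsto n (𝓝[>] 0) (𝓝 t) := by
    have := hn0.const_sub t
    simpa using this
  have hp1 : Tendsto p (𝓝[>] 0) (𝓝 t) := by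
    have := hp0.add_const t
    simpa using this
  refine ⟨tendsto_nhdsWithin_iff.2 ⟨hn1, by filter_upwards [h] with r hr using hr.n_mem.2⟩,
    tendsto_nhdsWithin_iff.2 ⟨hp1, by filter_upwards [h] with r hr using hr.p_mem.1⟩, ?_⟩
  have hX : Continuous (fun τ => ‖diffQuot y (t, τ)‖) :=
    ((contDiff_diffQuot hy.contDiff_two).continuous.comp (by fun_prop)).norm
  have hne : ‖diffQuot y (t, t)‖ ≠ 0 := norm_ne_zero_iff.2 (hy.diffQuot_ne htI htI)
  have hlog : ContinuousAt (fun τ => Real.log ‖diffQuot y (t, τ)‖) t :=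
    hX.continuousAt.log hne
  have := (hlog.tendsto.comp hn1).sub (hlog.tendsto.comp hp1)
  rw [sub_self] at this
  refine this.congr' ?_
  filter_upwards [h, self_mem_nhdsWithin] with r hr hr0
  have hr0' : (0 : ℝ) < r := hr0
  have e1 : Real.log (p r - t) + Real.log ‖diffQuot y (t, p r)‖ = Real.log r := by
    rw [← Real.log_mul (by linarith [hr.p_mem.1]) (fun h => by
      have := hr.p_eq; rw [h, mul_zero] at this; linarith), hr.p_eq]
  have e2 : Real.log (t - n r) + Real.log ‖diffQuot y (t, n r)‖ = Real.log r := by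
    rw [← Real.log_mul (by linarith [hr.n_mem.2]) (fun h => by
      have := hr.n_eq; rw [h, mul_zero] at this; linarith), hr.n_eq]
  simp only [Function.comp]
  linarith

end SmoothArc.IsExtension

/-! ### Kernels with a logarithmic singularity -/

/-- Smoothness of order `n` at all points of the closed parameter square. -/
def SmoothSq (n : WithTop ℕ∞) (A : ℝ × ℝ → ℂ) : Prop :=
  ∀ p ∈ Icc (-1 : ℝ) 1 ×ˢ Icc (-1 : ℝ) 1, ContDiffAt ℝ n A p

/-- The kernel `log |t - τ| A(t, τ) + B(t, τ)`. -/
noncomputable def logKer (A B : ℝ × ℝ → ℂ) (t τ : ℝ) : ℂ :=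
  (Real.log (t - τ) : ℂ) * A (t, τ) + B (t, τ)

/-- The partial derivative of `logKer` in the first variable. -/
noncomputable def logKerDeriv (A B : ℝ × ℝ → ℂ) (t τ : ℝ) : ℂ :=
  A (t, τ) / (t - τ) + (Real.log (t - τ) : ℂ) * fderiv ℝ A (t, τ) (1, 0) + fderiv ℝ B (t, τ) (1, 0)

section SmoothSq

variable {A B : ℝ × ℝ → ℂ} {m n : WithTop ℕ∞}

theorem SmoothSq.of_le (hA : SmoothSq n A) (h : m ≤ n) : SmoothSq m A := fun p hp => (hA p hp).of_le h

theorem SmoothSq.add (hA : SmoothSq n A) (hB : SmoothSq n B) : SmoothSq n (fun p => A p + B p) :=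
  fun p hp => (hA p hp).add (hB p hp)

theorem SmoothSq.mul (hA : SmoothSq n A) (hB : SmoothSq n B) : SmoothSq n (fun p => A p * B p) :=
  fun p hp => (hA p hp).mul (hB p hp)

theorem smoothSq_const (c : ℂ) : SmoothSq n (fun _ => c) := fun _ _ => contDiffAt_const

theorem SmoothSq.differentiableAt (hA : SmoothSq 1 A) {t τ : ℝ} (ht : t ∈ Icc (-1 : ℝ) 1)
    (hτ : τ ∈ Icc (-1 : ℝ) 1) : DifferentiableAt ℝ A (t, τ) :=
  (hA (t, τ) ⟨ht, hτ⟩).differentiableAt (by simp)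

theorem continuousAt_fderiv_of_contDiffAt {E F : Type*} [NormedAddCommGroup E] [NormedSpace ℝ E]
    [NormedAddCommGroup F] [NormedSpace ℝ F] {f : E → F} {x : E}
    (hf : ContDiffAt ℝ 1 f x) : ContinuousAt (fderiv ℝ f) x :=
  (hf.fderiv_right (m := 0) (by simp)).continuousAt

theorem SmoothSq.exists_bound (hA : SmoothSq 1 A) :
    ∃ C, 0 ≤ C ∧ ∀ t ∈ Icc (-1 : ℝ) 1, ∀ τ ∈ Icc (-1 : ℝ) 1, ‖A (t, τ)‖ ≤ C ∧
      ‖fderiv ℝ A (t, τ) (1, 0)‖ ≤ C := by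
  have hK : IsCompact (Icc (-1 : ℝ) 1 ×ˢ Icc (-1 : ℝ) 1) := isCompact_Icc.prod isCompact_Icc
  obtain ⟨C₁, h₁⟩ := hK.exists_bound_of_continuousOn
    (fun p hp => (hA p hp).continuousAt.continuousWithinAt)
  obtain ⟨C₂, h₂⟩ := hK.exists_bound_of_continuousOn (f := fun p => fderiv ℝ A p (1, 0))
    (fun p hp => ((continuousAt_fderiv_of_contDiffAt (hA p hp)).clm_apply
      continuousAt_const).continuousWithinAt)
  refine ⟨max C₁ C₂, ?_, fun t ht τ hτ => ⟨(h₁ (t, τ) ⟨ht, hτ⟩).trans (le_max_left _ _),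
    (h₂ (t, τ) ⟨ht, hτ⟩).trans (le_max_right _ _)⟩⟩
  exact (norm_nonneg _).trans ((h₁ (0, 0) ⟨by norm_num, by norm_num⟩).trans (le_max_left _ _))

theorem SmoothSq.continuousOn_right (hA : SmoothSq 1 A) {t : ℝ} (ht : t ∈ Icc (-1 : ℝ) 1) :
    ContinuousOn (fun τ => A (t, τ)) (Icc (-1) 1) := fun τ hτ =>
  (ContinuousAt.comp (f := fun τ => (t, τ)) (hA (t, τ) ⟨ht, hτ⟩).continuousAt
    (by fun_prop)).continuousWithinAt

theorem SmoothSq.continuousOn_fderiv_right (hA : SmoothSq 1 A) {t : ℝ} (ht : t ∈ Icc (-1 : ℝ) 1)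
    (v : ℝ × ℝ) : ContinuousOn (fun τ => fderiv ℝ A (t, τ) v) (Icc (-1) 1) := fun τ hτ =>
  (ContinuousAt.comp (f := fun τ => (t, τ)) (g := fun p => fderiv ℝ A p v)
    ((continuousAt_fderiv_of_contDiffAt (hA (t, τ) ⟨ht, hτ⟩)).clm_apply continuousAt_const)
    (by fun_prop)).continuousWithinAt

theorem hasDerivAt_fst {A : ℝ × ℝ → ℂ} {t τ : ℝ} (hA : DifferentiableAt ℝ A (t, τ)) :
    HasDerivAt (fun s => A (s, τ)) (fderiv ℝ A (t, τ) (1, 0)) t :=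
  hA.hasFDerivAt.comp_hasDerivAt (f := fun s => (s, τ)) t
    ((hasDerivAt_id t).prodMk (hasDerivAt_const t τ))

theorem hasDerivAt_snd {A : ℝ × ℝ → ℂ} {t τ : ℝ} (hA : DifferentiableAt ℝ A (t, τ)) :
    HasDerivAt (fun s => A (t, s)) (fderiv ℝ A (t, τ) (0, 1)) τ :=
  hA.hasFDerivAt.comp_hasDerivAt (f := fun s => (t, s)) τ
    ((hasDerivAt_const τ t).prodMk (hasDerivAt_id τ))

/-- `Real.log` is even, so one formula covers both sides of the diagonal. -/
theorem hasDerivAt_logKer {A B : ℝ × ℝ → ℂ} {t τ : ℝ} (hA : DifferentiableAt ℝ A (t, τ))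
    (hB : DifferentiableAt ℝ B (t, τ)) (h : t ≠ τ) :
    HasDerivAt (fun s => logKer A B s τ) (logKerDeriv A B t τ) t := by
  have hl : HasDerivAt (fun s => ((Real.log (s - τ) : ℝ) : ℂ)) (((t - τ : ℝ) : ℂ)⁻¹) t := by
    have := (((hasDerivAt_id t).sub_const τ).log (sub_ne_zero.2 h)).ofReal_comp
    simpa using this
  refine ((hl.mul (hasDerivAt_fst hA)).add (hasDerivAt_fst hB)).congr_deriv ?_
  rw [logKerDeriv]; push_cast; ring

end SmoothSq

/-! ### Shrinking cuts -/

/-- The set `(-1, a) ∪ (b, 1)`. -/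
def cutSet (a b : ℝ) : Set ℝ := Ioo (-1) a ∪ Ioo b 1

theorem cutSet_subset {a b : ℝ} (ha : a ≤ 1) (hb : -1 ≤ b) : cutSet a b ⊆ Ioo (-1) 1 :=
  union_subset (Ioo_subset_Ioo_right ha) (Ioo_subset_Ioo_left hb)

theorem measurableSet_cutSet (a b : ℝ) : MeasurableSet (cutSet a b) :=
  measurableSet_Ioo.union measurableSet_Ioo

theorem integral_cutSet {h : ℝ → ℂ} {a b : ℝ} (hab : a ≤ b) (ha : -1 ≤ a) (hb : b ≤ 1)
    (h1 : IntegrableOn h (Ioo (-1) a)) (h2 : IntegrableOn h (Ioo b 1)) :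
    ∫ τ in cutSet a b, h τ = (∫ τ in (-1 : ℝ)..a, h τ) + ∫ τ in b..1, h τ := by
  rw [cutSet, setIntegral_union _ measurableSet_Ioo h1 h2, intervalIntegral.integral_of_le ha,
    intervalIntegral.integral_of_le hb, integral_Ioc_eq_integral_Ioo, integral_Ioc_eq_integral_Ioo]
  exact Set.disjoint_left.2 fun x hx hx' => by linarith [hx.2, hx'.1]

section IsCut

variable {l : Filter ℝ} {n p : ℝ → ℝ} {t : ℝ}

theorem IsCut.eventually (h : IsCut l n p t) (ht : t ∈ Ioo (-1 : ℝ) 1) :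
    ∀ᶠ r in l, n r ∈ Ioo (-1) t ∧ p r ∈ Ioo t 1 :=
  (h.tendsto_n.eventually (Ioo_mem_nhdsLT ht.1)).and (h.tendsto_p.eventually (Ioo_mem_nhdsGT ht.2))

theorem IsCut.tendsto_n' (h : IsCut l n p t) : Tendsto n l (𝓝 t) :=
  h.tendsto_n.mono_right nhdsWithin_le_nhds

theorem IsCut.tendsto_p' (h : IsCut l n p t) : Tendsto p l (𝓝 t) :=
  h.tendsto_p.mono_right nhdsWithin_le_nhds

/-- Convergence of the integrals of an integrable function over the complements of the cuts. -/
theorem IsCut.tendsto_integral (hc : IsCut l n p t) (ht : t ∈ Ioo (-1 : ℝ) 1) {h : ℝ → ℂ}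
    (hh : IntegrableOn h (Ioo (-1) 1)) :
    Tendsto (fun r => ∫ τ in cutSet (n r) (p r), h τ) l (𝓝 (∫ τ in Ioo (-1 : ℝ) 1, h τ)) := by
  set g := indicator (Ioo (-1 : ℝ) 1) h with hg
  have hgi : Integrable g := hh.integrable_indicator measurableSet_Ioo
  have hc1 := intervalIntegral.continuous_primitive (fun a b => hgi.intervalIntegrable (a := a) (b := b)) (-1)
  have hc2 := intervalIntegral.continuous_primitive (fun a b => hgi.intervalIntegrable (a := a) (b := b)) 1
  have hlim := ((hc1.tendsto t).comp hc.tendsto_n').sub ((hc2.tendsto t).comp hc.tendsto_p')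
  have e : (∫ τ in (-1 : ℝ)..t, g τ) - ∫ τ in (1 : ℝ)..t, g τ = ∫ τ in Ioo (-1 : ℝ) 1, h τ := by
    rw [intervalIntegral.integral_symm t 1, sub_neg_eq_add,
      intervalIntegral.integral_add_adjacent_intervals hgi.intervalIntegrable hgi.intervalIntegrable,
      intervalIntegral.integral_of_le (by norm_num), integral_Ioc_eq_integral_Ioo]
    exact setIntegral_congr_fun measurableSet_Ioo fun τ hτ => indicator_of_mem hτ h
  rw [e] at hlim
  refine hlim.congr' ?_
  filter_upwards [hc.eventually ht] with r hr
  have hsub : cutSet (n r) (p r) ⊆ Ioo (-1) 1 :=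
    cutSet_subset (by linarith [hr.1.2, ht.2]) (by linarith [hr.2.1, ht.1])
  have e2 : ∫ τ in cutSet (n r) (p r), h τ = ∫ τ in cutSet (n r) (p r), g τ :=
    setIntegral_congr_fun (measurableSet_cutSet _ _) fun τ hτ => (indicator_of_mem (hsub hτ) h).symm
  rw [e2, integral_cutSet (by linarith [hr.1.2, hr.2.1]) hr.1.1.le hr.2.2.le hgi.integrableOn
    hgi.integrableOn]
  simp only [Function.comp]
  rw [intervalIntegral.integral_symm (p r) 1, sub_neg_eq_add]

/-- The factor `m` may blow up; only its product with `q - t` has to converge, the difference `a (q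
r) - a t` being the slope of `a` times `q r - t`. -/
theorem tendsto_slope_mul {a : ℝ → ℂ} (ha : DifferentiableAt ℝ a t) {q : ℝ → ℝ}
    (hq : Tendsto q l (𝓝 t)) (hne : ∀ᶠ r in l, q r ≠ t) {m : ℝ → ℂ} {c : ℂ}
    (hm : Tendsto (fun r => m r * (q r - t : ℝ)) l (𝓝 c)) :
    Tendsto (fun r => m r * (a (q r) - a t)) l (𝓝 (c * deriv a t)) := by
  have h1 := (hasDerivAt_iff_tendsto_slope.1 ha.hasDerivAt).comp
    (tendsto_nhdsWithin_iff.2 ⟨hq, hne⟩)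
  refine (hm.mul h1).congr' ?_
  filter_upwards [hne] with r hr
  have : ((q r - t : ℝ) : ℂ) ≠ 0 := by exact_mod_cast sub_ne_zero.2 hr
  simp only [Function.comp, slope_def_module, Complex.real_smul]
  push_cast at *
  field_simp

theorem tendsto_log_mul_self_nhdsGT :
    Tendsto (fun x : ℝ => Real.log x * x) (𝓝[>] 0) (𝓝 0) := by
  simpa using tendsto_log_mul_rpow_nhdsGT_zero one_pos

theorem IsCut.tendsto_log_n (hc : IsCut l n p t) :
    Tendsto (fun r => (Real.log (t - n r) : ℂ) * (n r - t : ℝ)) l (𝓝 0) := by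
  have h1 : Tendsto (fun r => t - n r) l (𝓝[>] 0) := by
    refine tendsto_nhdsWithin_iff.2 ⟨by simpa using hc.tendsto_n'.const_sub t, ?_⟩
    filter_upwards [hc.tendsto_n.eventually self_mem_nhdsWithin] with r hr
    exact sub_pos.2 hr
  have h2 := (tendsto_log_mul_self_nhdsGT.comp h1).neg
  rw [neg_zero] at h2
  have h3 := (Complex.continuous_ofReal.tendsto 0).comp h2
  refine Tendsto.congr (fun r => ?_) (by simpa using h3)
  simp only [Function.comp]
  push_cast; ring

theorem IsCut.tendsto_log_p (hc : IsCut l n p t) :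
    Tendsto (fun r => (Real.log (p r - t) : ℂ) * (p r - t : ℝ)) l (𝓝 0) := by
  have h1 : Tendsto (fun r => p r - t) l (𝓝[>] 0) := by
    refine tendsto_nhdsWithin_iff.2 ⟨by simpa using hc.tendsto_p'.sub_const t, ?_⟩
    filter_upwards [hc.tendsto_p.eventually self_mem_nhdsWithin] with r hr
    exact sub_pos.2 hr
  have h3 := (Complex.continuous_ofReal.tendsto 0).comp (tendsto_log_mul_self_nhdsGT.comp h1)
  refine Tendsto.congr (fun r => ?_) (by simpa using h3)
  simp only [Function.comp]
  push_cast; ring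

/-- Logarithmic boundary terms cancel in the limit. -/
theorem IsCut.tendsto_boundary_log (hc : IsCut l n p t) {a b : ℝ → ℂ} (ha : DifferentiableAt ℝ a t)
    (hb : ContinuousAt b t) :
    Tendsto (fun r => ((Real.log (t - n r) : ℂ) * a (n r) + b (n r))
      - ((Real.log (t - p r) : ℂ) * a (p r) + b (p r))) l (𝓝 0) := by
  have hn : ∀ᶠ r in l, n r ≠ t := by
    filter_upwards [hc.tendsto_n.eventually self_mem_nhdsWithin] with r hr using ne_of_lt hr
  have hp : ∀ᶠ r in l, p r ≠ t := by
    filter_upwards [hc.tendsto_p.eventually self_mem_nhdsWithin] with r hr using ne_of_gt hr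
  -- Subtracting `a t` from both coefficients gives two terms of type `u log u` and the remainder `a
  -- t` times the difference of the logarithms, which `log_sub` sends to zero.
  have h1 := tendsto_slope_mul ha hc.tendsto_n' hn hc.tendsto_log_n
  have h2 := tendsto_slope_mul ha hc.tendsto_p' hp hc.tendsto_log_p
  have h3 := ((Complex.continuous_ofReal.tendsto 0).comp hc.log_sub).mul_const (a t)
  have h4 := (hb.tendsto.comp hc.tendsto_n').sub (hb.tendsto.comp hc.tendsto_p')
  have h5 := ((h1.sub h2).sub h3).add h4
  simp only [zero_mul, Complex.ofReal_zero, sub_self, add_zero] at h5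
  refine h5.congr fun r => ?_
  simp only [Function.comp]
  rw [show t - p r = -(p r - t) by ring, Real.log_neg_eq_log]
  push_cast; ring

end IsCut

theorem abs_log_le {ε u : ℝ} (hε : 0 < ε) (h1 : ε ≤ |u|) (h2 : |u| ≤ 2) :
    |Real.log u| ≤ |Real.log ε| + Real.log 2 := by
  have hu : 0 < |u| := hε.trans_le h1
  rw [← Real.log_abs u, abs_le]
  have h3 := Real.log_le_log hε h1
  have h4 := Real.log_le_log hu h2
  have h5 := Real.log_nonneg (one_le_two (α := ℝ))
  constructor
  · linarith [neg_abs_le (Real.log ε)]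
  · linarith [abs_nonneg (Real.log ε)]

theorem integrable_mul_of_bound {μ : Measure ℝ} {h f : ℝ → ℂ} (hf : Integrable f μ)
    (hm : AEStronglyMeasurable h μ) {C : ℝ} (hb : ∀ᵐ τ ∂μ, ‖h τ * f τ‖ ≤ C * ‖f τ‖) :
    Integrable (fun τ => h τ * f τ) μ :=
  (hf.norm.const_mul C).mono' (hm.mul hf.aestronglyMeasurable) hb

/-! ### Logarithmic kernels away from the diagonal. -/

section LogKernel

variable {A B : ℝ × ℝ → ℂ} (hA : SmoothSq 1 A) (hB : SmoothSq 1 B)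
include hA hB

theorem aestronglyMeasurable_logKer {t : ℝ} (ht : t ∈ Icc (-1 : ℝ) 1) :
    AEStronglyMeasurable (logKer A B t) (volume.restrict (Ioo (-1) 1)) := by
  have h1 : Measurable fun τ : ℝ => (Real.log (t - τ) : ℂ) :=
    Complex.measurable_ofReal.comp (Real.measurable_log.comp (measurable_const.sub measurable_id))
  exact (h1.aestronglyMeasurable.mul (((hA.continuousOn_right ht).mono
    Ioo_subset_Icc_self).aestronglyMeasurable measurableSet_Ioo)).add
    (((hB.continuousOn_right ht).mono Ioo_subset_Icc_self).aestronglyMeasurable measurableSet_Ioo)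

theorem aestronglyMeasurable_logKerDeriv {t : ℝ} (ht : t ∈ Icc (-1 : ℝ) 1) :
    AEStronglyMeasurable (logKerDeriv A B t) (volume.restrict (Ioo (-1) 1)) := by
  have h0 : Measurable fun τ : ℝ => ((t : ℂ) - τ) :=
    measurable_const.sub Complex.measurable_ofReal
  have h1 : Measurable fun τ : ℝ => (Real.log (t - τ) : ℂ) :=
    Complex.measurable_ofReal.comp (Real.measurable_log.comp (measurable_const.sub measurable_id))
  have hm : ∀ {h : ℝ → ℂ}, ContinuousOn h (Icc (-1) 1) →
      AEStronglyMeasurable h (volume.restrict (Ioo (-1) 1)) := fun hh =>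
    (hh.mono Ioo_subset_Icc_self).aestronglyMeasurable measurableSet_Ioo
  have h2 : AEStronglyMeasurable (fun τ => A (t, τ) / ((t : ℂ) - τ))
      (volume.restrict (Ioo (-1) 1)) := by
    simp only [div_eq_mul_inv]
    exact (hm (hA.continuousOn_right ht)).mul h0.inv.aestronglyMeasurable
  exact (h2.add (h1.aestronglyMeasurable.mul (hm (hA.continuousOn_fderiv_right ht _)))).add
    (hm (hB.continuousOn_fderiv_right ht _))

/-- Bounds for a logarithmic kernel and its derivative away from the diagonal. -/
theorem exists_logKer_bound {ε : ℝ} (hε : 0 < ε) : ∃ C, ∀ t ∈ Icc (-1 : ℝ) 1, ∀ τ ∈ Icc (-1 : ℝ) 1,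
    ε ≤ |t - τ| → ‖logKer A B t τ‖ ≤ C ∧ ‖logKerDeriv A B t τ‖ ≤ C := by
  obtain ⟨a, ha, hab⟩ := hA.exists_bound
  obtain ⟨b, hb, hbb⟩ := hB.exists_bound
  set L := |Real.log ε| + Real.log 2
  refine ⟨a / ε + L * a + b, fun t ht τ hτ h => ?_⟩
  have hL : ‖(Real.log (t - τ) : ℂ)‖ ≤ L := by
    rw [Complex.norm_real, Real.norm_eq_abs]
    exact abs_log_le hε h (by rw [abs_le]; constructor <;> linarith [ht.1, ht.2, hτ.1, hτ.2])
  have hL0 : 0 ≤ L := (norm_nonneg _).trans hL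
  obtain ⟨a1, a2⟩ := hab t ht τ hτ
  obtain ⟨b1, b2⟩ := hbb t ht τ hτ
  have h0 : 0 ≤ a / ε := by positivity
  constructor
  · refine (norm_add_le _ _).trans ?_
    rw [norm_mul]
    have := mul_le_mul hL a1 (norm_nonneg _) hL0
    linarith
  · refine (norm_add₃_le).trans ?_
    rw [norm_mul, norm_div]
    have := mul_le_mul hL a2 (norm_nonneg _) hL0
    have hd : ‖(t : ℂ) - τ‖ = |t - τ| := by
      rw [← Complex.ofReal_sub, Complex.norm_real, Real.norm_eq_abs]
    have : ‖A (t, τ)‖ / ‖(t : ℂ) - τ‖ ≤ a / ε := by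
      rw [hd]
      exact div_le_div₀ ha a1 hε h
    linarith

/-- The contribution of a density vanishing near `t₀`. -/
theorem hasDerivAt_integral_away {f : ℝ → ℂ} (hf : IntegrableOn f (Ioo (-1) 1)) {t₀ η : ℝ}
    (ht : t₀ ∈ Ioo (-1 : ℝ) 1) (hη : 0 < η) (hf0 : ∀ τ, |τ - t₀| < η → f τ = 0) :
    IntegrableOn (fun τ => logKerDeriv A B t₀ τ * f τ) (Ioo (-1) 1) ∧
    HasDerivAt (fun t => ∫ τ in Ioo (-1 : ℝ) 1, logKer A B t τ * f τ)
      (∫ τ in Ioo (-1 : ℝ) 1, logKerDeriv A B t₀ τ * f τ) t₀ := by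
  obtain ⟨C, hC⟩ := exists_logKer_bound hA hB (half_pos hη)
  have hs : Ioo (-1 : ℝ) 1 ∩ Metric.ball t₀ (η / 2) ∈ 𝓝 t₀ :=
    Filter.inter_mem (isOpen_Ioo.mem_nhds ht) (Metric.ball_mem_nhds _ (half_pos hη))
  -- While `t` moves by less than `η / 2`, the support of `f` stays at distance at least `η / 2`,
  -- where kernel and derivative are bounded.
  have far : ∀ t ∈ Ioo (-1 : ℝ) 1 ∩ Metric.ball t₀ (η / 2), ∀ τ, f τ ≠ 0 → η / 2 ≤ |t - τ| := by
    intro t ht' τ hτ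
    have h1 : η ≤ |τ - t₀| := not_lt.1 fun h => hτ (hf0 τ h)
    have h2 : |t - t₀| < η / 2 := by simpa [Real.dist_eq] using ht'.2
    have h3 : |τ - t₀| ≤ |t - τ| + |t - t₀| := by
      rw [show τ - t₀ = -(t - τ) + (t - t₀) by ring]
      exact (abs_add_le _ _).trans (by rw [abs_neg])
    linarith
  refine hasDerivAt_integral_of_dominated_loc_of_deriv_le (𝕜 := ℝ)
    (μ := volume.restrict (Ioo (-1) 1)) (F := fun t τ => logKer A B t τ * f τ)
    (F' := fun t τ => logKerDeriv A B t τ * f τ) (x₀ := t₀) (bound := fun τ => C * ‖f τ‖) hs ?_ ?_ ?_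
    ?_ (hf.norm.const_mul C) ?_
  · filter_upwards [isOpen_Ioo.mem_nhds ht] with t ht'
    exact (aestronglyMeasurable_logKer hA hB (Ioo_subset_Icc_self ht')).mul hf.aestronglyMeasurable
  · refine integrable_mul_of_bound hf (aestronglyMeasurable_logKer hA hB
      (Ioo_subset_Icc_self ht)) (C := C) ?_
    refine (ae_restrict_iff' measurableSet_Ioo).2 (ae_of_all _ fun τ hτ => ?_)
    by_cases h0 : f τ = 0
    · simp [h0]
    · rw [norm_mul]
      gcongr
      exact (hC t₀ (Ioo_subset_Icc_self ht) τ (Ioo_subset_Icc_self hτ)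
        (far t₀ (mem_of_mem_nhds hs) τ h0)).1
  · exact (aestronglyMeasurable_logKerDeriv hA hB (Ioo_subset_Icc_self ht)).mul
      hf.aestronglyMeasurable
  · refine (ae_restrict_iff' measurableSet_Ioo).2 (ae_of_all _ fun τ hτ t ht' => ?_)
    by_cases h0 : f τ = 0
    · simp [h0]
    · rw [norm_mul]
      gcongr
      exact (hC t (Ioo_subset_Icc_self ht'.1) τ (Ioo_subset_Icc_self hτ) (far t ht' τ h0)).2
  · refine (ae_restrict_iff' measurableSet_Ioo).2 (ae_of_all _ fun τ hτ t ht' => ?_)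
    by_cases h0 : f τ = 0
    · simpa [h0] using hasDerivAt_const t (0 : ℂ)
    · have hne : t ≠ τ := fun h => by
        have := far t ht' τ h0
        rw [h, sub_self, abs_zero] at this
        linarith
      have hτ' := Ioo_subset_Icc_self hτ
      have ht'' := Ioo_subset_Icc_self ht'.1
      exact (hasDerivAt_logKer (hA.differentiableAt ht'' hτ') (hB.differentiableAt ht'' hτ')
        hne).mul_const (f τ)

end LogKernel

/-- Smoothness of a coefficient multiplied by a compactly supported density. -/
theorem contDiffAt_mul_density {A : ℝ × ℝ → ℂ} (hA : SmoothSq 1 A) {g : ℝ → ℂ}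
    (hg : ContDiff ℝ 1 g) {a b : ℝ} (ha : -1 < a) (hb : b < 1) (hg0 : ∀ τ ∉ Icc a b, g τ = 0)
    {p : ℝ × ℝ} (hp : p.1 ∈ Icc (-1 : ℝ) 1) : ContDiffAt ℝ 1 (fun p : ℝ × ℝ => A p * g p.2) p := by
  by_cases h : p.2 ∈ Icc (-1 : ℝ) 1
  · exact (hA p ⟨hp, h⟩).mul (hg.contDiffAt.comp p contDiffAt_snd)
  -- Outside the square nothing is known about `A`, but the density vanishes in a neighbourhood.
  · have : (fun p : ℝ × ℝ => A p * g p.2) =ᶠ[𝓝 p] fun _ => 0 := by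
      have hn : {q : ℝ × ℝ | q.2 ∉ Icc a b} ∈ 𝓝 p :=
        (isClosed_Icc.isOpen_compl.preimage continuous_snd).mem_nhds
          (fun h' => h ⟨by linarith [h'.1], by linarith [h'.2]⟩)
      filter_upwards [hn] with q hq
      rw [hg0 q.2 hq, mul_zero]
    exact contDiffAt_const.congr_of_eventuallyEq this

theorem fderiv_mul_density_eq_zero {A : ℝ × ℝ → ℂ} {g : ℝ → ℂ}
    {a b : ℝ} (hg0 : ∀ τ ∉ Icc a b, g τ = 0) {p : ℝ × ℝ} (hp : p.2 ∉ Icc a b) :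
    fderiv ℝ (fun p : ℝ × ℝ => A p * g p.2) p = 0 := by
  have : (fun p : ℝ × ℝ => A p * g p.2) =ᶠ[𝓝 p] fun _ => 0 := by
    have hn : {q : ℝ × ℝ | q.2 ∉ Icc a b} ∈ 𝓝 p :=
      (isClosed_Icc.isOpen_compl.preimage continuous_snd).mem_nhds hp
    filter_upwards [hn] with q hq
    rw [hg0 q.2 hq, mul_zero]
  rw [this.fderiv_eq]
  simp

theorem integrable_log_bound (C : ℝ) :
    Integrable (indicator (Icc (-2 : ℝ) 2) fun s => C * (|Real.log s| + 1)) := by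
  refine IntegrableOn.integrable_indicator ?_ measurableSet_Icc
  rw [← intervalIntegrable_iff_integrableOn_Icc_of_le (by norm_num)]
  exact ((intervalIntegral.intervalIntegrable_log'.abs).add intervalIntegrable_const).const_mul C

/-- The contribution of a compactly supported `C¹` density: the derivative is found after the
substitution `τ = s + t`. -/
theorem hasDerivAt_integral_shift {P Q : ℝ × ℝ → ℂ} {t₀ a b : ℝ} (ht : t₀ ∈ Ioo (-1 : ℝ) 1)
    (ha : -1 < a) (hb : b < 1)
    (hP : ∀ p : ℝ × ℝ, p.1 ∈ Icc (-1 : ℝ) 1 → ContDiffAt ℝ 1 P p)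
    (hQ : ∀ p : ℝ × ℝ, p.1 ∈ Icc (-1 : ℝ) 1 → ContDiffAt ℝ 1 Q p)
    (hP0 : ∀ p : ℝ × ℝ, p.2 ∉ Icc a b → P p = 0 ∧ fderiv ℝ P p = 0)
    (hQ0 : ∀ p : ℝ × ℝ, p.2 ∉ Icc a b → Q p = 0 ∧ fderiv ℝ Q p = 0) :
    Integrable (fun τ => (Real.log (t₀ - τ) : ℂ) * fderiv ℝ P (t₀, τ) (1, 1)
      + fderiv ℝ Q (t₀, τ) (1, 1)) ∧
    HasDerivAt (fun t => ∫ τ, ((Real.log (t - τ) : ℂ) * P (t, τ) + Q (t, τ)))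
      (∫ τ, ((Real.log (t₀ - τ) : ℂ) * fderiv ℝ P (t₀, τ) (1, 1)
        + fderiv ℝ Q (t₀, τ) (1, 1))) t₀ := by
  have hK : IsCompact (Icc (-1 : ℝ) 1 ×ˢ Icc a b) := isCompact_Icc.prod isCompact_Icc
  have bd : ∀ {R : ℝ × ℝ → ℂ}, (∀ p : ℝ × ℝ, p.1 ∈ Icc (-1 : ℝ) 1 → ContDiffAt ℝ 1 R p) →
      (∀ p : ℝ × ℝ, p.2 ∉ Icc a b → R p = 0 ∧ fderiv ℝ R p = 0) →
      ∃ C, 0 ≤ C ∧ ∀ t ∈ Icc (-1 : ℝ) 1, ∀ s : ℝ, ‖R (t, s + t)‖ ≤ C ∧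
        ‖fderiv ℝ R (t, s + t) (1, 1)‖ ≤ C := by
    intro R hR hR0
    obtain ⟨C₁, h₁⟩ := hK.exists_bound_of_continuousOn
      (fun p hp => (hR p hp.1).continuousAt.continuousWithinAt)
    obtain ⟨C₂, h₂⟩ := hK.exists_bound_of_continuousOn (f := fun p => fderiv ℝ R p (1, 1))
      (fun p hp => ((continuousAt_fderiv_of_contDiffAt (hR p hp.1)).clm_apply
        continuousAt_const).continuousWithinAt)
    refine ⟨max 0 (max C₁ C₂), le_max_left _ _, fun t ht s => ?_⟩
    by_cases hs : s + t ∈ Icc a b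
    · exact ⟨(h₁ (t, s + t) ⟨ht, hs⟩).trans ((le_max_left _ _).trans (le_max_right _ _)),
        (h₂ (t, s + t) ⟨ht, hs⟩).trans ((le_max_right _ _).trans (le_max_right _ _))⟩
    · obtain ⟨e1, e2⟩ := hR0 (t, s + t) hs
      rw [e1, e2]
      simp
  obtain ⟨C₁, hC₁, hb₁⟩ := bd hP hP0
  obtain ⟨C₂, hC₂, hb₂⟩ := bd hQ hQ0
  -- For `t` in `[-1, 1]` and `s + t` in `[a, b]` one has `|s| ≤ 2`, so a single integrable function
  -- dominates for all `t`.
  have key : ∀ t ∈ Icc (-1 : ℝ) 1, ∀ s : ℝ, ∀ u v : ℂ, ‖u‖ ≤ C₁ → ‖v‖ ≤ C₂ →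
      (s + t ∉ Icc a b → u = 0 ∧ v = 0) → ‖(Real.log s : ℂ) * u + v‖
        ≤ indicator (Icc (-2 : ℝ) 2) (fun s => (C₁ + C₂) * (|Real.log s| + 1)) s := by
    intro t ht s u v hu hv h0
    by_cases hs : s + t ∈ Icc a b
    · rw [indicator_of_mem (show s ∈ Icc (-2 : ℝ) 2 from
        ⟨by linarith [hs.1, ht.2], by linarith [hs.2, ht.1]⟩)]
      refine (norm_add_le _ _).trans ?_
      rw [norm_mul, Complex.norm_real, Real.norm_eq_abs]
      have := mul_le_mul_of_nonneg_left hu (abs_nonneg (Real.log s))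
      nlinarith [abs_nonneg (Real.log s), mul_nonneg hC₂ (abs_nonneg (Real.log s))]
    · obtain ⟨e1, e2⟩ := h0 hs
      rw [e1, e2, mul_zero, add_zero, norm_zero]
      exact indicator_nonneg (fun s _ => by positivity) s
  have hlog : Measurable fun s : ℝ => (Real.log s : ℂ) :=
    Complex.measurable_ofReal.comp Real.measurable_log
  have cont : ∀ {R : ℝ × ℝ → ℂ}, (∀ p : ℝ × ℝ, p.1 ∈ Icc (-1 : ℝ) 1 → ContDiffAt ℝ 1 R p) →
      ∀ t ∈ Icc (-1 : ℝ) 1, Continuous (fun s : ℝ => R (t, s + t)) ∧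
        Continuous (fun s : ℝ => fderiv ℝ R (t, s + t) (1, 1)) := fun {R} hR t ht =>
    ⟨continuous_iff_continuousAt.2 fun s => ContinuousAt.comp (f := fun s => (t, s + t))
      (hR (t, s + t) ht).continuousAt (by fun_prop),
     continuous_iff_continuousAt.2 fun s => ContinuousAt.comp (f := fun s => (t, s + t))
      (g := fun p => fderiv ℝ R p (1, 1)) ((continuousAt_fderiv_of_contDiffAt
        (hR (t, s + t) ht)).clm_apply continuousAt_const) (by fun_prop)⟩
  -- After the shift the logarithm is `log |s|`, free of `t`. The derivative falls on the
  -- coefficients, along the diagonal direction `(1, 1)`, and the singularity does not get worse.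
  have main := hasDerivAt_integral_of_dominated_loc_of_deriv_le (μ := volume) (𝕜 := ℝ)
    (F := fun t s => (Real.log s : ℂ) * P (t, s + t) + Q (t, s + t))
    (F' := fun t s => (Real.log s : ℂ) * fderiv ℝ P (t, s + t) (1, 1)
      + fderiv ℝ Q (t, s + t) (1, 1)) (x₀ := t₀) (s := Ioo (-1) 1)
    (bound := indicator (Icc (-2 : ℝ) 2) (fun s => (C₁ + C₂) * (|Real.log s| + 1)))
    (isOpen_Ioo.mem_nhds ht) ?_ ?_ ?_ ?_ (integrable_log_bound _) ?_
  · obtain ⟨m1, m2⟩ := main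
    have e : ∀ t τ : ℝ, Real.log (t - τ) = Real.log (τ - t) := fun t τ => by
      rw [← Real.log_neg_eq_log, neg_sub]
    constructor
    · have := m1.comp_sub_right t₀
      simpa [e t₀] using this
    · refine (m2.congr_deriv ?_).congr_of_eventuallyEq (Eventually.of_forall fun t => ?_)
      · rw [← integral_sub_right_eq_self _ t₀]
        simp [e t₀]
      · simp only
        rw [← integral_add_right_eq_self _ t]
        simp
  · filter_upwards [isOpen_Ioo.mem_nhds ht] with t ht'
    have ht'' := Ioo_subset_Icc_self ht'
    exact (hlog.aestronglyMeasurable.mul (cont hP t ht'').1.aestronglyMeasurable).add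
      (cont hQ t ht'').1.aestronglyMeasurable
  · have ht'' := Ioo_subset_Icc_self ht
    refine (integrable_log_bound (C₁ + C₂)).mono' ((hlog.aestronglyMeasurable.mul
      (cont hP t₀ ht'').1.aestronglyMeasurable).add (cont hQ t₀ ht'').1.aestronglyMeasurable)
      (ae_of_all _ fun s => key t₀ ht'' s _ _ (hb₁ t₀ ht'' s).1 (hb₂ t₀ ht'' s).1 fun h =>
        ⟨(hP0 _ h).1, (hQ0 _ h).1⟩)
  · have ht'' := Ioo_subset_Icc_self ht
    exact (hlog.aestronglyMeasurable.mul (cont hP t₀ ht'').2.aestronglyMeasurable).add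
      (cont hQ t₀ ht'').2.aestronglyMeasurable
  · refine ae_of_all _ fun s t ht' => ?_
    have ht'' := Ioo_subset_Icc_self ht'
    refine key t ht'' s _ _ (hb₁ t ht'' s).2 (hb₂ t ht'' s).2 fun h => ?_
    rw [(hP0 (t, s + t) h).2, (hQ0 (t, s + t) h).2]
    simp
  · refine ae_of_all _ fun s t ht' => ?_
    have ht'' := Ioo_subset_Icc_self ht'
    have hd : ∀ {R : ℝ × ℝ → ℂ}, (∀ p : ℝ × ℝ, p.1 ∈ Icc (-1 : ℝ) 1 → ContDiffAt ℝ 1 R p) →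
        HasDerivAt (fun t => R (t, s + t)) (fderiv ℝ R (t, s + t) (1, 1)) t := fun {R} hR =>
      ((hR (t, s + t) ht'').differentiableAt (by simp)).hasFDerivAt.comp_hasDerivAt
        (f := fun t => (t, s + t)) t ((hasDerivAt_id t).prodMk ((hasDerivAt_id t).const_add s))
    exact ((hd hP).const_mul _).add (hd hQ)

/-- The fundamental theorem of calculus on the complement of a cut. -/
theorem integral_cutSet_deriv {F F' : ℝ → ℂ} {t a b : ℝ} (ha : a ∈ Ioo (-1) t) (hb : b ∈ Ioo t 1)
    (hF : ContinuousOn F (Icc (-1) 1 \ {t})) (hF' : ∀ τ ∈ Ioo (-1 : ℝ) 1, τ ≠ t → HasDerivAt F (F' τ) τ)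
    (hi : IntegrableOn F' (cutSet a b)) (h1 : F (-1) = 0) (h2 : F 1 = 0) :
    ∫ τ in cutSet a b, F' τ = F a - F b := by
  have i1 : IntegrableOn F' (Ioo (-1) a) := hi.mono_set subset_union_left
  have i2 : IntegrableOn F' (Ioo b 1) := hi.mono_set subset_union_right
  rw [integral_cutSet (by linarith [ha.2, hb.1]) ha.1.le hb.2.le i1 i2,
    intervalIntegral.integral_eq_sub_of_hasDerivAt_of_le ha.1.le
      (hF.mono fun τ hτ => ⟨⟨hτ.1, by linarith [hτ.2, ha.2, hb.1, hb.2]⟩,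
        ne_of_lt (lt_of_le_of_lt hτ.2 ha.2)⟩)
      (fun τ hτ => hF' τ ⟨hτ.1, by linarith [hτ.2, ha.2, hb.1, hb.2]⟩ (ne_of_lt (hτ.2.trans ha.2)))
      ((intervalIntegrable_iff_integrableOn_Ioo_of_le ha.1.le).2 i1),
    intervalIntegral.integral_eq_sub_of_hasDerivAt_of_le hb.2.le
      (hF.mono fun τ hτ => ⟨⟨by linarith [hτ.1, ha.1, ha.2, hb.1], hτ.2⟩,
        ne_of_gt (lt_of_lt_of_le hb.1 hτ.1)⟩)
      (fun τ hτ => hF' τ ⟨by linarith [hτ.1, ha.1, ha.2, hb.1], hτ.2⟩ (ne_of_gt (hb.1.trans hτ.1)))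
      ((intervalIntegrable_iff_integrableOn_Ioo_of_le hb.2.le).2 i2), h1, h2]
  ring

/-! ### Absolute convergence of logarithmic integrals, and their derivatives as principal values. -/

section LogKernel

variable {A B : ℝ × ℝ → ℂ} (hA : SmoothSq 1 A) (hB : SmoothSq 1 B)
include hA hB

/-- Absolute convergence of the integral of a logarithmic kernel. -/
theorem integrableOn_logKer_mul {f : ℝ → ℂ} (hf : IntegrableOn f (Ioo (-1) 1)) {t : ℝ}
    (ht : t ∈ Ioo (-1 : ℝ) 1) (hft : ContinuousAt f t) :
    IntegrableOn (fun τ => logKer A B t τ * f τ) (Ioo (-1) 1) := by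
  obtain ⟨a, ha, hab⟩ := hA.exists_bound
  obtain ⟨b, hb, hbb⟩ := hB.exists_bound
  obtain ⟨ε, hε, hball⟩ := Metric.continuousAt_iff.1 hft 1 one_pos
  set L := |Real.log ε| + Real.log 2
  have hlog : IntegrableOn (fun τ => Real.log (t - τ)) (Ioo (-1) 1) := by
    rw [← intervalIntegrable_iff_integrableOn_Ioo_of_le (by norm_num)]
    have h := (intervalIntegral.intervalIntegrable_log' (a := t - 1) (b := t + 1)).comp_sub_left t
    have h3 := h.symm
    simpa using h3
  have hL0 : 0 ≤ L := by have := Real.log_nonneg (one_le_two (α := ℝ)); positivity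
  -- Near `t` the density is bounded by `‖f t‖ + 1` and the logarithm is integrable; elsewhere the
  -- logarithm is bounded by `L` and the density is integrable. The sum dominates in both cases.
  have hdom : IntegrableOn (fun τ => (a * |Real.log (t - τ)| + b) * (‖f t‖ + 1)
      + (a * L + b) * ‖f τ‖) (Ioo (-1) 1) :=
    (((hlog.abs.const_mul a).add (integrableOn_const (by simp) (by simp))).mul_const _).add
      (hf.norm.const_mul _)
  refine hdom.mono' ((aestronglyMeasurable_logKer hA hB
    (Ioo_subset_Icc_self ht)).mul hf.aestronglyMeasurable) ?_
  refine (ae_restrict_iff' measurableSet_Ioo).2 (ae_of_all _ fun τ hτ => ?_)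
  have h1 : ‖logKer A B t τ‖ ≤ a * |Real.log (t - τ)| + b := by
    refine (norm_add_le _ _).trans ?_
    rw [norm_mul, Complex.norm_real, Real.norm_eq_abs, mul_comm a]
    exact add_le_add (mul_le_mul_of_nonneg_left
      (hab t (Ioo_subset_Icc_self ht) τ (Ioo_subset_Icc_self hτ)).1 (abs_nonneg _))
      (hbb t (Ioo_subset_Icc_self ht) τ (Ioo_subset_Icc_self hτ)).1
  rw [norm_mul]
  by_cases h : |t - τ| < ε
  · have h2 : ‖f τ‖ ≤ ‖f t‖ + 1 := by
      have := hball (x := τ) (by rwa [Real.dist_eq, abs_sub_comm])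
      rw [dist_eq_norm] at this
      have h4 := norm_le_norm_add_norm_sub (f t) (f τ)
      rw [norm_sub_rev] at h4
      linarith
    have := mul_le_mul h1 h2 (norm_nonneg _) (by positivity)
    nlinarith [mul_nonneg (add_nonneg (mul_nonneg ha hL0) hb) (norm_nonneg (f τ))]
  · have h2 : |Real.log (t - τ)| ≤ L := abs_log_le hε (not_lt.1 h)
      (by rw [abs_le]; constructor <;> linarith [ht.1, ht.2, hτ.1, hτ.2])
    have h3 : ‖logKer A B t τ‖ ≤ a * L + b := h1.trans (by gcongr)
    have := mul_le_mul_of_nonneg_right h3 (norm_nonneg (f τ))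
    have : 0 ≤ (a * |Real.log (t - τ)| + b) * (‖f t‖ + 1) := by positivity
    linarith

theorem integrableOn_cutSet_logKerDeriv {f : ℝ → ℂ} (hf : IntegrableOn f (Ioo (-1) 1)) {t a b : ℝ}
    (ht : t ∈ Ioo (-1 : ℝ) 1) (ha : a ∈ Ioo (-1) t) (hb : b ∈ Ioo t 1) :
    IntegrableOn (fun τ => logKerDeriv A B t τ * f τ) (cutSet a b) := by
  obtain ⟨C, hC⟩ := exists_logKer_bound hA hB
    (lt_min (sub_pos.2 ha.2) (sub_pos.2 hb.1))
  have hsub : cutSet a b ⊆ Ioo (-1) 1 :=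
    cutSet_subset (by linarith [ha.2, ht.2]) (by linarith [hb.1, ht.1])
  refine integrable_mul_of_bound (hf.mono_set hsub) ((aestronglyMeasurable_logKerDeriv hA hB
    (Ioo_subset_Icc_self ht)).mono_set hsub) (C := C) ?_
  refine (ae_restrict_iff' (measurableSet_cutSet _ _)).2 (ae_of_all _ fun τ hτ => ?_)
  rw [norm_mul]
  gcongr
  refine (hC t (Ioo_subset_Icc_self ht) τ (Ioo_subset_Icc_self (hsub hτ)) ?_).2
  rcases hτ with h | h
  · exact (min_le_left _ _).trans (le_trans (by linarith [h.2]) (le_abs_self _))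
  · exact (min_le_right _ _).trans (le_trans (by linarith [h.1]) (neg_le_abs _))

/-- Differentiation of the integral of a logarithmic kernel against a compactly supported density:
the derivative is a principal value. -/
theorem exists_hasDerivAt_integral_near {g : ℝ → ℂ} (hg : ContDiff ℝ 1 g) {a b t : ℝ}
    (ht : t ∈ Ioo (-1 : ℝ) 1) (ha : -1 < a) (hb : b < 1) (hg0 : ∀ τ ∉ Icc a b, g τ = 0) :
    ∃ D, HasDerivAt (fun s => ∫ τ in Ioo (-1 : ℝ) 1, logKer A B s τ * g τ) D t ∧
      ∀ {l : Filter ℝ} {n p : ℝ → ℝ}, IsCut l n p t →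
        Tendsto (fun r => ∫ τ in cutSet (n r) (p r), logKerDeriv A B t τ * g τ) l (𝓝 D) := by
  set P : ℝ × ℝ → ℂ := fun p => A p * g p.2 with hPdef
  set Q : ℝ × ℝ → ℂ := fun p => B p * g p.2 with hQdef
  have hP : ∀ p : ℝ × ℝ, p.1 ∈ Icc (-1 : ℝ) 1 → ContDiffAt ℝ 1 P p := fun p hp =>
    contDiffAt_mul_density hA hg ha hb hg0 hp
  have hQ : ∀ p : ℝ × ℝ, p.1 ∈ Icc (-1 : ℝ) 1 → ContDiffAt ℝ 1 Q p := fun p hp =>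
    contDiffAt_mul_density hB hg ha hb hg0 hp
  have hP0 : ∀ p : ℝ × ℝ, p.2 ∉ Icc a b → P p = 0 ∧ fderiv ℝ P p = 0 := fun p hp =>
    ⟨by simp [hPdef, hg0 p.2 hp], fderiv_mul_density_eq_zero hg0 hp⟩
  have hQ0 : ∀ p : ℝ × ℝ, p.2 ∉ Icc a b → Q p = 0 ∧ fderiv ℝ Q p = 0 := fun p hp =>
    ⟨by simp [hQdef, hg0 p.2 hp], fderiv_mul_density_eq_zero hg0 hp⟩
  obtain ⟨hi, hd⟩ := hasDerivAt_integral_shift ht ha hb hP hQ hP0 hQ0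
  set R : ℝ → ℂ := fun τ => (Real.log (t - τ) : ℂ) * fderiv ℝ P (t, τ) (1, 1)
    + fderiv ℝ Q (t, τ) (1, 1) with hR
  have out : ∀ τ ∉ Ioo (-1 : ℝ) 1, τ ∉ Icc a b := fun τ hτ h =>
    hτ ⟨by linarith [h.1], by linarith [h.2]⟩
  refine ⟨∫ τ, R τ, ?_, fun {l n p} hc => ?_⟩
  · refine hd.congr_of_eventuallyEq (Eventually.of_forall fun s => ?_)
    simp only
    rw [setIntegral_eq_integral_of_forall_compl_eq_zero fun τ hτ => by
      rw [hg0 τ (out τ hτ), mul_zero]]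
    exact integral_congr_ae (ae_of_all _ fun τ => by simp only [logKer, hPdef, hQdef]; ring)
  · have e1 : ∫ τ, R τ = ∫ τ in Ioo (-1 : ℝ) 1, R τ :=
      (setIntegral_eq_integral_of_forall_compl_eq_zero fun τ hτ => by
        simp only [hR]
        rw [(hP0 (t, τ) (out τ hτ)).2, (hQ0 (t, τ) (out τ hτ)).2]; simp).symm
    have l1 := hc.tendsto_integral ht hi.integrableOn
    have ht' := Ioo_subset_Icc_self ht
    have dP : ∀ τ, DifferentiableAt ℝ P (t, τ) := fun τ => (hP (t, τ) ht').differentiableAt (by simp)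
    have dQ : ∀ τ, DifferentiableAt ℝ Q (t, τ) := fun τ => (hQ (t, τ) ht').differentiableAt (by simp)
    have l2 := hc.tendsto_boundary_log (hasDerivAt_snd (dP t)).differentiableAt
      (hasDerivAt_snd (dQ t)).continuousAt
    have l3 := l1.sub l2
    rw [sub_zero, ← e1] at l3
    refine l3.congr' ?_
    filter_upwards [hc.eventually ht] with r hr
    have hsub : cutSet (n r) (p r) ⊆ Ioo (-1) 1 :=
      cutSet_subset (by linarith [hr.1.2, ht.2]) (by linarith [hr.2.1, ht.1])
    have hgi : IntegrableOn g (Ioo (-1) 1) :=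
      (hg.continuous.integrableOn_Icc (a := -1) (b := 1)).mono_set Ioo_subset_Icc_self
    have hi2 := integrableOn_cutSet_logKerDeriv hA hB hgi ht hr.1 hr.2
    have hK : ∀ τ ∈ cutSet (n r) (p r), logKerDeriv A B t τ * g τ
        = P (t, τ) / (t - τ) + (Real.log (t - τ) : ℂ) * fderiv ℝ P (t, τ) (1, 0)
          + fderiv ℝ Q (t, τ) (1, 0) := by
      intro τ hτ
      have hτ' := Ioo_subset_Icc_self (hsub hτ)
      have key : ∀ {S : ℝ × ℝ → ℂ}, SmoothSq 1 S →
          fderiv ℝ (fun p : ℝ × ℝ => S p * g p.2) (t, τ) (1, 0) = fderiv ℝ S (t, τ) (1, 0) * g τ := by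
        intro S hS
        have h1 := (hasDerivAt_fst (hS.differentiableAt ht' hτ')).mul_const (g τ)
        have h2 := hasDerivAt_fst (A := fun p : ℝ × ℝ => S p * g p.2) (t := t) (τ := τ)
          ((contDiffAt_mul_density hS hg ha hb hg0 ht').differentiableAt (by simp))
        exact h2.unique h1
      rw [hPdef, hQdef, key hA, key hB, logKerDeriv]
      ring
    have hF' : ∀ τ ∈ Ioo (-1 : ℝ) 1, τ ≠ t → HasDerivAt (fun τ => logKer P Q t τ)
        (-(P (t, τ) / (t - τ)) + (Real.log (t - τ) : ℂ) * fderiv ℝ P (t, τ) (0, 1)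
          + fderiv ℝ Q (t, τ) (0, 1)) τ := by
      intro τ hτ hne
      have hl : HasDerivAt (fun s => ((Real.log (t - s) : ℝ) : ℂ)) (-((t - τ : ℝ) : ℂ)⁻¹) τ := by
        have := (((hasDerivAt_id τ).const_sub t).log (sub_ne_zero.2 hne.symm)).ofReal_comp
        refine this.congr_deriv ?_
        simp [neg_div]
      refine ((hl.mul (hasDerivAt_snd (dP τ))).add (hasDerivAt_snd (dQ τ))).congr_deriv ?_
      push_cast; ring
    -- Since `(1, 1) = (1, 0) + (0, 1)`, the shifted integrand differs from the differentiated
    -- kernel by the `τ`-derivative of `logKer P Q t`. Over the cut this integrates to the boundary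
    -- terms that `l2` sends to zero.
    have eR : ∀ τ ∈ cutSet (n r) (p r), R τ - logKerDeriv A B t τ * g τ
        = -(P (t, τ) / (t - τ)) + (Real.log (t - τ) : ℂ) * fderiv ℝ P (t, τ) (0, 1)
          + fderiv ℝ Q (t, τ) (0, 1) := by
      intro τ hτ
      rw [hK τ hτ, hR]
      have e : ((1 : ℝ), (1 : ℝ)) = (1, 0) + (0, 1) := by simp
      simp only [e, map_add]
      ring
    have hcont : ContinuousOn (fun τ => logKer P Q t τ) (Icc (-1) 1 \ {t}) := by
      refine ((ContinuousOn.mul ?_ ?_).add ?_)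
      · exact Complex.continuous_ofReal.comp_continuousOn ((continuousOn_const.sub
          continuousOn_id).log fun τ hτ => sub_ne_zero.2 (Ne.symm hτ.2))
      · exact fun τ _ => (hasDerivAt_snd (dP τ)).continuousAt.continuousWithinAt
      · exact fun τ _ => (hasDerivAt_snd (dQ τ)).continuousAt.continuousWithinAt
    have z : ∀ τ ∉ Icc a b, logKer P Q t τ = 0 := fun τ hτ => by
      rw [logKer, (hP0 (t, τ) hτ).1, (hQ0 (t, τ) hτ).1]; simp
    have hi3 : IntegrableOn (fun τ => R τ - logKerDeriv A B t τ * g τ) (cutSet (n r) (p r)) :=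
      hi.integrableOn.sub hi2
    have ftc := integral_cutSet_deriv hr.1 hr.2 hcont hF'
      (hi3.congr_fun eR (measurableSet_cutSet _ _)) (z _ (out _ (by simp))) (z _ (out _ (by simp)))
    rw [← setIntegral_congr_fun (measurableSet_cutSet _ _) eR, integral_sub hi.integrableOn hi2] at ftc
    simp only [logKer] at ftc
    linear_combination ftc

/-- The derivative of the integral of a logarithmic kernel is the principal value of the integral of
the differentiated kernel. -/
theorem exists_hasDerivAt_integral_logKer {f : ℝ → ℂ} (hf : IntegrableOn f (Ioo (-1) 1))
    (hf1 : ContDiffOn ℝ 1 f (Ioo (-1) 1)) {t : ℝ} (ht : t ∈ Ioo (-1 : ℝ) 1) :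
    ∃ D, HasDerivAt (fun s => ∫ τ in Ioo (-1 : ℝ) 1, logKer A B s τ * f τ) D t ∧
      ∀ {l : Filter ℝ} {n p : ℝ → ℝ}, IsCut l n p t →
        Tendsto (fun r => ∫ τ in cutSet (n r) (p r), logKerDeriv A B t τ * f τ) l (𝓝 D) := by
  set ρ := min (t + 1) (1 - t) / 2 with hρ
  have hmin : 0 < min (t + 1) (1 - t) := lt_min (by linarith [ht.1]) (by linarith [ht.2])
  have h1 := min_le_left (t + 1) (1 - t)
  have h2 := min_le_right (t + 1) (1 - t)
  -- The cutoff is one near `t` and vanishes before the endpoints: `χ f` is `C¹` with compact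
  -- support, and `f - χ f` is integrable and zero near `t`.
  let χ : ContDiffBump t := ⟨ρ / 2, ρ, by positivity, by linarith⟩
  set g : ℝ → ℂ := fun τ => (χ τ : ℂ) * f τ with hg_def
  have hg0 : ∀ τ ∉ Icc (t - ρ) (t + ρ), g τ = 0 := by
    intro τ hτ
    have : χ τ = 0 := by
      by_contra h
      have hs : τ ∈ Function.support χ := h
      rw [χ.support_eq, Real.ball_eq_Ioo] at hs
      exact hτ (Ioo_subset_Icc_self hs)
    simp [hg_def, this]
  have hg : ContDiff ℝ 1 g := by
    refine contDiff_iff_contDiffAt.2 fun τ => ?_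
    by_cases h : τ ∈ Icc (t - ρ) (t + ρ)
    · have hχ : ContDiffAt ℝ 1 (fun τ => (χ τ : ℂ)) τ :=
        Complex.ofRealCLM.contDiff.contDiffAt.comp τ χ.contDiffAt
      exact hχ.mul (hf1.contDiffAt (isOpen_Ioo.mem_nhds ⟨by linarith [h.1], by linarith [h.2]⟩))
    · refine (contDiffAt_const (c := (0 : ℂ))).congr_of_eventuallyEq ?_
      filter_upwards [isClosed_Icc.isOpen_compl.mem_nhds h] with s hs using hg0 s hs
  have hgi : IntegrableOn g (Ioo (-1) 1) :=
    (hg.continuous.integrableOn_Icc (a := -1) (b := 1)).mono_set Ioo_subset_Icc_self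
  have hf1i : IntegrableOn (fun τ => f τ - g τ) (Ioo (-1) 1) := hf.sub hgi
  have hf10 : ∀ τ, |τ - t| < ρ / 2 → f τ - g τ = 0 := by
    intro τ hτ
    have : χ τ = 1 := χ.one_of_mem_closedBall (by
      rw [Metric.mem_closedBall, Real.dist_eq]; exact hτ.le)
    simp [hg_def, this]
  obtain ⟨i1, d1⟩ := hasDerivAt_integral_away hA hB hf1i ht (by positivity : 0 < ρ / 2) hf10
  obtain ⟨D, d2, l2⟩ := exists_hasDerivAt_integral_near hA hB hg ht (by linarith : -1 < t - ρ)
    (by linarith : t + ρ < 1) hg0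
  have split : ∀ τ, f τ = (f τ - g τ) + g τ := fun τ => by ring
  refine ⟨_, (d1.add d2).congr_of_eventuallyEq ?_, fun {l n p} hc => ?_⟩
  · filter_upwards [isOpen_Ioo.mem_nhds ht] with s hs
    have cf : ContinuousAt f s := (hf1.contDiffAt (isOpen_Ioo.mem_nhds hs)).continuousAt
    have cg : ContinuousAt g s := hg.continuous.continuousAt
    simp only [Pi.add_apply]
    rw [← integral_add (integrableOn_logKer_mul hA hB hf1i hs (cf.sub cg))
      (integrableOn_logKer_mul hA hB hgi hs cg)]
    exact integral_congr_ae (ae_of_all _ fun τ => by ring)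
  · refine ((hc.tendsto_integral ht i1).add (l2 hc)).congr' ?_
    filter_upwards [hc.eventually ht] with r hr
    have hsub : cutSet (n r) (p r) ⊆ Ioo (-1) 1 :=
      cutSet_subset (by linarith [hr.1.2, ht.2]) (by linarith [hr.2.1, ht.1])
    rw [← integral_add (i1.mono_set hsub) (integrableOn_cutSet_logKerDeriv hA hB hgi ht hr.1 hr.2)]
    exact integral_congr_ae (ae_of_all _ fun τ => by ring)

end LogKernel

/-- The derivative of a logarithmic kernel contributes to the integral outside a ball of radius `r`
a boundary term of the form `a / r`, up to a vanishing remainder. -/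
theorem IsCut.exists_tendsto_boundary_logKerDeriv {A B : ℝ × ℝ → ℂ} (hA : SmoothSq 2 A)
    (hB : SmoothSq 1 B) {u : ℝ → ℂ} {t : ℝ} (ht : t ∈ Ioo (-1 : ℝ) 1) (hu : DifferentiableAt ℝ u t)
    {n p N : ℝ → ℝ} (hc : IsCut (𝓝[>] 0) n p t) (hN : DifferentiableAt ℝ N t) (hN0 : N t ≠ 0)
    (hn : ∀ᶠ r in 𝓝[>] (0 : ℝ), (t - n r) * N (n r) = r)
    (hp : ∀ᶠ r in 𝓝[>] (0 : ℝ), (p r - t) * N (p r) = r) :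
    ∃ a : ℂ, Tendsto (fun r => logKerDeriv A B t (n r) * u (n r) - logKerDeriv A B t (p r) * u (p r)
      - (r : ℂ)⁻¹ * a) (𝓝[>] 0) (𝓝 0) := by
  have ht' := Ioo_subset_Icc_self ht
  have hA1 : SmoothSq 1 A := hA.of_le (by norm_num)
  -- As `(t - n) N(n) = r = (p - t) N(p)`, the polar terms at the two endpoints are exactly `m(n) /
  -- r` and `-m(p) / r`.
  set m : ℝ → ℂ := fun τ => N τ * A (t, τ) * u τ with hm_def
  have hAs : DifferentiableAt ℝ (fun τ => A (t, τ)) t :=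
    (hasDerivAt_snd (hA1.differentiableAt ht' ht')).differentiableAt
  have hNC : DifferentiableAt ℝ (fun τ => (N τ : ℂ)) t := hN.hasDerivAt.ofReal_comp.differentiableAt
  have hm : DifferentiableAt ℝ m t := (hNC.mul hAs).mul hu
  have hA' : DifferentiableAt ℝ (fun τ => fderiv ℝ A (t, τ) (1, 0)) t := by
    have h1 : DifferentiableAt ℝ (fderiv ℝ A) (t, t) :=
      ((hA (t, t) ⟨ht', ht'⟩).fderiv_right (m := 1) (by norm_num)).differentiableAt (by simp)
    have h2 : DifferentiableAt ℝ (fun τ => fderiv ℝ A (t, τ)) t :=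
      DifferentiableAt.comp t (f := fun τ => (t, τ)) h1 (by fun_prop)
    exact h2.clm_apply (differentiableAt_const _)
  have hB' : ContinuousAt (fun τ => fderiv ℝ B (t, τ) (1, 0)) t :=
    ContinuousAt.comp (f := fun τ => (t, τ)) (g := fun p => fderiv ℝ B p (1, 0))
      ((continuousAt_fderiv_of_contDiffAt (hB (t, t) ⟨ht', ht'⟩)).clm_apply continuousAt_const)
      (by fun_prop)
  have hnt : ∀ᶠ r in 𝓝[>] (0 : ℝ), n r < t := hc.tendsto_n.eventually self_mem_nhdsWithin
  have hpt : ∀ᶠ r in 𝓝[>] (0 : ℝ), t < p r := hc.tendsto_p.eventually self_mem_nhdsWithin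
  have hr0 : ∀ᶠ r in 𝓝[>] (0 : ℝ), 0 < r := self_mem_nhdsWithin
  have inv : ∀ {q : ℝ → ℝ}, Tendsto q (𝓝[>] 0) (𝓝 t) →
      Tendsto (fun r => ((N (q r))⁻¹ : ℂ)) (𝓝[>] 0) (𝓝 ((N t : ℂ)⁻¹)) := fun hq =>
    (hNC.continuousAt.tendsto.comp hq).inv₀ (by exact_mod_cast hN0)
  have l1 := tendsto_slope_mul hm hc.tendsto_n' (hnt.mono fun r h => ne_of_lt h)
    (m := fun r => (r : ℂ)⁻¹) (c := -(N t : ℂ)⁻¹) (by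
      refine (inv hc.tendsto_n').neg.congr' ?_
      filter_upwards [hn, hr0] with r h h0
      have h1 : (r : ℂ) ≠ 0 := by exact_mod_cast h0.ne'
      have h2 : (N (n r) : ℂ) ≠ 0 := by
        intro h2
        rw [Complex.ofReal_eq_zero.1 h2, mul_zero] at h
        exact h0.ne h
      have h3 : ((t - n r) * N (n r) : ℂ) = r := by exact_mod_cast h
      rw [← h3] at h1 ⊢
      have h4 := left_ne_zero_of_mul h1
      push_cast
      field_simp
      ring)
  have l2 := tendsto_slope_mul hm hc.tendsto_p' (hpt.mono fun r h => ne_of_gt h)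
    (m := fun r => (r : ℂ)⁻¹) (c := (N t : ℂ)⁻¹) (by
      refine (inv hc.tendsto_p').congr' ?_
      filter_upwards [hp, hr0] with r h h0
      have h1 : (r : ℂ) ≠ 0 := by exact_mod_cast h0.ne'
      have h2 : (N (p r) : ℂ) ≠ 0 := by
        intro h2
        rw [Complex.ofReal_eq_zero.1 h2, mul_zero] at h
        exact h0.ne h
      have h3 : ((p r - t) * N (p r) : ℂ) = r := by exact_mod_cast h
      rw [← h3] at h1 ⊢
      have h4 := left_ne_zero_of_mul h1
      push_cast
      field_simp)
  have l3 := hc.tendsto_boundary_log (hA'.mul hu) (hB'.mul hu.continuousAt)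
  -- The polar part is `(m(n) + m(p)) / r`. Beyond `2 m(t) / r` it tends to `m'(t) (-1/N(t) +
  -- 1/N(t)) = 0`.
  refine ⟨2 * m t, ?_⟩
  have l4 := (l1.add l2).add l3
  rw [neg_mul, neg_add_cancel, add_zero] at l4
  refine l4.congr' ?_
  filter_upwards [hn, hp, hnt, hpt, hr0] with r h1 h2 h3 h4 h0
  have e1 : A (t, n r) / ((t : ℂ) - n r) * u (n r) = (r : ℂ)⁻¹ * m (n r) := by
    have hd : ((t : ℂ) - n r) ≠ 0 := by exact_mod_cast sub_ne_zero.2 (ne_of_gt h3)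
    have hr : (r : ℂ) ≠ 0 := by exact_mod_cast h0.ne'
    have e : ((t - n r) * N (n r) : ℂ) = r := by exact_mod_cast h1
    simp only [hm_def]
    field_simp
    linear_combination -(A (t, n r) * u (n r)) * e
  have e2 : A (t, p r) / ((t : ℂ) - p r) * u (p r) = -((r : ℂ)⁻¹ * m (p r)) := by
    have hd : ((t : ℂ) - p r) ≠ 0 := by exact_mod_cast sub_ne_zero.2 (ne_of_lt h4)
    have hr : (r : ℂ) ≠ 0 := by exact_mod_cast h0.ne'
    have e : ((p r - t) * N (p r) : ℂ) = r := by exact_mod_cast h2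
    simp only [hm_def]
    field_simp
    linear_combination -(A (t, p r) * u (p r)) * e
  simp only [logKerDeriv, add_mul, e1, e2, Pi.mul_apply]
  ring

/-! ### Logarithmic kernels on an arc -/

/-- A kernel with at most a logarithmic singularity on the diagonal. -/
def IsLogKernel (K : ℝ → ℝ → ℂ) : Prop :=
  ∃ A B, SmoothSq 2 A ∧ SmoothSq 1 B ∧
    ∀ t ∈ Ioo (-1 : ℝ) 1, ∀ τ ∈ Ioo (-1 : ℝ) 1, t ≠ τ → K t τ = logKer A B t τ

namespace IsLogKernel

variable {K K' : ℝ → ℝ → ℂ}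

theorem congr (hK : IsLogKernel K)
    (h : ∀ t ∈ Ioo (-1 : ℝ) 1, ∀ τ ∈ Ioo (-1 : ℝ) 1, t ≠ τ → K' t τ = K t τ) : IsLogKernel K' := by
  obtain ⟨A, B, hA, hB, e⟩ := hK
  exact ⟨A, B, hA, hB, fun t ht τ hτ hne => (h t ht τ hτ hne).trans (e t ht τ hτ hne)⟩

theorem add (hK : IsLogKernel K) (hK' : IsLogKernel K') : IsLogKernel fun t τ => K t τ + K' t τ := by
  obtain ⟨A, B, hA, hB, e⟩ := hK
  obtain ⟨A', B', hA', hB', e'⟩ := hK'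
  refine ⟨_, _, hA.add hA', hB.add hB', fun t ht τ hτ hne => ?_⟩
  simp only [e t ht τ hτ hne, e' t ht τ hτ hne, logKer]
  ring

theorem smooth_mul (hK : IsLogKernel K) {S : ℝ × ℝ → ℂ} (hS : SmoothSq 2 S) :
    IsLogKernel fun t τ => S (t, τ) * K t τ := by
  obtain ⟨A, B, hA, hB, e⟩ := hK
  refine ⟨_, _, hS.mul hA, (hS.of_le (by norm_num)).mul hB, fun t ht τ hτ hne => ?_⟩
  simp only [e t ht τ hτ hne, logKer]
  ring

theorem const_mul (hK : IsLogKernel K) (c : ℂ) : IsLogKernel fun t τ => c * K t τ :=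
  hK.smooth_mul (smoothSq_const c)

end IsLogKernel

/-! ### Functions of `x - y` pulled back to the parameters. -/

namespace SmoothArc.IsExtension

variable {Γ : SmoothArc} {y : ℝ → Pt} (hy : Γ.IsExtension y)
include hy

theorem sub_ne {t τ : ℝ} (ht : t ∈ Icc (-1 : ℝ) 1) (hτ : τ ∈ Icc (-1 : ℝ) 1) (hne : t ≠ τ) :
    y t - y τ ≠ 0 :=
  sub_ne_zero.2 fun h => hne (hy.injOn ht hτ h)

theorem contDiff_sub : ContDiff ℝ 2 fun p : ℝ × ℝ => y p.1 - y p.2 :=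
  (hy.contDiff_two.comp contDiff_fst).sub (hy.contDiff_two.comp contDiff_snd)

omit hy in
theorem contDiff_coord {n : WithTop ℕ∞} (i : Fin 2) : ContDiff ℝ n fun z : Pt => ((z i : ℝ) : ℂ) :=
  Complex.ofRealCLM.contDiff.comp (EuclideanSpace.proj (𝕜 := ℝ) i).contDiff

theorem smoothSq_radial {f : ℝ → ℂ} (hf : ContDiff ℝ ∞ f) :
    SmoothSq 2 fun p => f (‖y p.1 - y p.2‖ ^ 2) := fun _ _ =>
  (((hf.of_le (WithTop.coe_le_coe.2 (le_top : ((2 : ℕ) : ℕ∞) ≤ ⊤))).comp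
    (hy.contDiff_sub.norm_sq ℝ))).contDiffAt

theorem smoothSq_coord (i : Fin 2) : SmoothSq 2 fun p => (((y p.1 - y p.2) i : ℝ) : ℂ) := fun _ _ =>
  ((contDiff_coord i).comp hy.contDiff_sub).contDiffAt

theorem smoothSq_diffQuot (i : Fin 2) : SmoothSq 1 fun p => ((diffQuot y p i : ℝ) : ℂ) := fun _ _ =>
  ((contDiff_coord i).comp (contDiff_diffQuot hy.contDiff_two)).contDiffAt

theorem normSq_diffQuot_ne {p : ℝ × ℝ} (hp : p ∈ Icc (-1 : ℝ) 1 ×ˢ Icc (-1 : ℝ) 1) :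
    ‖diffQuot y p‖ ^ 2 ≠ 0 :=
  (norm_sq_pos (hy.diffQuot_ne hp.1 hp.2)).ne'

theorem smoothSq_log_diffQuot : SmoothSq 1 fun p => ((Real.log (‖diffQuot y p‖ ^ 2) : ℝ) : ℂ) :=
  fun p hp => Complex.ofRealCLM.contDiff.contDiffAt.comp p
    ((((contDiff_diffQuot hy.contDiff_two).norm_sq ℝ).contDiffAt).log (hy.normSq_diffQuot_ne hp))

theorem smoothSq_inv_diffQuot : SmoothSq 1 fun p => (((‖diffQuot y p‖ ^ 2)⁻¹ : ℝ) : ℂ) :=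
  fun p hp => Complex.ofRealCLM.contDiff.contDiffAt.comp p
    ((((contDiff_diffQuot hy.contDiff_two).norm_sq ℝ).contDiffAt).inv (hy.normSq_diffQuot_ne hp))

theorem norm_sub_sq (t τ : ℝ) : ‖y t - y τ‖ ^ 2 = (t - τ) ^ 2 * ‖diffQuot y (t, τ)‖ ^ 2 := by
  rw [hy.norm_sub, mul_pow, sq_abs]

/-- A kernel which is a combination of `log |x - y|²` with smooth coefficients. -/
theorem isLogKernel_of_eq {K : ℝ → ℝ → ℂ} {α β : ℝ × ℝ → ℂ} (hα : SmoothSq 2 α) (hβ : SmoothSq 1 β)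
    (h : ∀ t ∈ Ioo (-1 : ℝ) 1, ∀ τ ∈ Ioo (-1 : ℝ) 1, t ≠ τ →
      K t τ = α (t, τ) * (Real.log (‖y t - y τ‖ ^ 2) : ℝ) + β (t, τ)) : IsLogKernel K := by
  -- `log |y t - y τ|² = 2 log |t - τ| + log |X|²`, and `X` does not vanish on the closed square.
  refine ⟨fun p => 2 * α p, fun p => α p * (Real.log (‖diffQuot y p‖ ^ 2) : ℝ) + β p,
    (smoothSq_const 2).mul hα, ((hα.of_le (by norm_num)).mul hy.smoothSq_log_diffQuot).add hβ,
    fun t ht τ hτ hne => ?_⟩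
  rw [h t ht τ hτ hne, hy.norm_sub_sq, Real.log_mul (pow_ne_zero 2 (sub_ne_zero.2 hne))
    (hy.normSq_diffQuot_ne (p := (t, τ)) ⟨Ioo_subset_Icc_self ht, Ioo_subset_Icc_self hτ⟩),
    Real.log_pow, logKer]
  push_cast
  ring

variable {F : Pt → ℂ} {c : ℂ} {a d b : ℝ → ℂ}

theorem isLogKernel (hF : LogForm F c a d b) : IsLogKernel fun t τ => F (y t - y τ) :=
  hy.isLogKernel_of_eq (hy.smoothSq_radial hF.contDiff_a)
    ((hy.smoothSq_radial hF.contDiff_b).of_le (by norm_num)) fun t ht τ hτ hne =>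
    hF.eq _ (hy.sub_ne (Ioo_subset_Icc_self ht) (Ioo_subset_Icc_self hτ) hne)

/-- With no constant in the logarithmic coefficient, the quotient `a(ρ) / ρ` is the smooth function
`d(ρ)`. -/
theorem isLogKernel_pd (hF : LogForm F 0 a d b) (i : Fin 2) :
    IsLogKernel fun t τ => pd i F (y t - y τ) := by
  refine hy.isLogKernel_of_eq
    (α := fun p => 2 * (((y p.1 - y p.2) i : ℝ) : ℂ) * deriv a (‖y p.1 - y p.2‖ ^ 2))
    (β := fun p => 2 * (((y p.1 - y p.2) i : ℝ) : ℂ) * (d (‖y p.1 - y p.2‖ ^ 2)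
      + deriv b (‖y p.1 - y p.2‖ ^ 2)))
    (((smoothSq_const 2).mul (hy.smoothSq_coord i)).mul
      (hy.smoothSq_radial (LogForm.contDiff_deriv hF.contDiff_a)))
    ((((smoothSq_const 2).mul (hy.smoothSq_coord i)).mul
      ((hy.smoothSq_radial hF.contDiff_d).add
      (hy.smoothSq_radial (LogForm.contDiff_deriv hF.contDiff_b)))).of_le (by norm_num))
    fun t ht τ hτ hne => ?_
  rw [hF.pd_eq_of_zero i (hy.sub_ne (Ioo_subset_Icc_self ht) (Ioo_subset_Icc_self hτ) hne)]
  ring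

/-- The only factor not smooth in `z` besides the logarithm is `z_i z_j / |z|²`. Along the arc the
powers of `t - τ` cancel in it and leave `X_i X_j / |X|²`, which is `C¹` up to the diagonal. -/
theorem isLogKernel_pd_pd (hF : LogForm F 0 a d b) (i j : Fin 2) :
    IsLogKernel fun t τ => pd j (pd i F) (y t - y τ) := by
  have ha' := LogForm.contDiff_deriv hF.contDiff_a
  have hb' := LogForm.contDiff_deriv hF.contDiff_b
  have ha'' := LogForm.contDiff_deriv ha'
  have hb'' := LogForm.contDiff_deriv hb'
  have r1 : ∀ {f : ℝ → ℂ}, ContDiff ℝ ∞ f → SmoothSq 1 fun p => f (‖y p.1 - y p.2‖ ^ 2) :=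
    fun hf => (hy.smoothSq_radial hf).of_le (by norm_num)
  have c1 : ∀ i, SmoothSq 1 fun p => (((y p.1 - y p.2) i : ℝ) : ℂ) :=
    fun i => (hy.smoothSq_coord i).of_le (by norm_num)
  refine hy.isLogKernel_of_eq
    (α := fun p => 2 * (if i = j then 1 else 0) * deriv a (‖y p.1 - y p.2‖ ^ 2)
      + 4 * (((y p.1 - y p.2) i : ℝ) : ℂ) * (((y p.1 - y p.2) j : ℝ) : ℂ)
        * deriv (deriv a) (‖y p.1 - y p.2‖ ^ 2))
    (β := fun p => (2 * (if i = j then 1 else 0) * (d (‖y p.1 - y p.2‖ ^ 2)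
          + deriv b (‖y p.1 - y p.2‖ ^ 2))
        + 4 * (((y p.1 - y p.2) i : ℝ) : ℂ) * (((y p.1 - y p.2) j : ℝ) : ℂ)
          * deriv (deriv b) (‖y p.1 - y p.2‖ ^ 2))
      + 4 * ((diffQuot y p i : ℝ) : ℂ) * ((diffQuot y p j : ℝ) : ℂ)
          * (((‖diffQuot y p‖ ^ 2)⁻¹ : ℝ) : ℂ)
          * (2 * deriv a (‖y p.1 - y p.2‖ ^ 2) + -1 * d (‖y p.1 - y p.2‖ ^ 2)))
    (((smoothSq_const _).mul (hy.smoothSq_radial ha')).add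
      ((((smoothSq_const 4).mul (hy.smoothSq_coord i)).mul (hy.smoothSq_coord j)).mul
        (hy.smoothSq_radial ha'')))
    ((((smoothSq_const _).mul ((r1 hF.contDiff_d).add (r1 hb'))).add
      ((((smoothSq_const 4).mul (c1 i)).mul (c1 j)).mul (r1 hb''))).add
      (((((smoothSq_const 4).mul (hy.smoothSq_diffQuot i)).mul (hy.smoothSq_diffQuot j)).mul
        hy.smoothSq_inv_diffQuot).mul (((smoothSq_const 2).mul (r1 ha')).add
          ((smoothSq_const (-1)).mul (r1 hF.contDiff_d)))))
    fun t ht τ hτ hne => ?_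
  have hz := hy.sub_ne (Ioo_subset_Icc_self ht) (Ioo_subset_Icc_self hτ) hne
  have hX := hy.normSq_diffQuot_ne (p := (t, τ)) ⟨Ioo_subset_Icc_self ht, Ioo_subset_Icc_self hτ⟩
  have e : (((y t - y τ) i : ℝ) : ℂ) * (((y t - y τ) j : ℝ) : ℂ)
      * ((‖y t - y τ‖ ^ 2 : ℝ) : ℂ)⁻¹ = ((diffQuot y (t, τ) i : ℝ) : ℂ)
        * ((diffQuot y (t, τ) j : ℝ) : ℂ) * (((‖diffQuot y (t, τ)‖ ^ 2)⁻¹ : ℝ) : ℂ) := by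
    rw [hy.norm_sub_sq, ← diffQuot_smul hy.contDiff_two t τ]
    have h1 : (t - τ) ≠ 0 := sub_ne_zero.2 hne
    norm_cast
    simp only [PiLp.smul_apply, smul_eq_mul]
    field_simp
  rw [hF.pd_pd_eq_of_zero i j hz, e]
  ring

/-- A `C²` extension of the components of the normal. -/
theorem exists_normal (i : Fin 2) : ∃ ν : ℝ → ℂ, (∀ t ∈ Icc (-1 : ℝ) 1, ContDiffAt ℝ 2 ν t) ∧
    ∀ t ∈ Ioo (-1 : ℝ) 1, toC (Γ.normal t) i = ν t := by
  have h : ∀ j, ∀ t ∈ Icc (-1 : ℝ) 1,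
      ContDiffAt ℝ 2 (fun t => ((deriv y t j * ‖deriv y t‖⁻¹ : ℝ) : ℂ)) t := fun j t ht =>
    Complex.ofRealCLM.contDiff.contDiffAt.comp t
      (((EuclideanSpace.proj (𝕜 := ℝ) j).contDiff.comp hy.contDiff_deriv).contDiffAt.mul
      ((hy.contDiff_deriv.contDiffAt.norm ℝ (hy.deriv_ne ht)).inv
        (norm_ne_zero_iff.2 (hy.deriv_ne ht))))
  fin_cases i
  · exact ⟨_, h 1, fun t ht => by
      simp [toC, normal, hy.deriv_eq ht, hy.speed_eq ht, div_eq_mul_inv]⟩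
  · exact ⟨_, fun t ht => (h 0 t ht).neg, fun t ht => by
      simp [toC, normal, hy.deriv_eq ht, hy.speed_eq ht, div_eq_mul_inv]⟩

theorem isLogKernel_normal_left {K : ℝ → ℝ → ℂ} (hK : IsLogKernel K) (i : Fin 2) :
    IsLogKernel fun t τ => toC (Γ.normal t) i * K t τ := by
  obtain ⟨ν, h1, h2⟩ := hy.exists_normal i
  exact (hK.smooth_mul (S := fun p => ν p.1) fun p hp =>
    (h1 p.1 hp.1).comp p contDiffAt_fst).congr fun t ht τ _ _ => by rw [h2 t ht]

theorem isLogKernel_normal_right {K : ℝ → ℝ → ℂ} (hK : IsLogKernel K) (i : Fin 2) :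
    IsLogKernel fun t τ => toC (Γ.normal τ) i * K t τ := by
  obtain ⟨ν, h1, h2⟩ := hy.exists_normal i
  exact (hK.smooth_mul (S := fun p => ν p.2) fun p hp =>
    (h1 p.2 hp.2).comp p contDiffAt_snd).congr fun t _ τ hτ _ => by rw [h2 τ hτ]

theorem isLogKernel_perpGrad (hF : LogForm F 0 a d b) (i : Fin 2) :
    IsLogKernel fun t τ => perpGrad F i (y t - y τ) := by
  fin_cases i
  · exact hy.isLogKernel_pd hF 1
  · exact ((hy.isLogKernel_pd hF 0).const_mul (-1)).congr fun t _ τ _ _ => by simp [perpGrad]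

/-- The pullback of a function of the difference of the points. -/
theorem isLogKernel_pull {F : Pt → ℂ} (hK : IsLogKernel fun t τ => F (y t - y τ)) :
    IsLogKernel fun t τ => F (Γ.x t - Γ.x τ) :=
  hK.congr fun t ht τ hτ _ => by rw [hy.eq_x ht, hy.eq_x hτ]

end SmoothArc.IsExtension

theorem ne_of_mem_cutSet {a b t τ : ℝ} (ha : a < t) (hb : t < b) (h : τ ∈ cutSet a b) : τ ≠ t := by
  rcases h with h | h
  · exact ne_of_lt (h.2.trans ha)
  · exact ne_of_gt (hb.trans h.1)

/-! ### Integrals, boundary terms and weak singularity of logarithmic kernels. -/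

namespace IsLogKernel

variable {K : ℝ → ℝ → ℂ} (hK : IsLogKernel K)
include hK

theorem integrableOn_mul {f : ℝ → ℂ} (hf : IntegrableOn f (Ioo (-1) 1)) {t : ℝ}
    (ht : t ∈ Ioo (-1 : ℝ) 1) (hft : ContinuousAt f t) :
    IntegrableOn (fun τ => K t τ * f τ) (Ioo (-1) 1) := by
  obtain ⟨A, B, hA, hB, e⟩ := hK
  refine (integrableOn_logKer_mul (hA.of_le (by norm_num)) hB hf ht hft).congr_fun_ae ?_
  refine (ae_restrict_iff' measurableSet_Ioo).2 ?_
  filter_upwards [compl_mem_ae_iff.2 (measure_singleton (μ := volume) t)] with τ hne hτ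
  rw [e t ht τ hτ (Ne.symm hne)]

omit hK in
theorem deriv_eq_of_eq {A B : ℝ × ℝ → ℂ} (hA : SmoothSq 1 A) (hB : SmoothSq 1 B)
    (e : ∀ t ∈ Ioo (-1 : ℝ) 1, ∀ τ ∈ Ioo (-1 : ℝ) 1, t ≠ τ → K t τ = logKer A B t τ) {t τ : ℝ}
    (ht : t ∈ Ioo (-1 : ℝ) 1) (hτ : τ ∈ Ioo (-1 : ℝ) 1) (hne : t ≠ τ) :
    deriv (fun s => K s τ) t = logKerDeriv A B t τ := by
  have ht' := Ioo_subset_Icc_self ht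
  have hτ' := Ioo_subset_Icc_self hτ
  refine ((hasDerivAt_logKer (hA.differentiableAt ht' hτ') (hB.differentiableAt ht' hτ')
    hne).congr_of_eventuallyEq ?_).deriv
  filter_upwards [isOpen_Ioo.mem_nhds ht, isOpen_ne.mem_nhds hne] with s hs hs'
  exact e s hs τ hτ hs'

/-- The derivative of the integral of a logarithmic kernel is a principal value. -/
theorem exists_hasDerivAt_integral {f : ℝ → ℂ} (hf : IntegrableOn f (Ioo (-1) 1))
    (hf1 : ContDiffOn ℝ 1 f (Ioo (-1) 1)) {t : ℝ} (ht : t ∈ Ioo (-1 : ℝ) 1) :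
    ∃ D, HasDerivAt (fun s => ∫ τ in Ioo (-1 : ℝ) 1, K s τ * f τ) D t ∧
      ∀ {l : Filter ℝ} {n p : ℝ → ℝ}, IsCut l n p t →
        Tendsto (fun r => ∫ τ in cutSet (n r) (p r), deriv (fun s => K s τ) t * f τ) l (𝓝 D) := by
  obtain ⟨A, B, hA, hB, e⟩ := hK
  have hA1 : SmoothSq 1 A := hA.of_le (by norm_num)
  obtain ⟨D, h1, h2⟩ := exists_hasDerivAt_integral_logKer hA1 hB hf hf1 ht
  refine ⟨D, h1.congr_of_eventuallyEq ?_, fun {l n p} hc => (h2 hc).congr' ?_⟩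
  · filter_upwards [isOpen_Ioo.mem_nhds ht] with s hs
    refine setIntegral_congr_ae measurableSet_Ioo ?_
    filter_upwards [compl_mem_ae_iff.2 (measure_singleton (μ := volume) s)] with τ hne hτ
    rw [e s hs τ hτ (Ne.symm hne)]
  · filter_upwards [hc.eventually ht] with r hr
    refine setIntegral_congr_fun (measurableSet_cutSet _ _) fun τ hτ => ?_
    have hsub := cutSet_subset (a := n r) (b := p r) (by linarith [hr.1.2, ht.2])
      (by linarith [hr.2.1, ht.1]) hτ
    rw [deriv_eq_of_eq hA1 hB e ht hsub (ne_of_mem_cutSet hr.1.2 hr.2.1 hτ).symm]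

theorem integrableOn_cutSet_deriv {f : ℝ → ℂ} (hf : IntegrableOn f (Ioo (-1) 1)) {t a b : ℝ}
    (ht : t ∈ Ioo (-1 : ℝ) 1) (ha : a ∈ Ioo (-1) t) (hb : b ∈ Ioo t 1) :
    IntegrableOn (fun τ => deriv (fun s => K s τ) t * f τ) (cutSet a b) := by
  obtain ⟨A, B, hA, hB, e⟩ := hK
  have hA1 : SmoothSq 1 A := hA.of_le (by norm_num)
  refine (integrableOn_cutSet_logKerDeriv hA1 hB hf ht ha hb).congr_fun (fun τ hτ => ?_)
    (measurableSet_cutSet _ _)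
  have hsub := cutSet_subset (a := a) (b := b) (by linarith [ha.2, ht.2]) (by linarith [hb.1, ht.1]) hτ
  simp only
  rw [deriv_eq_of_eq hA1 hB e ht hsub (ne_of_mem_cutSet ha.2 hb.1 hτ).symm]

theorem tendsto_boundary {u : ℝ → ℂ} {t : ℝ} (ht : t ∈ Ioo (-1 : ℝ) 1)
    (hu : DifferentiableAt ℝ u t) {l : Filter ℝ} {n p : ℝ → ℝ} (hc : IsCut l n p t) :
    Tendsto (fun r => K t (n r) * u (n r) - K t (p r) * u (p r)) l (𝓝 0) := by
  obtain ⟨A, B, hA, hB, e⟩ := hK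
  have ht' := Ioo_subset_Icc_self ht
  have dA := hasDerivAt_snd ((hA.of_le (by norm_num) : SmoothSq 1 A).differentiableAt ht' ht')
  have dB := hasDerivAt_snd (hB.differentiableAt ht' ht')
  refine (hc.tendsto_boundary_log (dA.differentiableAt.mul hu)
    (dB.continuousAt.mul hu.continuousAt)).congr' ?_
  filter_upwards [hc.eventually ht] with r hr
  rw [e t ht (n r) ⟨hr.1.1, hr.1.2.trans ht.2⟩ (ne_of_gt hr.1.2),
    e t ht (p r) ⟨ht.1.trans hr.2.1, hr.2.2⟩ (ne_of_lt hr.2.1), logKer, logKer]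
  simp only [Pi.mul_apply]
  ring

theorem exists_tendsto_boundary_deriv {u : ℝ → ℂ} {t : ℝ} (ht : t ∈ Ioo (-1 : ℝ) 1)
    (hu : DifferentiableAt ℝ u t) {n p N : ℝ → ℝ} (hc : IsCut (𝓝[>] 0) n p t)
    (hN : DifferentiableAt ℝ N t) (hN0 : N t ≠ 0)
    (hn : ∀ᶠ r in 𝓝[>] (0 : ℝ), (t - n r) * N (n r) = r)
    (hp : ∀ᶠ r in 𝓝[>] (0 : ℝ), (p r - t) * N (p r) = r) :
    ∃ a : ℂ, Tendsto (fun r => deriv (fun s => K s (n r)) t * u (n r)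
      - deriv (fun s => K s (p r)) t * u (p r) - (r : ℂ)⁻¹ * a) (𝓝[>] 0) (𝓝 0) := by
  obtain ⟨A, B, hA, hB, e⟩ := hK
  obtain ⟨a, ha⟩ := hc.exists_tendsto_boundary_logKerDeriv hA hB ht hu hN hN0 hn hp
  refine ⟨a, ha.congr' ?_⟩
  filter_upwards [hc.eventually ht] with r hr
  have hA1 : SmoothSq 1 A := hA.of_le (by norm_num)
  rw [deriv_eq_of_eq hA1 hB e ht ⟨hr.1.1, hr.1.2.trans ht.2⟩ (ne_of_gt hr.1.2),
    deriv_eq_of_eq hA1 hB e ht ⟨ht.1.trans hr.2.1, hr.2.2⟩ (ne_of_lt hr.2.1)]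

theorem continuousOn : ContinuousOn (fun p : ℝ × ℝ => K p.1 p.2)
    {p | p.1 ∈ Ioo (-1 : ℝ) 1 ∧ p.2 ∈ Ioo (-1 : ℝ) 1 ∧ p.1 ≠ p.2} := by
  obtain ⟨A, B, hA, hB, e⟩ := hK
  refine ContinuousOn.congr (f := fun p : ℝ × ℝ => (Real.log (p.1 - p.2) : ℂ) * A p + B p) ?_
    fun p hp => e p.1 hp.1 p.2 hp.2.1 hp.2.2
  intro p hp
  have hp' : p ∈ Icc (-1 : ℝ) 1 ×ˢ Icc (-1 : ℝ) 1 :=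
    ⟨Ioo_subset_Icc_self hp.1, Ioo_subset_Icc_self hp.2.1⟩
  have hl : ContinuousAt (fun p : ℝ × ℝ => (Real.log (p.1 - p.2) : ℂ)) p :=
    Complex.continuous_ofReal.continuousAt.comp
      ((continuousAt_fst.sub continuousAt_snd).log (sub_ne_zero.2 hp.2.2))
  exact ((hl.mul (hA p hp').continuousAt).add (hB p hp').continuousAt).continuousWithinAt

omit hK in
-- From `log u ≤ 2 u^(1/2)` for `u = s` and `u = s⁻¹`, with `s ≤ 2` converting `s^(1/2)` into `2
-- s^(-1/2)`. The exponent `1/2` is a choice; any exponent in `(0, 1)` would dominate a logarithm.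
theorem abs_log_le_rpow {s : ℝ} (h0 : 0 < s) (h2 : s ≤ 2) :
    |Real.log s| ≤ 4 * s ^ (-(1 / 2) : ℝ) ∧ 1 ≤ 2 * s ^ (-(1 / 2) : ℝ) := by
  have hs : 0 < s ^ (1 / 2 : ℝ) := Real.rpow_pos_of_pos h0 _
  have hsq : s ^ (1 / 2 : ℝ) * s ^ (1 / 2 : ℝ) = s := by
    rw [← Real.rpow_add h0]; norm_num
  have hinv : s ^ (-(1 / 2) : ℝ) * s ^ (1 / 2 : ℝ) = 1 := by
    rw [← Real.rpow_add h0]; norm_num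
  have hpos : 0 < s ^ (-(1 / 2) : ℝ) := Real.rpow_pos_of_pos h0 _
  have hle : s ^ (1 / 2 : ℝ) ≤ 2 * s ^ (-(1 / 2) : ℝ) := by
    have := mul_le_mul_of_nonneg_right h2 hpos.le
    nlinarith
  have hle2 : s ^ (1 / 2 : ℝ) ≤ 2 := by nlinarith
  have h3 := Real.log_le_rpow_div h0.le (ε := 1 / 2) (by norm_num)
  have h4 := Real.log_le_rpow_div (inv_pos.2 h0).le (ε := 1 / 2) (by norm_num)
  rw [Real.log_inv, Real.inv_rpow h0.le, ← Real.rpow_neg h0.le] at h4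
  refine ⟨abs_le.2 ⟨by linarith, by linarith⟩, ?_⟩
  nlinarith

/-- The exponent is negative, so passing from `|t - τ|` to the chord uses the upper bound of the
chord by the parameter distance. -/
theorem exists_bound {Γ : SmoothArc} {y : ℝ → Pt} (hy : Γ.IsExtension y) :
    ∃ C, 0 ≤ C ∧ ∀ t ∈ Ioo (-1 : ℝ) 1, ∀ τ ∈ Ioo (-1 : ℝ) 1, t ≠ τ →
      ‖K t τ‖ ≤ C * ‖Γ.x t - Γ.x τ‖ ^ (-(1 / 2) : ℝ) := by
  obtain ⟨A, B, hA, hB, e⟩ := hK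
  obtain ⟨a, ha, hab⟩ := (hA.of_le (by norm_num) : SmoothSq 1 A).exists_bound
  obtain ⟨b, hb, hbb⟩ := hB.exists_bound
  obtain ⟨_, _, c, hc, hcb⟩ := hy.exists_chord_bounds
  refine ⟨(4 * a + 2 * b) * c ^ (1 / 2 : ℝ), by positivity, fun t ht τ hτ hne => ?_⟩
  have ht' := Ioo_subset_Icc_self ht
  have hτ' := Ioo_subset_Icc_self hτ
  have hs0 : 0 < |t - τ| := abs_pos.2 (sub_ne_zero.2 hne)
  have hs2 : |t - τ| ≤ 2 := by rw [abs_le]; constructor <;> linarith [ht.1, ht.2, hτ.1, hτ.2]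
  obtain ⟨l1, l2⟩ := abs_log_le_rpow hs0 hs2
  rw [Real.log_abs] at l1
  have h1 : ‖K t τ‖ ≤ (4 * a + 2 * b) * |t - τ| ^ (-(1 / 2) : ℝ) := by
    rw [e t ht τ hτ hne, logKer]
    refine (norm_add_le _ _).trans ?_
    rw [norm_mul, Complex.norm_real, Real.norm_eq_abs]
    have := mul_le_mul l1 (hab t ht' τ hτ').1 (norm_nonneg _) (by positivity)
    nlinarith [(hbb t ht' τ hτ').1]
  refine h1.trans ?_
  rw [mul_assoc]
  refine mul_le_mul_of_nonneg_left ?_ (by positivity)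
  have hx : ‖Γ.x t - Γ.x τ‖ ≤ |t - τ| * c := by
    rw [hy.eq_x ht, hy.eq_x hτ, hy.norm_sub]
    exact mul_le_mul_of_nonneg_left (hcb t ht' τ hτ').2 (abs_nonneg _)
  have hx0 : 0 < ‖Γ.x t - Γ.x τ‖ := by
    rw [hy.eq_x ht, hy.eq_x hτ]
    exact norm_pos_iff.2 (hy.sub_ne ht' hτ' hne)
  have h5 := Real.rpow_le_rpow_of_nonpos hx0 hx (by norm_num : (-(1 / 2) : ℝ) ≤ 0)
  rw [Real.mul_rpow (abs_nonneg _) hc.le] at h5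
  have hcc : c ^ (-(1 / 2) : ℝ) * c ^ (1 / 2 : ℝ) = 1 := by
    rw [← Real.rpow_add hc]; norm_num
  have := mul_le_mul_of_nonneg_left h5 (Real.rpow_nonneg hc.le (1 / 2))
  calc |t - τ| ^ (-(1 / 2) : ℝ)
      = c ^ (1 / 2 : ℝ) * (|t - τ| ^ (-(1 / 2) : ℝ) * c ^ (-(1 / 2) : ℝ)) := by
        linear_combination (-|t - τ| ^ (-(1 / 2) : ℝ)) * hcc
    _ ≤ _ := this

end IsLogKernel

/-! ### Matrix-valued integral operators on the arc. -/

namespace SmoothArc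

variable {Γ : SmoothArc} {y : ℝ → Pt} {m n : Type*} [Fintype m] [Fintype n]

/-- Matrix kernels with logarithmic entries are weakly singular. -/
theorem IsExtension.isWeaklySingular (hy : Γ.IsExtension y) {K : ℝ → ℝ → Matrix m n ℂ}
    (hK : ∀ i j, IsLogKernel fun t τ => K t τ i j) : Γ.IsWeaklySingular K := by
  refine ⟨continuousOn_pi.2 fun i => continuousOn_pi.2 fun j => (hK i j).continuousOn, ?_⟩
  choose C hC0 hC using fun i j => (hK i j).exists_bound hy
  refine ⟨∑ i, ∑ j, C i j, 1 / 2, by norm_num, by norm_num, fun t ht τ hτ hne i j => ?_⟩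
  refine (hC i j t ht τ hτ hne).trans ?_
  refine mul_le_mul_of_nonneg_right ?_ (Real.rpow_nonneg (norm_nonneg _) _)
  exact (Finset.single_le_sum (f := fun j => C i j) (fun j _ => hC0 i j) (Finset.mem_univ j)).trans
    (Finset.single_le_sum (f := fun i => ∑ j, C i j)
      (fun i _ => Finset.sum_nonneg fun j _ => hC0 i j) (Finset.mem_univ i))

omit [Fintype m] in
theorem integrand_apply (K : ℝ → ℝ → Matrix m n ℂ) (φ : ℝ → n → ℂ) (t τ : ℝ) (i : m) :
    Γ.integrand K φ t τ i = ∑ j, K t τ i j * ((Γ.speed τ : ℂ) * φ τ j) := by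
  simp only [integrand, Pi.smul_apply, mulVec, dotProduct, Complex.real_smul, Finset.mul_sum]
  exact Finset.sum_congr rfl fun j _ => by ring

theorem integrableOn_integrand {K : ℝ → ℝ → Matrix m n ℂ} {φ : ℝ → n → ℂ} {t : ℝ} {s : Set ℝ}
    (h : ∀ i j, IntegrableOn (fun τ => K t τ i j * ((Γ.speed τ : ℂ) * φ τ j)) s) :
    IntegrableOn (Γ.integrand K φ t) s := by
  refine Integrable.of_eval fun i => ?_
  simp only [integrand_apply]
  exact integrable_finsetSum _ fun j _ => h i j

theorem setIntegral_integrand {K : ℝ → ℝ → Matrix m n ℂ} {φ : ℝ → n → ℂ} {t : ℝ} {s : Set ℝ}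
    (h : ∀ i j, IntegrableOn (fun τ => K t τ i j * ((Γ.speed τ : ℂ) * φ τ j)) s) (i : m) :
    (∫ τ in s, Γ.integrand K φ t τ) i = ∑ j, ∫ τ in s, K t τ i j * ((Γ.speed τ : ℂ) * φ τ j) := by
  rw [eval_integral fun i => (integrableOn_integrand h).eval i]
  simp only [integrand_apply]
  exact integral_finsetSum _ fun j _ => h i j

/-- Densities admissible for the integral operators. -/
structure IsDensity (Γ : SmoothArc) (φ : ℝ → n → ℂ) : Prop where
  integrableOn : ∀ j, IntegrableOn (fun τ => (Γ.speed τ : ℂ) * φ τ j) (Ioo (-1) 1)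
  contDiffOn : ∀ j, ContDiffOn ℝ 1 (fun τ => (Γ.speed τ : ℂ) * φ τ j) (Ioo (-1) 1)

variable {K : ℝ → ℝ → Matrix m n ℂ} (hK : ∀ i j, IsLogKernel fun t τ => K t τ i j)
  {φ : ℝ → n → ℂ} (hφ : Γ.IsDensity φ) {t : ℝ} (ht : t ∈ Ioo (-1 : ℝ) 1)
include hK hφ ht

omit [Fintype m] [Fintype n] in
theorem integrableOn_entry (i : m) (j : n) :
    IntegrableOn (fun τ => K t τ i j * ((Γ.speed τ : ℂ) * φ τ j)) (Ioo (-1) 1) :=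
  (hK i j).integrableOn_mul (hφ.integrableOn j) ht
    ((hφ.contDiffOn j).contDiffAt (isOpen_Ioo.mem_nhds ht)).continuousAt

theorem converges : Γ.Converges K φ t := integrableOn_integrand (integrableOn_entry hK hφ ht)

theorem op_apply (i : m) :
    Γ.op K φ t i = ∑ j, ∫ τ in Ioo (-1 : ℝ) 1, K t τ i j * ((Γ.speed τ : ℂ) * φ τ j) :=
  setIntegral_integrand (integrableOn_entry hK hφ ht) i

theorem tendsto_cut_op {l : Filter ℝ} {a b : ℝ → ℝ} (hc : IsCut l a b t) (i : m) :
    Tendsto (fun r => ∑ j, ∫ τ in cutSet (a r) (b r), K t τ i j * ((Γ.speed τ : ℂ) * φ τ j)) l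
      (𝓝 (Γ.op K φ t i)) := by
  rw [op_apply hK hφ ht]
  exact tendsto_finsetSum _ fun j _ => hc.tendsto_integral ht (integrableOn_entry hK hφ ht i j)

/-- The entries are summed here. The derivative is a limit along every asymptotically symmetric cut,
so the cuts made by balls may be inserted. -/
theorem hasDerivAt_op : DifferentiableAt ℝ (Γ.op K φ) t ∧
    ∀ {l : Filter ℝ} {a b : ℝ → ℝ}, IsCut l a b t → ∀ i, Tendsto (fun r => ∑ j,
      ∫ τ in cutSet (a r) (b r), deriv (fun s => K s τ i j) t * ((Γ.speed τ : ℂ) * φ τ j)) l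
      (𝓝 (deriv (Γ.op K φ) t i)) := by
  choose D hD hl using fun i j =>
    (hK i j).exists_hasDerivAt_integral (hφ.integrableOn j) (hφ.contDiffOn j) ht
  have h : HasDerivAt (Γ.op K φ) (fun i => ∑ j, D i j) t := by
    refine hasDerivAt_pi.2 fun i => ?_
    refine (HasDerivAt.fun_sum fun j _ => hD i j).congr_of_eventuallyEq ?_
    filter_upwards [isOpen_Ioo.mem_nhds ht] with s hs
    exact op_apply hK hφ hs i
  refine ⟨h.differentiableAt, fun {l a b} hc i => ?_⟩
  rw [h.deriv]
  exact tendsto_finsetSum _ fun j _ => hl i j hc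

end SmoothArc

/-! ### The edge weight -/

theorem one_sub_sq_pos {t : ℝ} (ht : t ∈ Ioo (-1 : ℝ) 1) : 0 < 1 - t ^ 2 := by
  nlinarith [ht.1, ht.2]

/-- It is the nonnegative derivative of the continuous function `arcsin`. -/
theorem integrableOn_inv_sqrt : IntegrableOn (fun t : ℝ => (√(1 - t ^ 2))⁻¹) (Ioo (-1) 1) := by
  have h := intervalIntegral.integrableOn_deriv_of_nonneg (a := -1) (b := 1) (g := Real.arcsin)
    (g' := fun t => (√(1 - t ^ 2))⁻¹) Real.continuous_arcsin.continuousOn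
    (fun t ht => by
      have := Real.hasDerivAt_arcsin (ne_of_gt ht.1) (ne_of_lt ht.2)
      rwa [one_div] at this) (fun t _ => by positivity)
  exact h.mono_set Ioo_subset_Ioc_self

theorem integrableOn_inv_sqrt_mul {g : ℝ → ℂ} (hg : ContinuousOn g (Icc (-1) 1)) :
    IntegrableOn (fun t : ℝ => (((√(1 - t ^ 2))⁻¹ : ℝ) : ℂ) * g t) (Ioo (-1) 1) := by
  have h : IntegrableOn (fun t : ℝ => (((√(1 - t ^ 2))⁻¹ : ℝ) : ℂ)) (Ioo (-1) 1) :=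
    integrableOn_inv_sqrt.ofReal
  rw [← integrableOn_Icc_iff_integrableOn_Ioo] at h ⊢
  exact h.mul_continuousOn hg isCompact_Icc

section Weight

variable {w b : ℝ → ℝ} (hb : ContDiff ℝ 2 b) (hb0 : ∀ t ∈ Icc (-1 : ℝ) 1, 0 < b t)
  (hw : ∀ t ∈ Icc (-1 : ℝ) 1, w t = √(1 - t ^ 2) * b t)

include hw in
-- This removes the endpoint terms when the tangential derivative is integrated by parts.
theorem weight_endpoint : w (-1) = 0 ∧ w 1 = 0 := by
  rw [hw _ (by norm_num), hw _ (by norm_num)]; norm_num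

include hb0 hw in
theorem weight_pos {t : ℝ} (ht : t ∈ Ioo (-1 : ℝ) 1) : 0 < w t := by
  rw [hw t (Ioo_subset_Icc_self ht)]
  exact mul_pos (Real.sqrt_pos.2 (one_sub_sq_pos ht)) (hb0 t (Ioo_subset_Icc_self ht))

include hb hw

theorem weight_continuousOn : ContinuousOn w (Icc (-1) 1) := by
  refine ContinuousOn.congr (f := fun t => √(1 - t ^ 2) * b t) ?_ hw
  exact ((Real.continuous_sqrt.comp (by fun_prop)).mul hb.continuous).continuousOn

theorem weight_contDiffOn : ContDiffOn ℝ 2 w (Ioo (-1) 1) := by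
  refine ContDiffOn.congr (f := fun t => √(1 - t ^ 2) * b t) ?_
    fun t ht => hw t (Ioo_subset_Icc_self ht)
  have h : ContDiffOn ℝ 2 (fun t : ℝ => 1 - t ^ 2) (Ioo (-1) 1) := by fun_prop
  exact (h.sqrt fun t ht => (one_sub_sq_pos ht).ne').mul hb.contDiffOn

theorem weight_hasDerivAt {t : ℝ} (ht : t ∈ Ioo (-1 : ℝ) 1) :
    HasDerivAt w ((√(1 - t ^ 2))⁻¹ * (-t * b t + (1 - t ^ 2) * deriv b t)) t := by
  have h1 : HasDerivAt (fun t : ℝ => 1 - t ^ 2) (-(2 * t)) t := by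
    simpa using ((hasDerivAt_id t).pow 2).const_sub 1
  have h2 := (h1.sqrt (one_sub_sq_pos ht).ne').mul
    (hb.differentiable (by simp) t).hasDerivAt
  refine (h2.congr_of_eventuallyEq ?_).congr_deriv ?_
  · filter_upwards [isOpen_Ioo.mem_nhds ht] with s hs using hw s (Ioo_subset_Icc_self hs)
  · have h3 := Real.sqrt_pos.2 (one_sub_sq_pos ht)
    have h4 := Real.sq_sqrt (one_sub_sq_pos ht).le
    field_simp
    rw [h4]

variable {v : ℝ → ℂ} (hv : ContDiffOn ℝ 2 v (Icc (-1) 1))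
include hv

theorem weight_mul_contDiffOn : ContDiffOn ℝ 2 (fun t => (w t : ℂ) * v t) (Ioo (-1) 1) :=
  (Complex.ofRealCLM.contDiff.comp_contDiffOn (weight_contDiffOn hb hw)).mul
    (hv.mono Ioo_subset_Icc_self)

theorem weight_mul_continuousOn : ContinuousOn (fun t => (w t : ℂ) * v t) (Icc (-1) 1) :=
  (Complex.continuous_ofReal.comp_continuousOn (weight_continuousOn hb hw)).mul hv.continuousOn

theorem weight_mul_contDiffOn_deriv :
    ContDiffOn ℝ 1 (deriv fun t => (w t : ℂ) * v t) (Ioo (-1) 1) :=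
  (weight_mul_contDiffOn hb hw hv).deriv_of_isOpen isOpen_Ioo (by norm_num)

/-- The derivative of `w v` is `(1 - t²)^(-1/2)` times a function continuous on `[-1, 1]`. The
extension `v₀` supplies a derivative that is continuous up to the endpoints. -/
theorem weight_mul_integrableOn_deriv :
    IntegrableOn (deriv fun t => (w t : ℂ) * v t) (Ioo (-1) 1) := by
  obtain ⟨v₀, h0, h1⟩ := exists_contDiff_extension 2 v (by exact_mod_cast hv)
  have h0' : ContDiff ℝ 2 v₀ := by exact_mod_cast h0
  have hd : Continuous (deriv v₀) := h0'.continuous_deriv (by simp)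
  have hbd : Continuous (deriv b) := hb.continuous_deriv (by simp)
  have hv0 : Continuous v₀ := h0'.continuous
  have hbc := hb.continuous
  refine (integrableOn_inv_sqrt_mul (g := fun t => ((-t * b t + (1 - t ^ 2) * deriv b t : ℝ) : ℂ)
    * v₀ t + ((1 - t ^ 2 : ℝ) : ℂ) * b t * deriv v₀ t) (by fun_prop)).congr_fun (fun t ht => ?_)
    measurableSet_Ioo
  have hve : v =ᶠ[𝓝 t] v₀ := Filter.eventually_of_mem (isOpen_Ioo.mem_nhds ht) fun s hs =>
    (h1 (Ioo_subset_Icc_self hs)).symm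
  have h2 := ((weight_hasDerivAt hb hw ht).ofReal_comp.mul
    ((h0'.differentiable (by simp) t).hasDerivAt.congr_of_eventuallyEq hve)).deriv
  have e : deriv (fun t => (w t : ℂ) * v t) t = deriv ((fun t => (w t : ℂ)) * v) t := rfl
  rw [e, h2, hw t (Ioo_subset_Icc_self ht), hve.self_of_nhds]
  have h3 : ((√(1 - t ^ 2) : ℝ) : ℂ) ≠ 0 := by
    exact_mod_cast (Real.sqrt_pos.2 (one_sub_sq_pos ht)).ne'
  have h4 : ((√(1 - t ^ 2) : ℝ) : ℂ) ^ 2 = ((1 - t ^ 2 : ℝ) : ℂ) := by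
    exact_mod_cast Real.sq_sqrt (one_sub_sq_pos ht).le
  beta_reduce
  rw [← h4]
  push_cast at *
  field_simp

include hb0

theorem weight_inv_mul_contDiffOn : ContDiffOn ℝ 1 (fun t => (w t : ℂ)⁻¹ * v t) (Ioo (-1) 1) := by
  refine ContDiffOn.of_le (n := 2) ?_ (by norm_num)
  exact ((Complex.ofRealCLM.contDiff.comp_contDiffOn (weight_contDiffOn hb hw)).inv fun t ht => by
    simpa using (weight_pos hb0 hw ht).ne').mul (hv.mono Ioo_subset_Icc_self)

theorem weight_inv_mul_integrableOn : IntegrableOn (fun t => (w t : ℂ)⁻¹ * v t) (Ioo (-1) 1) := by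
  refine (integrableOn_inv_sqrt_mul (g := fun t => (((b t)⁻¹ : ℝ) : ℂ) * v t)
    ((Complex.continuous_ofReal.comp_continuousOn (hb.continuous.continuousOn.inv₀ fun t ht =>
      (hb0 t ht).ne')).mul hv.continuousOn)).congr_fun (fun t ht => ?_) measurableSet_Ioo
  simp only [hw t (Ioo_subset_Icc_self ht)]
  push_cast
  rw [mul_inv]
  ring

end Weight

/-! ### Admissibility of the three weighted densities. -/

namespace SmoothArc.IsExtension

variable {Γ : SmoothArc} {y : ℝ → Pt} (hy : Γ.IsExtension y) {n : Type*} [Fintype n]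
include hy

theorem speed_contDiffOn : ContDiffOn ℝ 1 (fun t => (Γ.speed t : ℂ)) (Ioo (-1) 1) := by
  refine ContDiffOn.congr (f := fun t => ((‖deriv y t‖ : ℝ) : ℂ)) (fun t ht => ?_)
    fun t ht => by rw [hy.speed_eq ht]
  exact (Complex.ofRealCLM.contDiff.contDiffAt.comp t
    ((hy.contDiff_deriv.of_le (by norm_num)).contDiffAt.norm ℝ
      (hy.deriv_ne (Ioo_subset_Icc_self ht)))).contDiffWithinAt

theorem speed_mul_integrableOn {f : ℝ → ℂ} (hf : IntegrableOn f (Ioo (-1) 1)) :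
    IntegrableOn (fun t => (Γ.speed t : ℂ) * f t) (Ioo (-1) 1) := by
  have hc : Continuous fun t => ((‖deriv y t‖ : ℝ) : ℂ) :=
    Complex.continuous_ofReal.comp hy.contDiff_deriv.continuous.norm
  refine IntegrableOn.congr_fun (f := fun t => ((‖deriv y t‖ : ℝ) : ℂ) * f t) ?_
    (fun t ht => by simp only; rw [hy.speed_eq ht]) measurableSet_Ioo
  rw [← integrableOn_Icc_iff_integrableOn_Ioo] at hf ⊢
  exact hf.continuousOn_mul hc.continuousOn isCompact_Icc

omit [Fintype n] in
theorem isDensity {φ : ℝ → n → ℂ} (h1 : ∀ j, IntegrableOn (fun τ => φ τ j) (Ioo (-1) 1))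
    (h2 : ∀ j, ContDiffOn ℝ 1 (fun τ => φ τ j) (Ioo (-1) 1)) : Γ.IsDensity φ :=
  ⟨fun j => hy.speed_mul_integrableOn (h1 j), fun j => hy.speed_contDiffOn.mul (h2 j)⟩

section Weight

variable {w b : ℝ → ℝ} (hb : ContDiff ℝ 2 b) (hb0 : ∀ t ∈ Icc (-1 : ℝ) 1, 0 < b t)
  (hw : ∀ t ∈ Icc (-1 : ℝ) 1, w t = √(1 - t ^ 2) * b t) {φ : ℝ → n → ℂ}
  (hφ : ContDiffOn ℝ 2 φ (Icc (-1) 1))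
include hb hw hφ

theorem isDensity_weight : Γ.IsDensity fun τ => w τ • φ τ := by
  have hj := contDiffOn_pi.1 hφ
  refine hy.isDensity (fun j => ?_) fun j => ?_ <;> simp only [Pi.smul_apply, Complex.real_smul]
  · exact ((weight_mul_continuousOn hb hw (hj j)).integrableOn_Icc).mono_set Ioo_subset_Icc_self
  · exact (weight_mul_contDiffOn hb hw (hj j)).of_le (by norm_num)

include hb0

theorem isDensity_weight_inv : Γ.IsDensity fun τ => (w τ)⁻¹ • φ τ := by
  have hj := contDiffOn_pi.1 hφ
  refine hy.isDensity (fun j => ?_) fun j => ?_ <;>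
    simp only [Pi.smul_apply, Complex.real_smul, Complex.ofReal_inv]
  · exact weight_inv_mul_integrableOn hb hb0 hw (hj j)
  · exact weight_inv_mul_contDiffOn hb hb0 hw (hj j)

/-- `w⁻¹ D_s^w φ = D_s (w φ)`. -/
theorem weight_inv_Dsw {τ : ℝ} (hτ : τ ∈ Ioo (-1 : ℝ) 1) (j : n) :
    (Γ.speed τ : ℂ) * ((w τ)⁻¹ • Γ.Dsw w φ τ) j = deriv (fun τ => (w τ : ℂ) * φ τ j) τ := by
  have hs : (Γ.speed τ : ℂ) ≠ 0 := by exact_mod_cast (hy.speed_pos hτ).ne'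
  have hw0 : (w τ : ℂ) ≠ 0 := by exact_mod_cast (weight_pos hb0 hw hτ).ne'
  have hwd := weight_hasDerivAt hb hw hτ
  have hφd : DifferentiableAt ℝ φ τ :=
    (hφ.contDiffAt (Icc_mem_nhds hτ.1 hτ.2)).differentiableAt (by simp)
  have hφj : HasDerivAt (fun τ => φ τ j) (deriv φ τ j) τ := hasDerivAt_pi.1 hφd.hasDerivAt j
  have h1 := (hwd.ofReal_comp.mul hφj).deriv
  have h2 := (hwd.pow 2).deriv
  have e1 : deriv (fun τ => (w τ : ℂ) * φ τ j) τ
    = deriv ((fun τ => (w τ : ℂ)) * fun τ => φ τ j) τ := rfl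
  have e2 : deriv (fun s => w s ^ 2) τ = deriv (w ^ 2) τ := rfl
  rw [e1, h1]
  simp only [Dsw, Ds, Pi.smul_apply, Pi.add_apply, Complex.real_smul, e2, h2, smul_eq_mul]
  push_cast
  field_simp
  ring

/-- Multiplied by the speed the density is `(w φ)'`, which is integrable up to the tips, and `C¹`
inside because `φ` is `C²`. -/
theorem isDensity_weight_inv_Dsw : Γ.IsDensity fun τ => (w τ)⁻¹ • Γ.Dsw w φ τ := by
  have hj := contDiffOn_pi.1 hφ
  refine ⟨fun j => (weight_mul_integrableOn_deriv hb hw (hj j)).congr_fun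
    (fun τ hτ => (hy.weight_inv_Dsw hb hb0 hw hφ hτ j).symm) measurableSet_Ioo, fun j => ?_⟩
  exact (weight_mul_contDiffOn_deriv hb hw (hj j)).congr
    fun τ hτ => hy.weight_inv_Dsw hb hb0 hw hφ hτ j

end Weight

end SmoothArc.IsExtension

/-! ### Integration by parts along the arc. -/

theorem integrableOn_cutSet_mul {κ f : ℝ → ℂ} {t a b : ℝ} (hκ : ContinuousOn κ (Icc (-1) 1 \ {t}))
    (hf : IntegrableOn f (Ioo (-1) 1)) (ha : a ∈ Ioo (-1) t) (hb : b ∈ Ioo t 1) :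
    IntegrableOn (fun τ => κ τ * f τ) (cutSet a b) := by
  have h1 : IntegrableOn f (Ioo (-1) a) :=
    hf.mono_set (Ioo_subset_Ioo_right (by linarith [ha.2, hb.1, hb.2]))
  have h2 : IntegrableOn f (Ioo b 1) :=
    hf.mono_set (Ioo_subset_Ioo_left (by linarith [ha.1, ha.2, hb.1]))
  rw [← integrableOn_Icc_iff_integrableOn_Ioo] at h1 h2
  refine IntegrableOn.union ?_ ?_ <;> rw [← integrableOn_Icc_iff_integrableOn_Ioo]
  · exact h1.continuousOn_mul (hκ.mono fun τ hτ => ⟨⟨hτ.1, by linarith [hτ.2, ha.2, hb.1, hb.2]⟩,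
      ne_of_lt (lt_of_le_of_lt hτ.2 ha.2)⟩) isCompact_Icc
  · exact h2.continuousOn_mul (hκ.mono fun τ hτ => ⟨⟨by linarith [hτ.1, ha.1, ha.2, hb.1], hτ.2⟩,
      ne_of_gt (lt_of_lt_of_le hb.1 hτ.1)⟩) isCompact_Icc

namespace SmoothArc.IsExtension

variable {Γ : SmoothArc} {y : ℝ → Pt} (hy : Γ.IsExtension y) {H : Pt → ℂ}
include hy

theorem x_sub_ne {t τ : ℝ} (ht : t ∈ Ioo (-1 : ℝ) 1) (hτ : τ ∈ Ioo (-1 : ℝ) 1) (hne : t ≠ τ) :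
    Γ.x t - Γ.x τ ≠ 0 := by
  rw [hy.eq_x ht, hy.eq_x hτ]
  exact hy.sub_ne (Ioo_subset_Icc_self ht) (Ioo_subset_Icc_self hτ) hne

/-- The tangential derivative in the first point of a function of the difference. -/
theorem deriv_pull_left (hH : SmoothOff H) {t τ : ℝ} (ht : t ∈ Ioo (-1 : ℝ) 1)
    (hτ : τ ∈ Ioo (-1 : ℝ) 1) (hne : t ≠ τ) :
    HasDerivAt (fun s => H (Γ.x s - Γ.x τ))
      ((Γ.speed t : ℂ) * ∑ l, tang (toC (Γ.normal t)) l * pd l H (Γ.x t - Γ.x τ)) t := by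
  have hx : HasDerivAt (fun s => Γ.x s - Γ.x τ) (deriv y t) t :=
    ((hy.hasDerivAt t).congr_of_eventuallyEq (hy.eventuallyEq ht)).sub_const _
  refine ((hH.hasFDerivAt (hy.x_sub_ne ht hτ hne)).comp_hasDerivAt t hx).congr_deriv ?_
  rw [fderiv_eq_pd, Finset.mul_sum]
  exact Finset.sum_congr rfl fun l _ => by rw [hy.deriv_eq_tang ht]; ring

/-- Integration by parts along the arc outside a cut. -/
theorem integral_cut_by_parts (hH : SmoothOff H) {t a b : ℝ} (ht : t ∈ Ioo (-1 : ℝ) 1)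
    (ha : a ∈ Ioo (-1) t) (hb : b ∈ Ioo t 1) {u : ℝ → ℂ} (hu : ContinuousOn u (Icc (-1) 1))
    (hud : DifferentiableOn ℝ u (Ioo (-1) 1)) (hui : IntegrableOn (deriv u) (Ioo (-1) 1))
    (h1 : u (-1) = 0) (h2 : u 1 = 0) :
    IntegrableOn (fun τ => (Γ.speed τ : ℂ) * (∑ l, tang (toC (Γ.normal τ)) l
      * pd l H (Γ.x t - Γ.x τ)) * u τ) (cutSet a b) ∧
    IntegrableOn (fun τ => H (Γ.x t - Γ.x τ) * deriv u τ) (cutSet a b) ∧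
    ∫ τ in cutSet a b, (Γ.speed τ : ℂ) * (∑ l, tang (toC (Γ.normal τ)) l
      * pd l H (Γ.x t - Γ.x τ)) * u τ
      = (∫ τ in cutSet a b, H (Γ.x t - Γ.x τ) * deriv u τ)
        - (H (Γ.x t - Γ.x a) * u a - H (Γ.x t - Γ.x b) * u b) := by
  have hsub : cutSet a b ⊆ Ioo (-1) 1 :=
    cutSet_subset (by linarith [ha.2, ht.2]) (by linarith [hb.1, ht.1])
  have htI := Ioo_subset_Icc_self ht
  have hz : ∀ τ ∈ Icc (-1 : ℝ) 1 \ {t}, y t - y τ ≠ 0 := fun τ hτ =>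
    hy.sub_ne htI hτ.1 (Ne.symm hτ.2)
  -- Written with the extension, the factors are continuous up to the endpoints, where `deriv Γ.x`
  -- and the normal need not be meaningful.
  set κ : ℝ → ℂ := fun τ => H (y t - y τ) with hκ
  set κ' : ℝ → ℂ := fun τ => ∑ l, (deriv y τ l : ℂ) * pd l H (y t - y τ) with hκ'
  have hd : ∀ τ ∈ Icc (-1 : ℝ) 1 \ {t}, HasDerivAt κ (-κ' τ) τ := fun τ hτ => by
    refine ((hH.hasFDerivAt (hz τ hτ)).comp_hasDerivAt τ
      ((hy.hasDerivAt τ).const_sub (y t))).congr_deriv ?_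
    rw [map_neg, fderiv_eq_pd]
  have c1 : ContinuousOn κ (Icc (-1) 1 \ {t}) := fun τ hτ =>
    (hd τ hτ).continuousAt.continuousWithinAt
  have c2 : ContinuousOn κ' (Icc (-1) 1 \ {t}) := by
    refine continuousOn_finsetSum _ fun l _ => ContinuousOn.mul ?_ fun τ hτ => ?_
    · exact ((contDiff_coord (n := 0) l).continuous.comp hy.contDiff_deriv.continuous).continuousOn
    · exact (ContinuousAt.comp (f := fun τ => y t - y τ) (g := pd l H)
        ((hH.pd l) _ (hz τ hτ)).continuousAt
        (continuous_const.sub hy.contDiff.continuous).continuousAt).continuousWithinAt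
  have e1 : ∀ τ ∈ cutSet a b, (Γ.speed τ : ℂ) * (∑ l, tang (toC (Γ.normal τ)) l
      * pd l H (Γ.x t - Γ.x τ)) * u τ = κ' τ * u τ := fun τ hτ => by
    simp only [hκ', hy.eq_x ht, hy.eq_x (hsub hτ), hy.deriv_eq_tang (hsub hτ), Finset.mul_sum,
      mul_assoc]
  have e2 : ∀ τ ∈ cutSet a b, H (Γ.x t - Γ.x τ) * deriv u τ = κ τ * deriv u τ := fun τ hτ => by
    simp only [hκ, hy.eq_x ht, hy.eq_x (hsub hτ)]
  have i1 : IntegrableOn (fun τ => κ' τ * u τ) (cutSet a b) :=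
    integrableOn_cutSet_mul c2 (hu.integrableOn_Icc.mono_set Ioo_subset_Icc_self) ha hb
  have i2 : IntegrableOn (fun τ => κ τ * deriv u τ) (cutSet a b) :=
    integrableOn_cutSet_mul c1 hui ha hb
  have ftc := integral_cutSet_deriv (F := fun τ => κ τ * u τ)
    (F' := fun τ => κ τ * deriv u τ - κ' τ * u τ) ha hb (c1.mul (hu.mono sdiff_subset))
    (fun τ hτ hne => by
      refine ((hd τ ⟨Ioo_subset_Icc_self hτ, hne⟩).mul
        (hud.differentiableAt (isOpen_Ioo.mem_nhds hτ)).hasDerivAt).congr_deriv ?_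
      ring) (i2.sub i1) (by simp [h1]) (by simp [h2])
  refine ⟨i1.congr_fun (fun τ hτ => (e1 τ hτ).symm) (measurableSet_cutSet _ _),
    i2.congr_fun (fun τ hτ => (e2 τ hτ).symm) (measurableSet_cutSet _ _), ?_⟩
  rw [setIntegral_congr_fun (measurableSet_cutSet _ _) e1,
    setIntegral_congr_fun (measurableSet_cutSet _ _) e2, hy.eq_x ht,
    hy.eq_x ⟨ha.1, ha.2.trans ht.2⟩, hy.eq_x ⟨ht.1.trans hb.1, hb.2⟩]
  rw [integral_sub i2 i1] at ftc
  simp only [hκ] at ftc ⊢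
  linear_combination -ftc

/-- Integrability is required for every `r > 0`, whereas the exact description as two intervals is
known only for small `r`. The upper chord bound suffices to keep a neighbourhood of `t` out. -/
theorem outside_subset {t r : ℝ} (ht : t ∈ Ioo (-1 : ℝ) 1) (hr : 0 < r) :
    ∃ a ∈ Ioo (-1) t, ∃ b ∈ Ioo t 1, Γ.outside t r ⊆ cutSet a b := by
  obtain ⟨_, _, C, hC, hb⟩ := hy.exists_chord_bounds
  set δ := min (r / C) (min ((t + 1) / 2) ((1 - t) / 2))
  have h1 : δ ≤ r / C := min_le_left _ _
  have h2 : δ ≤ (t + 1) / 2 := (min_le_right _ _).trans (min_le_left _ _)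
  have h3 : δ ≤ (1 - t) / 2 := (min_le_right _ _).trans (min_le_right _ _)
  have hδ0 : 0 < δ :=
    lt_min (by positivity) (lt_min (by linarith [ht.1]) (by linarith [ht.2]))
  refine ⟨t - δ, ⟨by linarith [ht.1], by linarith⟩, t + δ, ⟨by linarith, by linarith [ht.2]⟩,
    fun τ hτ => ?_⟩
  have h4 : r < ‖Γ.x t - Γ.x τ‖ := hτ.2
  rw [hy.eq_x ht, hy.eq_x hτ.1, hy.norm_sub] at h4
  have h5 := mul_le_mul_of_nonneg_left (hb t (Ioo_subset_Icc_self ht) τ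
    (Ioo_subset_Icc_self hτ.1)).2 (abs_nonneg (t - τ))
  have h6 : δ < |t - τ| := h1.trans_lt ((div_lt_iff₀ hC).2 (h4.trans_le h5))
  rcases lt_abs.1 h6 with h | h
  · exact Or.inl ⟨hτ.1.1, by linarith⟩
  · exact Or.inr ⟨by linarith, hτ.1.2⟩

end SmoothArc.IsExtension

/-! ### The kernels of the regularized operators are logarithmic -/

theorem LogForm.of_eq_zero {F : Pt → ℂ} {c : ℂ} {a d b : ℝ → ℂ} (hF : LogForm F c a d b)
    (hc : c = 0) : LogForm F 0 a d b :=
  hc ▸ hF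

namespace Medium

variable {M : Medium} {k₁ k₂ : ℂ} (hk : M.IsWavenumberPair k₁ k₂)
include hk

/-- The coefficients sum to `1 + (k₂² - k₁²) / (k₁² - k₂²) = 0`. -/
theorem IsWavenumberPair.exists_logForm_hess : ∃ a d b, LogForm (M.hessFun k₁ k₂) 0 a d b := by
  have h := ((logForm_fund M.ks_ne).add ((logForm_fund hk.ne₁).const_mul
    (-(((M.kp : ℂ) ^ 2 - k₂ ^ 2) / (k₁ ^ 2 - k₂ ^ 2))))).add ((logForm_fund hk.ne₂).const_mul
    (((M.kp : ℂ) ^ 2 - k₁ ^ 2) / (k₁ ^ 2 - k₂ ^ 2)))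
  have hD := hk.sub_ne
  exact ⟨_, _, _, h.of_eq_zero (by field_simp; ring)⟩

theorem IsWavenumberPair.exists_logForm_diff : ∃ a d b, LogForm (diffFun k₁ k₂) 0 a d b := by
  have h := (logForm_fund hk.ne₁).add ((logForm_fund hk.ne₂).const_mul (-1))
  exact ⟨_, _, _, h.of_eq_zero (by ring)⟩

theorem IsWavenumberPair.exists_logForm_mix : ∃ a d b, LogForm (M.mixFun k₁ k₂) 0 a d b := by
  have h := (((logForm_fund M.ks_ne).const_mul (-2 * M.mu)).add ((logForm_fund hk.ne₁).const_mul
    (2 * M.mu - M.C3 k₁ k₂))).add ((logForm_fund hk.ne₂).const_mul (M.C3 k₁ k₂))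
  exact ⟨_, _, _, h.of_eq_zero (by ring)⟩

variable {Γ : SmoothArc} {y : ℝ → Pt} (hy : Γ.IsExtension y)
include hy

omit hk in
theorem isLogKernel_fund {k : ℂ} (hk : k ≠ 0) : IsLogKernel fun t τ => fund k (Γ.x t - Γ.x τ) :=
  hy.isLogKernel_pull (hy.isLogKernel (logForm_fund hk))

theorem IsWavenumberPair.isLogKernel_diff :
    IsLogKernel fun t τ => diffFun k₁ k₂ (Γ.x t - Γ.x τ) := by
  obtain ⟨a, d, b, h⟩ := hk.exists_logForm_diff
  exact hy.isLogKernel_pull (hy.isLogKernel h)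

theorem IsWavenumberPair.isLogKernel_perpGrad_diff (j : Fin 2) :
    IsLogKernel fun t τ => perpGrad (diffFun k₁ k₂) j (Γ.x t - Γ.x τ) := by
  obtain ⟨a, d, b, h⟩ := hk.exists_logForm_diff
  exact hy.isLogKernel_pull (hy.isLogKernel_perpGrad h j)

theorem IsWavenumberPair.isLogKernel_perpGrad_mix (j : Fin 2) :
    IsLogKernel fun t τ => perpGrad (M.mixFun k₁ k₂) j (Γ.x t - Γ.x τ) := by
  obtain ⟨a, d, b, h⟩ := hk.exists_logForm_mix
  exact hy.isLogKernel_pull (hy.isLogKernel_perpGrad h j)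

theorem IsWavenumberPair.isLogKernel_K11_1 (i j : Fin 2) :
    IsLogKernel fun t τ => Γ.pull (M.K11_1 k₁ k₂) t τ i j := by
  have nn : ∀ {K : ℝ → ℝ → ℂ}, IsLogKernel K → ∀ a b : Fin 2,
      IsLogKernel fun t τ => toC (Γ.normal t) a * (toC (Γ.normal τ) b * K t τ) := fun h a b =>
    hy.isLogKernel_normal_left (hy.isLogKernel_normal_right h b) a
  have hs := isLogKernel_fund hy M.ks_ne
  have h12 := ((isLogKernel_fund hy hk.ne₁).const_mul (M.C1 k₁ k₂)).add
    ((isLogKernel_fund hy hk.ne₂).const_mul (-M.C2 k₁ k₂))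
  -- `ν_x ν_yᵀ` occurs twice, once by itself and once inside `-𝕁`.
  refine (((((nn hs i j).const_mul (-2 * (M.rho * M.omega ^ 2))).add
    (((nn hs 0 0).add (nn hs 1 1)).const_mul (M.rho * M.omega ^ 2 * (if i = j then 1 else 0)))).add
    ((nn hs j i).const_mul (M.rho * M.omega ^ 2))).add ((nn h12 i j).const_mul (-1))).congr
    fun t _ τ _ _ => ?_
  rw [SmoothArc.pull, K11_1_apply]
  ring

theorem IsWavenumberPair.isLogKernel_K11_2 (i j : Fin 2) :
    IsLogKernel fun t τ => Γ.pull (M.K11_2 k₁ k₂) t τ i j := by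
  obtain ⟨a, d, b, h⟩ := hk.exists_logForm_hess
  have hs := isLogKernel_fund hy M.ks_ne
  have hp := hy.isLogKernel_pull (hy.isLogKernel_pd_pd h (1 - j) (1 - i))
  refine ((hs.const_mul (4 * M.mu * (if i = j then 1 else 0))).add
    (((hs.const_mul (1 / (M.mu : ℂ) * (if 1 - i = 1 - j then 1 else 0))).add
      (hp.const_mul (1 / ((M.rho : ℂ) * (M.omega : ℂ) ^ 2)))).const_mul
        (4 * (M.mu : ℂ) ^ 2 * (if i = j then -1 else 1)))).congr fun t _ τ _ _ => ?_
  rw [SmoothArc.pull, K11_2_apply, shearFun, e11]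

theorem IsWavenumberPair.isLogKernel_K11_3 (i j : Fin 2) :
    IsLogKernel fun t τ => Γ.pull (M.K11_3 k₁ k₂) t τ i j :=
  (hy.isLogKernel_normal_left (hk.isLogKernel_perpGrad_mix hy j) i).congr fun t _ τ _ _ => by
    rw [SmoothArc.pull, K11_3_apply]

theorem IsWavenumberPair.isLogKernel_K11_4 (i j : Fin 2) :
    IsLogKernel fun t τ => Γ.pull (M.K11_4 k₁ k₂) t τ i j :=
  (hy.isLogKernel_normal_right (hk.isLogKernel_perpGrad_mix hy i) j).congr fun t ht τ hτ hne => by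
    rw [SmoothArc.pull, K11_4_apply hk (sub_ne_zero.1 (hy.x_sub_ne ht hτ hne)), mul_comm]

theorem IsWavenumberPair.isLogKernel_K12_1 (i : Fin 2) (j : Unit) :
    IsLogKernel fun t τ => Γ.pull (M.K12_1 k₁ k₂) t τ i j :=
  ((hy.isLogKernel_normal_left (hk.isLogKernel_diff hy) i).const_mul _).congr fun t _ τ _ _ => by
    rw [SmoothArc.pull, K12_1_apply, mul_assoc]

theorem IsWavenumberPair.isLogKernel_K12_2 (i : Fin 2) (j : Unit) :
    IsLogKernel fun t τ => Γ.pull (M.K12_2 k₁ k₂) t τ i j :=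
  ((hk.isLogKernel_perpGrad_diff hy i).const_mul _).congr fun t _ τ _ _ => by
    rw [SmoothArc.pull, K12_2_apply]

theorem IsWavenumberPair.isLogKernel_K21_1 (i : Unit) (j : Fin 2) :
    IsLogKernel fun t τ => Γ.pull (M.K21_1 k₁ k₂) t τ i j :=
  ((hy.isLogKernel_normal_right (hk.isLogKernel_diff hy) j).const_mul
    (-(M.iwe * (M.kp : ℂ) ^ 2 / (k₁ ^ 2 - k₂ ^ 2)))).congr fun t _ τ _ _ => by
      rw [SmoothArc.pull, K21_1_apply]
      ring

theorem IsWavenumberPair.isLogKernel_K21_2 (i : Unit) (j : Fin 2) :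
    IsLogKernel fun t τ => Γ.pull (M.K21_2 k₁ k₂) t τ i j :=
  ((hk.isLogKernel_perpGrad_diff hy j).const_mul _).congr fun t _ τ _ _ => by
    rw [SmoothArc.pull, K21_2_apply]

end Medium

/-! ### The three blocks outside a cut. -/

namespace SmoothArc

variable {M : Medium} {k₁ k₂ : ℂ} {Γ : SmoothArc} {y : ℝ → Pt} {w b : ℝ → ℝ}

theorem weightedKernel_inl (t τ : ℝ) (i : Medium.Idx) (j : Fin 2) :
    Γ.weightedKernel M k₁ k₂ w t τ i (Sum.inl j)
      = M.V4kernel k₁ k₂ (Γ.x t) (Γ.x τ) (Γ.normal t) (Γ.normal τ) i (Sum.inl j) * w τ := by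
  simp only [weightedKernel, pull, mul_diagonal, Sum.elim_inl]

theorem weightedKernel_inr (t τ : ℝ) (i : Medium.Idx) (j : Unit) :
    Γ.weightedKernel M k₁ k₂ w t τ i (Sum.inr j)
      = M.V4kernel k₁ k₂ (Γ.x t) (Γ.x τ) (Γ.normal t) (Γ.normal τ) i (Sum.inr j)
        * ((w τ)⁻¹ : ℝ) := by
  simp only [weightedKernel, pull, mul_diagonal, Sum.elim_inr, Complex.ofReal_inv]

namespace IsExtension

variable (hk : M.IsWavenumberPair k₁ k₂) (hy : Γ.IsExtension y)
include hk hy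

theorem deriv_K11_2 {t τ : ℝ} (ht : t ∈ Ioo (-1 : ℝ) 1) (hτ : τ ∈ Ioo (-1 : ℝ) 1) (hne : t ≠ τ)
    (i j : Fin 2) : deriv (fun s => Γ.pull (M.K11_2 k₁ k₂) s τ i j) t
      = Γ.speed t * ∑ l, tang (toC (Γ.normal t)) l
        * pd l (M.shearFun k₁ k₂ i j) (Γ.x t - Γ.x τ) := by
  simp only [pull, Medium.K11_2_apply]
  exact (hy.deriv_pull_left (hk.smoothOff_shear i j) ht hτ hne).deriv

theorem deriv_K11_4 {t τ : ℝ} (ht : t ∈ Ioo (-1 : ℝ) 1) (hτ : τ ∈ Ioo (-1 : ℝ) 1) (hne : t ≠ τ)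
    (i j : Fin 2) : deriv (fun s => Γ.pull (M.K11_4 k₁ k₂) s τ i j) t
      = Γ.speed t * (∑ l, tang (toC (Γ.normal t)) l
        * pd l (perpGrad (M.mixFun k₁ k₂) i) (Γ.x t - Γ.x τ)) * toC (Γ.normal τ) j := by
  refine (((hy.deriv_pull_left (hk.smoothOff_mix.perpGrad i) ht hτ hne).mul_const
    (toC (Γ.normal τ) j)).congr_of_eventuallyEq ?_).deriv
  filter_upwards [isOpen_Ioo.mem_nhds ht, isOpen_ne.mem_nhds hne] with s hs hs'
  rw [pull, Medium.K11_4_apply hk (sub_ne_zero.1 (hy.x_sub_ne hs hτ hs'))]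

theorem deriv_K12_2 {t τ : ℝ} (ht : t ∈ Ioo (-1 : ℝ) 1) (hτ : τ ∈ Ioo (-1 : ℝ) 1) (hne : t ≠ τ)
    (i : Fin 2) : deriv (fun s => Γ.pull (M.K12_2 k₁ k₂) s τ i ()) t
      = -(2 * M.mu * M.gam / ((M.lam + 2 * M.mu) * (k₁ ^ 2 - k₂ ^ 2))) *
        (Γ.speed t * ∑ l, tang (toC (Γ.normal t)) l
          * pd l (perpGrad (Medium.diffFun k₁ k₂) i) (Γ.x t - Γ.x τ)) := by
  simp only [pull, Medium.K12_2_apply]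
  exact ((hy.deriv_pull_left (hk.smoothOff_diff.perpGrad i) ht hτ hne).const_mul _).deriv

section Cut

variable (hb : ContDiff ℝ 2 b) (hb0 : ∀ t ∈ Icc (-1 : ℝ) 1, 0 < b t)
  (hw : ∀ t ∈ Icc (-1 : ℝ) 1, w t = √(1 - t ^ 2) * b t)
include hb hb0 hw

/-- The regularized form of the integral of the upper left block outside a cut. -/
theorem cut_block₁₁ {φ : ℝ → Fin 2 → ℂ} (hφ : ContDiffOn ℝ 2 φ (Icc (-1) 1)) {t a c : ℝ}
    (ht : t ∈ Ioo (-1 : ℝ) 1) (ha : a ∈ Ioo (-1) t) (hc : c ∈ Ioo t 1) (i j : Fin 2) :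
    IntegrableOn (fun τ => (Γ.weightedKernel M k₁ k₂ w t τ).toBlocks₁₁ i j
      * ((Γ.speed τ : ℂ) * φ τ j)) (cutSet a c) ∧
    ∫ τ in cutSet a c, (Γ.weightedKernel M k₁ k₂ w t τ).toBlocks₁₁ i j * ((Γ.speed τ : ℂ) * φ τ j)
      = (∫ τ in cutSet a c, Γ.pull (M.K11_1 k₁ k₂) t τ i j * ((Γ.speed τ : ℂ) * (w τ • φ τ) j))
        + (Γ.speed t : ℂ)⁻¹ * (∫ τ in cutSet a c, deriv (fun s => Γ.pull (M.K11_2 k₁ k₂) s τ i j) t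
          * ((Γ.speed τ : ℂ) * ((w τ)⁻¹ • Γ.Dsw w φ τ) j))
        + (∫ τ in cutSet a c, Γ.pull (M.K11_3 k₁ k₂) t τ i j
          * ((Γ.speed τ : ℂ) * ((w τ)⁻¹ • Γ.Dsw w φ τ) j))
        + (Γ.speed t : ℂ)⁻¹ * (∫ τ in cutSet a c, deriv (fun s => Γ.pull (M.K11_4 k₁ k₂) s τ i j) t
          * ((Γ.speed τ : ℂ) * (w τ • φ τ) j))
        - (Γ.speed t : ℂ)⁻¹ * (deriv (fun s => Γ.pull (M.K11_2 k₁ k₂) s a i j) t * (w a * φ a j)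
          - deriv (fun s => Γ.pull (M.K11_2 k₁ k₂) s c i j) t * (w c * φ c j))
        - (Γ.pull (M.K11_3 k₁ k₂) t a i j * (w a * φ a j)
          - Γ.pull (M.K11_3 k₁ k₂) t c i j * (w c * φ c j)) := by
  have hφj := contDiffOn_pi.1 hφ j
  have hsub : cutSet a c ⊆ Ioo (-1) 1 :=
    cutSet_subset (by linarith [ha.2, ht.2]) (by linarith [hc.1, ht.1])
  have hne : ∀ τ ∈ cutSet a c, t ≠ τ := fun τ hτ => (ne_of_mem_cutSet ha.2 hc.1 hτ).symm
  have hs : (Γ.speed t : ℂ) ≠ 0 := by exact_mod_cast (hy.speed_pos ht).ne'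
  -- `H` gathers everything under a tangential derivative in `y`: the mixed derivative of the
  -- `K11_2` kernel, with its `x`-part already carried out, and the `K11_3` kernel. The normal at
  -- `x(t)` is a constant here, so one integration by parts treats both.
  set H : Pt → ℂ := fun z => (∑ l, tang (toC (Γ.normal t)) l * pd l (M.shearFun k₁ k₂ i j) z)
    + toC (Γ.normal t) i * perpGrad (M.mixFun k₁ k₂) j z with hH_def
  have hH : SmoothOff H := (SmoothOff.sum fun l _ =>
    ((hk.smoothOff_shear i j).pd l).const_mul _).add ((hk.smoothOff_mix.perpGrad j).const_mul _)
  have hHK : ∀ τ ∈ Ioo (-1 : ℝ) 1, t ≠ τ → H (Γ.x t - Γ.x τ)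
      = (Γ.speed t : ℂ)⁻¹ * deriv (fun s => Γ.pull (M.K11_2 k₁ k₂) s τ i j) t
        + Γ.pull (M.K11_3 k₁ k₂) t τ i j := fun τ hτ h => by
    rw [hy.deriv_K11_2 hk ht hτ h, inv_mul_cancel_left₀ hs, pull, Medium.K11_3_apply]
  have hpd : ∀ z, z ≠ 0 → ∀ a, pd a H z
      = (∑ l, tang (toC (Γ.normal t)) l * pd l (pd a (M.shearFun k₁ k₂ i j)) z)
        + toC (Γ.normal t) i * pd a (perpGrad (M.mixFun k₁ k₂) j) z := fun z hz a => by
    have d1 : ∀ l, DifferentiableAt ℝ (pd l (M.shearFun k₁ k₂ i j)) z := fun l =>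
      ((hk.smoothOff_shear i j).pd l).differentiableAt hz
    have d2 := (hk.smoothOff_mix.perpGrad j).differentiableAt hz
    rw [hH_def, pd_add (DifferentiableAt.fun_sum fun l _ => (d1 l).const_mul _) (d2.const_mul _),
      pd_sum _ fun l _ => (d1 l).const_mul _, pd_const_mul d2]
    congr 1
    refine Finset.sum_congr rfl fun l _ => ?_
    rw [pd_const_mul (d1 l), (hk.smoothOff_shear i j).pd_comm hz]
  obtain ⟨w1, w2⟩ := weight_endpoint hw
  obtain ⟨i1, -, e⟩ := hy.integral_cut_by_parts hH ht ha hc (weight_mul_continuousOn hb hw hφj)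
    ((weight_mul_contDiffOn hb hw hφj).differentiableOn (by simp))
    (weight_mul_integrableOn_deriv hb hw hφj) (by simp [w1]) (by simp [w2])
  have D1 := hy.isDensity_weight hb hw hφ
  have D2 := hy.isDensity_weight_inv_Dsw hb hb0 hw hφ
  have j1 := (integrableOn_entry (hk.isLogKernel_K11_1 hy) D1 ht i j).mono_set hsub
  have j2 := (hk.isLogKernel_K11_2 hy i j).integrableOn_cutSet_deriv (D2.integrableOn j) ht ha hc
  have j3 := (integrableOn_entry (hk.isLogKernel_K11_3 hy) D2 ht i j).mono_set hsub
  have j4 := (hk.isLogKernel_K11_4 hy i j).integrableOn_cutSet_deriv (D1.integrableOn j) ht ha hc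
  have p1 : ∀ τ ∈ cutSet a c, (Γ.weightedKernel M k₁ k₂ w t τ).toBlocks₁₁ i j
      * ((Γ.speed τ : ℂ) * φ τ j)
      = (Γ.pull (M.K11_1 k₁ k₂) t τ i j * ((Γ.speed τ : ℂ) * (w τ • φ τ) j)
        + (Γ.speed t : ℂ)⁻¹ * (deriv (fun s => Γ.pull (M.K11_4 k₁ k₂) s τ i j) t
          * ((Γ.speed τ : ℂ) * (w τ • φ τ) j)))
        + (Γ.speed τ : ℂ) * (∑ l, tang (toC (Γ.normal τ)) l * pd l H (Γ.x t - Γ.x τ))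
          * (w τ * φ τ j) := fun τ hτ => by
    have hz := hy.x_sub_ne ht (hsub hτ) (hne τ hτ)
    rw [toBlocks₁₁, Matrix.of_apply, weightedKernel_inl,
      hk.V4kernel₁₁_eq _ _ (sub_ne_zero.1 hz), hy.deriv_K11_4 hk ht (hsub hτ) (hne τ hτ)]
    simp only [hpd _ hz, pull, Pi.smul_apply, Complex.real_smul, Fin.sum_univ_two]
    field_simp
    ring
  have p2 : ∀ τ ∈ cutSet a c, H (Γ.x t - Γ.x τ) * deriv (fun τ => (w τ : ℂ) * φ τ j) τ
      = (Γ.speed t : ℂ)⁻¹ * (deriv (fun s => Γ.pull (M.K11_2 k₁ k₂) s τ i j) t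
          * ((Γ.speed τ : ℂ) * ((w τ)⁻¹ • Γ.Dsw w φ τ) j))
        + Γ.pull (M.K11_3 k₁ k₂) t τ i j
          * ((Γ.speed τ : ℂ) * ((w τ)⁻¹ • Γ.Dsw w φ τ) j) := fun τ hτ => by
    rw [hHK τ (hsub hτ) (hne τ hτ), hy.weight_inv_Dsw hb hb0 hw hφ (hsub hτ)]
    ring
  have hm := measurableSet_cutSet a c
  have j14 : IntegrableOn (fun τ => Γ.pull (M.K11_1 k₁ k₂) t τ i j
      * ((Γ.speed τ : ℂ) * (w τ • φ τ) j)
      + (Γ.speed t : ℂ)⁻¹ * (deriv (fun s => Γ.pull (M.K11_4 k₁ k₂) s τ i j) t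
          * ((Γ.speed τ : ℂ) * (w τ • φ τ) j))) (cutSet a c) := j1.add (j4.const_mul _)
  refine ⟨(j14.add i1).congr_fun (fun τ hτ => (p1 τ hτ).symm) hm, ?_⟩
  rw [setIntegral_congr_fun hm p1, integral_add j14 i1,
    integral_add j1 (j4.const_mul _), integral_const_mul, e, setIntegral_congr_fun hm p2,
    integral_add (j2.const_mul _) j3, integral_const_mul,
    hHK a ⟨ha.1, ha.2.trans ht.2⟩ (ne_of_gt ha.2), hHK c ⟨ht.1.trans hc.1, hc.2⟩ (ne_of_lt hc.1)]
  ring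

/-- The regularized form of the integral of the upper right block outside a cut. -/
theorem cut_block₁₂ {ψ : ℝ → Unit → ℂ} (hψ : ContDiffOn ℝ 2 ψ (Icc (-1) 1)) {t a c : ℝ}
    (ht : t ∈ Ioo (-1 : ℝ) 1) (ha : a ∈ Ioo (-1) t) (hc : c ∈ Ioo t 1) (i : Fin 2) (j : Unit) :
    IntegrableOn (fun τ => (Γ.weightedKernel M k₁ k₂ w t τ).toBlocks₁₂ i j
      * ((Γ.speed τ : ℂ) * ψ τ j)) (cutSet a c) ∧
    ∫ τ in cutSet a c, (Γ.weightedKernel M k₁ k₂ w t τ).toBlocks₁₂ i j * ((Γ.speed τ : ℂ) * ψ τ j)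
      = (∫ τ in cutSet a c, Γ.pull (M.K12_1 k₁ k₂) t τ i j
          * ((Γ.speed τ : ℂ) * ((w τ)⁻¹ • ψ τ) j))
        + (Γ.speed t : ℂ)⁻¹ * (∫ τ in cutSet a c, deriv (fun s => Γ.pull (M.K12_2 k₁ k₂) s τ i j) t
          * ((Γ.speed τ : ℂ) * ((w τ)⁻¹ • ψ τ) j)) := by
  have hsub : cutSet a c ⊆ Ioo (-1) 1 :=
    cutSet_subset (by linarith [ha.2, ht.2]) (by linarith [hc.1, ht.1])
  have hs : (Γ.speed t : ℂ) ≠ 0 := by exact_mod_cast (hy.speed_pos ht).ne'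
  have D := hy.isDensity_weight_inv hb hb0 hw hψ
  have j1 := (integrableOn_entry (hk.isLogKernel_K12_1 hy) D ht i j).mono_set hsub
  have j2 := (hk.isLogKernel_K12_2 hy i j).integrableOn_cutSet_deriv (D.integrableOn j) ht ha hc
  have p1 : ∀ τ ∈ cutSet a c, (Γ.weightedKernel M k₁ k₂ w t τ).toBlocks₁₂ i j
      * ((Γ.speed τ : ℂ) * ψ τ j)
      = Γ.pull (M.K12_1 k₁ k₂) t τ i j * ((Γ.speed τ : ℂ) * ((w τ)⁻¹ • ψ τ) j)
        + (Γ.speed t : ℂ)⁻¹ * (deriv (fun s => Γ.pull (M.K12_2 k₁ k₂) s τ i j) t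
          * ((Γ.speed τ : ℂ) * ((w τ)⁻¹ • ψ τ) j)) := fun τ hτ => by
    have hne := (ne_of_mem_cutSet ha.2 hc.1 hτ).symm
    have hz := hy.x_sub_ne ht (hsub hτ) hne
    rw [toBlocks₁₂, Matrix.of_apply, weightedKernel_inr,
      hk.V4kernel₁₂_eq _ _ (sub_ne_zero.1 hz), hy.deriv_K12_2 hk ht (hsub hτ) hne]
    simp only [pull, Pi.smul_apply, Complex.real_smul, Fin.sum_univ_two, ← mul_assoc]
    field_simp
    ring
  have hm := measurableSet_cutSet a c
  refine ⟨(j1.add (j2.const_mul (Γ.speed t : ℂ)⁻¹)).congr_fun (fun τ hτ => (p1 τ hτ).symm) hm, ?_⟩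
  rw [setIntegral_congr_fun hm p1, integral_add j1 (j2.const_mul _), integral_const_mul]

/-- The regularized form of the integral of the lower left block outside a cut. -/
theorem cut_block₂₁ {φ : ℝ → Fin 2 → ℂ} (hφ : ContDiffOn ℝ 2 φ (Icc (-1) 1)) {t a c : ℝ}
    (ht : t ∈ Ioo (-1 : ℝ) 1) (ha : a ∈ Ioo (-1) t) (hc : c ∈ Ioo t 1) (i : Unit) (j : Fin 2) :
    IntegrableOn (fun τ => (Γ.weightedKernel M k₁ k₂ w t τ).toBlocks₂₁ i j
      * ((Γ.speed τ : ℂ) * φ τ j)) (cutSet a c) ∧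
    ∫ τ in cutSet a c, (Γ.weightedKernel M k₁ k₂ w t τ).toBlocks₂₁ i j * ((Γ.speed τ : ℂ) * φ τ j)
      = (∫ τ in cutSet a c, Γ.pull (M.K21_1 k₁ k₂) t τ i j * ((Γ.speed τ : ℂ) * (w τ • φ τ) j))
        + (∫ τ in cutSet a c, Γ.pull (M.K21_2 k₁ k₂) t τ i j
          * ((Γ.speed τ : ℂ) * ((w τ)⁻¹ • Γ.Dsw w φ τ) j))
        - (Γ.pull (M.K21_2 k₁ k₂) t a i j * (w a * φ a j)
          - Γ.pull (M.K21_2 k₁ k₂) t c i j * (w c * φ c j)) := by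
  have hφj := contDiffOn_pi.1 hφ j
  have hsub : cutSet a c ⊆ Ioo (-1) 1 :=
    cutSet_subset (by linarith [ha.2, ht.2]) (by linarith [hc.1, ht.1])
  -- `H` is the kernel `K21_2` as a function of the difference; apart from `K21_1`, the whole block
  -- is its tangential derivative in `y`.
  set H : Pt → ℂ := fun z => -(2 * M.iwe * M.mu / ((M.lam + 2 * M.mu) * (k₁ ^ 2 - k₂ ^ 2)))
    * perpGrad (Medium.diffFun k₁ k₂) j z with hH_def
  have hH : SmoothOff H := (hk.smoothOff_diff.perpGrad j).const_mul _
  have hHK : ∀ τ, H (Γ.x t - Γ.x τ) = Γ.pull (M.K21_2 k₁ k₂) t τ i j := fun τ => by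
    rw [pull, Medium.K21_2_apply]
  have hpd : ∀ z, z ≠ 0 → ∀ a, pd a H z
      = -(2 * M.iwe * M.mu / ((M.lam + 2 * M.mu) * (k₁ ^ 2 - k₂ ^ 2)))
        * pd a (perpGrad (Medium.diffFun k₁ k₂) j) z := fun z hz a =>
    pd_const_mul ((hk.smoothOff_diff.perpGrad j).differentiableAt hz) _ _
  obtain ⟨w1, w2⟩ := weight_endpoint hw
  obtain ⟨i1, -, e⟩ := hy.integral_cut_by_parts hH ht ha hc (weight_mul_continuousOn hb hw hφj)
    ((weight_mul_contDiffOn hb hw hφj).differentiableOn (by simp))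
    (weight_mul_integrableOn_deriv hb hw hφj) (by simp [w1]) (by simp [w2])
  have D1 := hy.isDensity_weight hb hw hφ
  have j1 := (integrableOn_entry (hk.isLogKernel_K21_1 hy) D1 ht i j).mono_set hsub
  have p1 : ∀ τ ∈ cutSet a c, (Γ.weightedKernel M k₁ k₂ w t τ).toBlocks₂₁ i j
      * ((Γ.speed τ : ℂ) * φ τ j)
      = Γ.pull (M.K21_1 k₁ k₂) t τ i j * ((Γ.speed τ : ℂ) * (w τ • φ τ) j)
        + (Γ.speed τ : ℂ) * (∑ l, tang (toC (Γ.normal τ)) l * pd l H (Γ.x t - Γ.x τ))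
          * (w τ * φ τ j) := fun τ hτ => by
    have hz := hy.x_sub_ne ht (hsub hτ) (ne_of_mem_cutSet ha.2 hc.1 hτ).symm
    rw [toBlocks₂₁, Matrix.of_apply, weightedKernel_inl, hk.V4kernel₂₁_eq _ _ (sub_ne_zero.1 hz)]
    simp only [hpd _ hz, pull, Pi.smul_apply, Complex.real_smul, Fin.sum_univ_two]
    ring
  have p2 : ∀ τ ∈ cutSet a c, H (Γ.x t - Γ.x τ) * deriv (fun τ => (w τ : ℂ) * φ τ j) τ
      = Γ.pull (M.K21_2 k₁ k₂) t τ i j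
          * ((Γ.speed τ : ℂ) * ((w τ)⁻¹ • Γ.Dsw w φ τ) j) := fun τ hτ => by
    rw [hHK τ, hy.weight_inv_Dsw hb hb0 hw hφ (hsub hτ)]
  have hm := measurableSet_cutSet a c
  refine ⟨(j1.add i1).congr_fun (fun τ hτ => (p1 τ hτ).symm) hm, ?_⟩
  rw [setIntegral_congr_fun hm p1, integral_add j1 i1, e, setIntegral_congr_fun hm p2, hHK, hHK]
  ring

end Cut

end IsExtension

end SmoothArc

/-! ### Passage to the limit: finite part and principal values. -/

namespace SmoothArc.IsExtension

variable {M : Medium} {k₁ k₂ : ℂ} {Γ : SmoothArc} {y : ℝ → Pt} {w b : ℝ → ℝ}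
  (hk : M.IsWavenumberPair k₁ k₂) (hy : Γ.IsExtension y)

include hy in
/-- Integrability outside small intervals gives integrability outside balls. -/
theorem integrableOn_outside {m n : Type*} [Fintype m] [Fintype n] {K : ℝ → ℝ → Matrix m n ℂ}
    {φ : ℝ → n → ℂ} {t : ℝ} (ht : t ∈ Ioo (-1 : ℝ) 1)
    (h : ∀ a ∈ Ioo (-1) t, ∀ c ∈ Ioo t 1, ∀ i j,
      IntegrableOn (fun τ => K t τ i j * ((Γ.speed τ : ℂ) * φ τ j)) (cutSet a c)) :
    ∀ r > 0, IntegrableOn (Γ.integrand K φ t) (Γ.outside t r) := fun r hr => by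
  obtain ⟨a, ha, c, hc, hsub⟩ := hy.outside_subset ht hr
  exact (integrableOn_integrand (h a ha c hc)).mono_set hsub

variable (hb : ContDiff ℝ 2 b) (hb0 : ∀ t ∈ Icc (-1 : ℝ) 1, 0 < b t)
  (hw : ∀ t ∈ Icc (-1 : ℝ) 1, w t = √(1 - t ^ 2) * b t)
include hk hy hb hb0 hw

/-- The upper left block: existence and value of the finite part. -/
theorem hasFP_block₁₁ {φ : ℝ → Fin 2 → ℂ} (hφ : ContDiffOn ℝ 2 φ (Icc (-1) 1)) {t : ℝ}
    (ht : t ∈ Ioo (-1 : ℝ) 1) :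
    Γ.HasFP (fun t τ => (Γ.weightedKernel M k₁ k₂ w t τ).toBlocks₁₁) φ t
      (Γ.op (Γ.pull (M.K11_1 k₁ k₂)) (fun τ => w τ • φ τ) t
        + Γ.Ds (Γ.op (Γ.pull (M.K11_2 k₁ k₂)) (fun τ => (w τ)⁻¹ • Γ.Dsw w φ τ)) t
        + Γ.op (Γ.pull (M.K11_3 k₁ k₂)) (fun τ => (w τ)⁻¹ • Γ.Dsw w φ τ) t
        + Γ.Ds (Γ.op (Γ.pull (M.K11_4 k₁ k₂)) (fun τ => w τ • φ τ)) t) := by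
  have D1 := hy.isDensity_weight hb hw hφ
  have D2 := hy.isDensity_weight_inv_Dsw hb hb0 hw hφ
  have hX := hy.deriv_ne (Ioo_subset_Icc_self ht)
  obtain ⟨n, p, hnp⟩ := hy.exists_isBallCut ht
  have hc := hy.isCut_of_isBallCut ht hnp
  have hud : ∀ j, DifferentiableAt ℝ (fun τ => (w τ : ℂ) * φ τ j) t := fun j =>
    ((weight_mul_contDiffOn hb hw (contDiffOn_pi.1 hφ j)).differentiableOn
      (by simp)).differentiableAt (isOpen_Ioo.mem_nhds ht)
  have hN : DifferentiableAt ℝ (fun τ => ‖diffQuot y (t, τ)‖) t := by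
    have h : DifferentiableAt ℝ (fun τ => diffQuot y (t, τ)) t :=
      ((contDiff_diffQuot hy.contDiff_two).differentiable (by simp)).differentiableAt.comp t
        (f := fun τ => (t, τ)) (by fun_prop)
    exact h.norm ℝ (by rwa [diffQuot_diag])
  -- The divergence comes only from the boundary terms of the `K11_2` kernel, which are still
  -- differentiated in `x`. Here `N = |X(t, ·)|` is the chord per unit of parameter.
  choose α hα using fun i j => (hk.isLogKernel_K11_2 hy i j).exists_tendsto_boundary_deriv ht
    (hud j) hc hN (by rwa [diffQuot_diag, norm_ne_zero_iff]) (hnp.mono fun r h => h.n_eq)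
    (hnp.mono fun r h => h.p_eq)
  -- The coefficient of `1 / r` is minus the sum of the `α i j` over the speed, since boundary terms
  -- enter with a minus sign and `D_s` divides by the speed.
  refine ⟨hy.integrableOn_outside ht fun a ha c hc i j =>
    (hy.cut_block₁₁ hk hb hb0 hw hφ ht ha hc i j).1,
    fun i => -((Γ.speed t : ℂ)⁻¹ * ∑ j, α i j), tendsto_pi_nhds.2 fun i => ?_⟩
  have l1 := tendsto_cut_op (hk.isLogKernel_K11_1 hy) D1 ht hc i
  have l2 := ((hasDerivAt_op (hk.isLogKernel_K11_2 hy) D2 ht).2 hc i).const_mul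
    ((Γ.speed t : ℂ)⁻¹)
  have l3 := tendsto_cut_op (hk.isLogKernel_K11_3 hy) D2 ht hc i
  have l4 := ((hasDerivAt_op (hk.isLogKernel_K11_4 hy) D1 ht).2 hc i).const_mul
    ((Γ.speed t : ℂ)⁻¹)
  have b2 := (tendsto_finsetSum Finset.univ fun j _ => hα i j).const_mul ((Γ.speed t : ℂ)⁻¹)
  have b3 := tendsto_finsetSum Finset.univ fun j _ =>
    (hk.isLogKernel_K11_3 hy i j).tendsto_boundary ht (hud j) hc
  have L := (((l1.add l2).add l3).add l4).sub (b2.add b3)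
  simp only [Finset.sum_const_zero, mul_zero, add_zero, sub_zero] at L
  have e : (Γ.op (Γ.pull (M.K11_1 k₁ k₂)) (fun τ => w τ • φ τ) t
        + Γ.Ds (Γ.op (Γ.pull (M.K11_2 k₁ k₂)) (fun τ => (w τ)⁻¹ • Γ.Dsw w φ τ)) t
        + Γ.op (Γ.pull (M.K11_3 k₁ k₂)) (fun τ => (w τ)⁻¹ • Γ.Dsw w φ τ) t
        + Γ.Ds (Γ.op (Γ.pull (M.K11_4 k₁ k₂)) (fun τ => w τ • φ τ)) t) i
      = Γ.op (Γ.pull (M.K11_1 k₁ k₂)) (fun τ => w τ • φ τ) t i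
        + (Γ.speed t : ℂ)⁻¹
          * deriv (Γ.op (Γ.pull (M.K11_2 k₁ k₂)) (fun τ => (w τ)⁻¹ • Γ.Dsw w φ τ)) t i
        + Γ.op (Γ.pull (M.K11_3 k₁ k₂)) (fun τ => (w τ)⁻¹ • Γ.Dsw w φ τ) t i
        + (Γ.speed t : ℂ)⁻¹ * deriv (Γ.op (Γ.pull (M.K11_4 k₁ k₂)) (fun τ => w τ • φ τ)) t i := by
    simp only [Pi.add_apply, Ds, Pi.smul_apply, Complex.real_smul, Complex.ofReal_inv]
  rw [e]
  refine L.congr' ?_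
  filter_upwards [hnp] with r hr
  have hcut : Γ.outside t r = cutSet (n r) (p r) := hr.outside_eq
  have E := setIntegral_integrand (Γ := Γ)
    (K := fun t τ => (Γ.weightedKernel M k₁ k₂ w t τ).toBlocks₁₁) (φ := φ) (t := t)
    (s := cutSet (n r) (p r))
    (fun i j => (hy.cut_block₁₁ hk hb hb0 hw hφ ht hr.n_mem hr.p_mem i j).1) i
  rw [Pi.sub_apply, Pi.smul_apply, Complex.real_smul, Complex.ofReal_inv, hcut, E,
    Finset.sum_congr rfl fun j _ =>
    (hy.cut_block₁₁ hk hb hb0 hw hφ ht hr.n_mem hr.p_mem i j).2]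
  simp only [Fin.sum_univ_two]
  ring

/-- The upper right block: existence and value of the principal value. -/
theorem hasPV_block₁₂ {ψ : ℝ → Unit → ℂ} (hψ : ContDiffOn ℝ 2 ψ (Icc (-1) 1)) {t : ℝ}
    (ht : t ∈ Ioo (-1 : ℝ) 1) :
    Γ.HasPV (fun t τ => (Γ.weightedKernel M k₁ k₂ w t τ).toBlocks₁₂) ψ t
      (Γ.op (Γ.pull (M.K12_1 k₁ k₂)) (fun τ => (w τ)⁻¹ • ψ τ) t
        + Γ.Ds (Γ.op (Γ.pull (M.K12_2 k₁ k₂)) (fun τ => (w τ)⁻¹ • ψ τ)) t) := by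
  have D := hy.isDensity_weight_inv hb hb0 hw hψ
  obtain ⟨n, p, hnp⟩ := hy.exists_isBallCut ht
  have hc := hy.isCut_of_isBallCut ht hnp
  refine ⟨hy.integrableOn_outside ht fun a ha c hc i j =>
    (hy.cut_block₁₂ hk hb hb0 hw hψ ht ha hc i j).1, tendsto_pi_nhds.2 fun i => ?_⟩
  have l1 := tendsto_cut_op (hk.isLogKernel_K12_1 hy) D ht hc i
  have l2 := ((hasDerivAt_op (hk.isLogKernel_K12_2 hy) D ht).2 hc i).const_mul
    ((Γ.speed t : ℂ)⁻¹)
  have e : (Γ.op (Γ.pull (M.K12_1 k₁ k₂)) (fun τ => (w τ)⁻¹ • ψ τ) t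
        + Γ.Ds (Γ.op (Γ.pull (M.K12_2 k₁ k₂)) (fun τ => (w τ)⁻¹ • ψ τ)) t) i
      = Γ.op (Γ.pull (M.K12_1 k₁ k₂)) (fun τ => (w τ)⁻¹ • ψ τ) t i + (Γ.speed t : ℂ)⁻¹
        * deriv (Γ.op (Γ.pull (M.K12_2 k₁ k₂)) (fun τ => (w τ)⁻¹ • ψ τ)) t i := by
    simp only [Pi.add_apply, Ds, Pi.smul_apply, Complex.real_smul, Complex.ofReal_inv]
  rw [e]
  refine (l1.add l2).congr' ?_
  filter_upwards [hnp] with r hr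
  have hcut : Γ.outside t r = cutSet (n r) (p r) := hr.outside_eq
  have E := setIntegral_integrand (Γ := Γ)
    (K := fun t τ => (Γ.weightedKernel M k₁ k₂ w t τ).toBlocks₁₂) (φ := ψ) (t := t)
    (s := cutSet (n r) (p r))
    (fun i j => (hy.cut_block₁₂ hk hb hb0 hw hψ ht hr.n_mem hr.p_mem i j).1) i
  rw [hcut, E, Finset.sum_congr rfl fun j _ =>
    (hy.cut_block₁₂ hk hb hb0 hw hψ ht hr.n_mem hr.p_mem i j).2]
  simp only [Finset.sum_add_distrib, Finset.mul_sum]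

/-- The lower left block: existence and value of the principal value. -/
theorem hasPV_block₂₁ {φ : ℝ → Fin 2 → ℂ} (hφ : ContDiffOn ℝ 2 φ (Icc (-1) 1)) {t : ℝ}
    (ht : t ∈ Ioo (-1 : ℝ) 1) :
    Γ.HasPV (fun t τ => (Γ.weightedKernel M k₁ k₂ w t τ).toBlocks₂₁) φ t
      (Γ.op (Γ.pull (M.K21_1 k₁ k₂)) (fun τ => w τ • φ τ) t
        + Γ.op (Γ.pull (M.K21_2 k₁ k₂)) (fun τ => (w τ)⁻¹ • Γ.Dsw w φ τ) t) := by
  have D1 := hy.isDensity_weight hb hw hφ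
  have D2 := hy.isDensity_weight_inv_Dsw hb hb0 hw hφ
  obtain ⟨n, p, hnp⟩ := hy.exists_isBallCut ht
  have hc := hy.isCut_of_isBallCut ht hnp
  have hud : ∀ j, DifferentiableAt ℝ (fun τ => (w τ : ℂ) * φ τ j) t := fun j =>
    ((weight_mul_contDiffOn hb hw (contDiffOn_pi.1 hφ j)).differentiableOn
      (by simp)).differentiableAt (isOpen_Ioo.mem_nhds ht)
  refine ⟨hy.integrableOn_outside ht fun a ha c hc i j =>
    (hy.cut_block₂₁ hk hb hb0 hw hφ ht ha hc i j).1, tendsto_pi_nhds.2 fun i => ?_⟩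
  have l1 := tendsto_cut_op (hk.isLogKernel_K21_1 hy) D1 ht hc i
  have l2 := tendsto_cut_op (hk.isLogKernel_K21_2 hy) D2 ht hc i
  have b2 := tendsto_finsetSum Finset.univ fun j _ =>
    (hk.isLogKernel_K21_2 hy i j).tendsto_boundary ht (hud j) hc
  have L := (l1.add l2).sub b2
  simp only [Finset.sum_const_zero, sub_zero] at L
  rw [Pi.add_apply]
  refine L.congr' ?_
  filter_upwards [hnp] with r hr
  have hcut : Γ.outside t r = cutSet (n r) (p r) := hr.outside_eq
  have E := setIntegral_integrand (Γ := Γ)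
    (K := fun t τ => (Γ.weightedKernel M k₁ k₂ w t τ).toBlocks₂₁) (φ := φ) (t := t)
    (s := cutSet (n r) (p r))
    (fun i j => (hy.cut_block₂₁ hk hb hb0 hw hφ ht hr.n_mem hr.p_mem i j).1) i
  rw [hcut, E, Finset.sum_congr rfl fun j _ =>
    (hy.cut_block₂₁ hk hb hb0 hw hφ ht hr.n_mem hr.p_mem i j).2]
  simp only [Finset.sum_add_distrib, Finset.sum_sub_distrib]

end SmoothArc.IsExtension

/-- A `C²` extension of the smooth factor of an edge weight. -/
theorem IsEdgeWeight.exists_extension {w : ℝ → ℝ} (hw : IsEdgeWeight w) : ∃ b : ℝ → ℝ,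
    ContDiff ℝ 2 b ∧ (∀ t ∈ Icc (-1 : ℝ) 1, 0 < b t) ∧
      ∀ t ∈ Icc (-1 : ℝ) 1, w t = √(1 - t ^ 2) * b t := by
  obtain ⟨b₀, hb₀, h⟩ := hw
  obtain ⟨b, h1, h2⟩ := exists_contDiff_extension 2 b₀
    (hb₀.of_le (WithTop.coe_le_coe.2 (le_top : ((2 : ℕ) : ℕ∞) ≤ ⊤)))
  exact ⟨b, by exact_mod_cast h1, fun t ht => by rw [h2 ht]; exact (h t ht).1,
    fun t ht => by rw [h2 ht]; exact (h t ht).2⟩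

end ThermoArc

theorem theorem3p10 (M : ThermoArc.Medium) (k₁ k₂ : ℂ) (hk : M.IsWavenumberPair k₁ k₂)
    (Γ : ThermoArc.SmoothArc) (w : ℝ → ℝ) (hw : ThermoArc.IsEdgeWeight w) :
    -- all eight kernels are at most weakly singular
    (Γ.IsWeaklySingular (Γ.pull (M.K11_1 k₁ k₂)) ∧
      Γ.IsWeaklySingular (Γ.pull (M.K11_2 k₁ k₂)) ∧
      Γ.IsWeaklySingular (Γ.pull (M.K11_3 k₁ k₂)) ∧
      Γ.IsWeaklySingular (Γ.pull (M.K11_4 k₁ k₂)) ∧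
      Γ.IsWeaklySingular (Γ.pull (M.K12_1 k₁ k₂)) ∧
      Γ.IsWeaklySingular (Γ.pull (M.K12_2 k₁ k₂)) ∧
      Γ.IsWeaklySingular (Γ.pull (M.K21_1 k₁ k₂)) ∧
      Γ.IsWeaklySingular (Γ.pull (M.K21_2 k₁ k₂))) ∧
    -- the block 11
    (∀ φ : ℝ → Fin 2 → ℂ, ContDiffOn ℝ 2 φ (Icc (-1) 1) →
      (∀ t ∈ Ioo (-1 : ℝ) 1,
        Γ.Converges (Γ.pull (M.K11_1 k₁ k₂)) (fun τ => w τ • φ τ) t ∧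
        Γ.Converges (Γ.pull (M.K11_2 k₁ k₂)) (fun τ => (w τ)⁻¹ • Γ.Dsw w φ τ) t ∧
        Γ.Converges (Γ.pull (M.K11_3 k₁ k₂)) (fun τ => (w τ)⁻¹ • Γ.Dsw w φ τ) t ∧
        Γ.Converges (Γ.pull (M.K11_4 k₁ k₂)) (fun τ => w τ • φ τ) t ∧
        DifferentiableAt ℝ
          (Γ.op (Γ.pull (M.K11_2 k₁ k₂)) (fun τ => (w τ)⁻¹ • Γ.Dsw w φ τ)) t ∧
        DifferentiableAt ℝ (Γ.op (Γ.pull (M.K11_4 k₁ k₂)) (fun τ => w τ • φ τ)) t ∧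
        Γ.HasFP (fun t τ => (Γ.weightedKernel M k₁ k₂ w t τ).toBlocks₁₁) φ t
          (Γ.op (Γ.pull (M.K11_1 k₁ k₂)) (fun τ => w τ • φ τ) t
            + Γ.Ds (Γ.op (Γ.pull (M.K11_2 k₁ k₂)) (fun τ => (w τ)⁻¹ • Γ.Dsw w φ τ)) t
            + Γ.op (Γ.pull (M.K11_3 k₁ k₂)) (fun τ => (w τ)⁻¹ • Γ.Dsw w φ τ) t
            + Γ.Ds (Γ.op (Γ.pull (M.K11_4 k₁ k₂)) (fun τ => w τ • φ τ)) t))) ∧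
    -- the block 12
    (∀ ψ : ℝ → Unit → ℂ, ContDiffOn ℝ 2 ψ (Icc (-1) 1) →
      (∀ t ∈ Ioo (-1 : ℝ) 1,
        Γ.Converges (Γ.pull (M.K12_1 k₁ k₂)) (fun τ => (w τ)⁻¹ • ψ τ) t ∧
        Γ.Converges (Γ.pull (M.K12_2 k₁ k₂)) (fun τ => (w τ)⁻¹ • ψ τ) t ∧
        DifferentiableAt ℝ (Γ.op (Γ.pull (M.K12_2 k₁ k₂)) (fun τ => (w τ)⁻¹ • ψ τ)) t ∧
        Γ.HasPV (fun t τ => (Γ.weightedKernel M k₁ k₂ w t τ).toBlocks₁₂) ψ t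
          (Γ.op (Γ.pull (M.K12_1 k₁ k₂)) (fun τ => (w τ)⁻¹ • ψ τ) t
            + Γ.Ds (Γ.op (Γ.pull (M.K12_2 k₁ k₂)) (fun τ => (w τ)⁻¹ • ψ τ)) t))) ∧
    -- the block 21
    (∀ φ : ℝ → Fin 2 → ℂ, ContDiffOn ℝ 2 φ (Icc (-1) 1) →
      (∀ t ∈ Ioo (-1 : ℝ) 1,
        Γ.Converges (Γ.pull (M.K21_1 k₁ k₂)) (fun τ => w τ • φ τ) t ∧
        Γ.Converges (Γ.pull (M.K21_2 k₁ k₂)) (fun τ => (w τ)⁻¹ • Γ.Dsw w φ τ) t ∧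
        Γ.HasPV (fun t τ => (Γ.weightedKernel M k₁ k₂ w t τ).toBlocks₂₁) φ t
          (Γ.op (Γ.pull (M.K21_1 k₁ k₂)) (fun τ => w τ • φ τ) t
            + Γ.op (Γ.pull (M.K21_2 k₁ k₂)) (fun τ => (w τ)⁻¹ • Γ.Dsw w φ τ) t))) := by
  -- Smoothness up to the endpoints is traded for finitely many derivatives on the whole line, so
  -- that points of the closed square can be treated as interior ones.
  obtain ⟨y, hy⟩ := Γ.exists_isExtension
  obtain ⟨b, hb, hb0, hwb⟩ := hw.exists_extension
  refine ⟨⟨hy.isWeaklySingular (hk.isLogKernel_K11_1 hy),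
    hy.isWeaklySingular (hk.isLogKernel_K11_2 hy), hy.isWeaklySingular (hk.isLogKernel_K11_3 hy),
    hy.isWeaklySingular (hk.isLogKernel_K11_4 hy), hy.isWeaklySingular (hk.isLogKernel_K12_1 hy),
    hy.isWeaklySingular (hk.isLogKernel_K12_2 hy), hy.isWeaklySingular (hk.isLogKernel_K21_1 hy),
    hy.isWeaklySingular (hk.isLogKernel_K21_2 hy)⟩, fun φ hφ t ht => ?_, fun ψ hψ t ht => ?_,
    fun φ hφ t ht => ?_⟩
  · have D1 := hy.isDensity_weight hb hwb hφ
    have D2 := hy.isDensity_weight_inv_Dsw hb hb0 hwb hφ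
    exact ⟨ThermoArc.SmoothArc.converges (hk.isLogKernel_K11_1 hy) D1 ht,
      ThermoArc.SmoothArc.converges (hk.isLogKernel_K11_2 hy) D2 ht,
      ThermoArc.SmoothArc.converges (hk.isLogKernel_K11_3 hy) D2 ht,
      ThermoArc.SmoothArc.converges (hk.isLogKernel_K11_4 hy) D1 ht,
      (ThermoArc.SmoothArc.hasDerivAt_op (hk.isLogKernel_K11_2 hy) D2 ht).1,
      (ThermoArc.SmoothArc.hasDerivAt_op (hk.isLogKernel_K11_4 hy) D1 ht).1,
      hy.hasFP_block₁₁ hk hb hb0 hwb hφ ht⟩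
  · have D := hy.isDensity_weight_inv hb hb0 hwb hψ
    exact ⟨ThermoArc.SmoothArc.converges (hk.isLogKernel_K12_1 hy) D ht,
      ThermoArc.SmoothArc.converges (hk.isLogKernel_K12_2 hy) D ht,
      (ThermoArc.SmoothArc.hasDerivAt_op (hk.isLogKernel_K12_2 hy) D ht).1,
      hy.hasPV_block₁₂ hk hb hb0 hwb hψ ht⟩
  · exact ⟨ThermoArc.SmoothArc.converges (hk.isLogKernel_K21_1 hy)
        (hy.isDensity_weight hb hwb hφ) ht,
      ThermoArc.SmoothArc.converges (hk.isLogKernel_K21_2 hy)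
        (hy.isDensity_weight_inv_Dsw hb hb0 hwb hφ) ht,
      hy.hasPV_block₂₁ hk hb hb0 hwb hφ ht⟩
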